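/- Let $G$ be a compact connected Lie group with simple Lie algebra $\mathfrak g$, let $T\subset G$ be a maximal torus with Lie algebra $\mathfrak t$, let $R\subset\mathfrak t^*$ be the set of roots, and let $\langle\cdot,\cdot\rangle$ be a $G$-invariant positive definite symmetric bilinear form on $\mathfrak g$, used to embed $\mathfrak t^*$ in $\mathfrak g^*$. Let $p_0\in\mathfrak t^*\subset\mathfrak g^*$ lie in the interior of a Weyl chamber, i.e. $\langle p_0,\alpha\rangle\neq 0$ for all $\alpha\in R$. Let $M=\mathcal O_{p_0}=G\cdot p_0\subset\mathfrak g^*$ be its coadjoint orbit with the Kirillov--Kostant form $\omega_p(X\cdot p,Y\cdot p)=p([X,Y])$, and let $\psi\colon M\to\mathfrak t^*$, $\psi(p)=p|_{\mathfrak t}$, be the moment map for the action of $T$. For $p\in M^T$ let $\Pi_p\subset\mathfrak t^*$ be the set of weights of the isotropy representation of $T$ on $T_pM$, with respect to a $T$-invariant complex structure compatible with $\omega$ (so that $\Pi_p=\{\alpha\in R\mid\langle p,\alpha\rangle>0\}$). Let $\xi\in\mathfrak t$ be generic, i.e. $\langle\eta,\xi\rangle\ne0$ for all $p\in M^T$ and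 $\eta\in\Pi_p$, and let $\varphi=\psi^\xi\colon M\to\mathbb R$, $\varphi(p)=\langle\psi(p),\xi\rangle$. For $p\in M^T$ let $2\lambda(p)$ be the index of the Morse function $\varphi$ at $p$, and let $$\Lambda_p^-=\prod_{\eta\in\Pi_p,\ \langle\eta,\xi\rangle>0}\eta\ \in\ \mathrm{Sym}(\mathfrak t^*),$$ the product of the weights on the negative normal bundle of $\varphi$ at $p$. The GKM graph $(V,E_{GKM})$ of $M$ has $V=M^T$, and for $p\ne q$ in $V$ one has $(p,q)\in E_{GKM}$ exactly if there is a codimension one closed subgroup $K\subset T$ such that $p$ and $q$ lie in the same connected component $N$ of $M^K$; in this case $\eta(p,q)\in\mathfrak t^*$ is the weight of the representation of $T$ on $T_qN$. For $\eta\in\mathfrak t^*$ with $\langle\eta,\xi\rangle\ne0$ let $\rho_\eta$ be the algebra endomorphism of $\mathrm{Sym}(\mathfrak t^*)$ induced by $X\mapsto X-\frac{\langle X,\xi\rangle}{\langle\eta,\xi\rangle}\eta$ on $\mathfrak t^*$. For $(p,q)\in E_{GKM}$ such that $\eta(p,q)$ divides $\Lambda_q^-$, put $$\Theta(p,q)=\frac{\rho_{\eta(p,q)}(\Lambda_p^-)}{\rho_{\eta(p,q)}\!\left(\Lambda_q^-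 /\eta(p,q)\right)}\ \in\ \mathrm{Frac}\,\mathrm{Sym}(\mathfrak t^*).$$ Then for every $(p,q)\in E_{GKM}$ with $\lambda(q)-\lambda(p)=1$, the weight $\eta(p,q)$ divides $\Lambda_q^-$, the denominator above is nonzero, and $$\Theta(p,q)=1 .$$ -/

import Mathlib

open scoped Manifold ContDiff

noncomputable section

namespace CoadjointGKM

/-- A smooth real Lie group has the regularity that Mathlib asks for in its Lie algebra. -/
instance instLEInftyMinSmoothness : ENat.LEInfty (minSmoothness ℝ 3) :=
  ⟨by rw [minSmoothness_of_isRCLikeNormedField]; exact ENat.LEInfty.out⟩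

section LieGroups

variable (E : Type*) [NormedAddCommGroup E] [NormedSpace ℝ E]
  (G : Type*) [TopologicalSpace G] [ChartedSpace E G] [Group G]

/-- The Lie algebra `𝔤` of `G` (tangent space at the identity, Mathlib's Lie bracket). -/
abbrev LieAlg := GroupLieAlgebra 𝓘(ℝ, E) G

/-- The dual space `𝔤*`, with its usual topology. -/
abbrev CoLieAlg := StrongDual ℝ (LieAlg E G)

instance instFiniteDimensionalLieAlg [FiniteDimensional ℝ E] :
    FiniteDimensional ℝ (LieAlg E G) :=
  inferInstanceAs (FiniteDimensional ℝ E)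

instance instT2SpaceLieAlg : T2Space (LieAlg E G) :=
  inferInstanceAs (T2Space E)

variable {G}

/-- `T` is a maximal torus of the (compact) Lie group `G`: a maximal element among the closed
connected commutative subgroups. -/
def IsMaximalTorus (T : Subgroup G) : Prop :=
  Maximal (fun S : Subgroup G => IsClosed (S : Set G) ∧ IsConnected (S : Set G) ∧
    ∀ a ∈ S, ∀ b ∈ S, a * b = b * a) T

/-- The Lie algebra of a (closed) subgroup `S`: all `X` such that `exp (t X) ∈ S` for all `t`.
The curve `t ↦ exp (t X)` is the integral curve through `1` of the left invariant vector field
defined by `X`.  (For closed `S` the set of these `X` is a subspace; the span makes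
it one by definition.) -/
def lieAlgOf (S : Subgroup G) : Submodule ℝ (LieAlg E G) :=
  Submodule.span ℝ {X | ∃ γ : ℝ → G, γ 0 = 1 ∧
    IsMIntegralCurve (I := 𝓘(ℝ, E)) γ (mulInvariantVectorField X) ∧ ∀ t, γ t ∈ S}

/-- The dual `𝔱*` of the Lie algebra of the subgroup `T`. -/
abbrev TorusDual (T : Subgroup G) := Module.Dual ℝ (lieAlgOf E T)

/-- The adjoint action `Ad g` on `𝔤`: the differential at `1` of `x ↦ g x g⁻¹`. -/
def Ad (g : G) : LieAlg E G →L[ℝ] LieAlg E G :=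
  (mfderiv 𝓘(ℝ, E) 𝓘(ℝ, E) (fun x : G => g * x * g⁻¹) 1 : E →L[ℝ] E)

/-- The coadjoint action `(g · p)(X) = p (Ad g⁻¹ X)` on `𝔤*`. -/
def coAd (g : G) (p : CoLieAlg E G) : CoLieAlg E G := p.comp (Ad E g⁻¹)

/-- A positive definite symmetric `G`-invariant bilinear form on `𝔤`. -/
structure IsInvariantInner (B : LinearMap.BilinForm ℝ (LieAlg E G)) : Prop where
  symm : ∀ X Y, B X Y = B Y X
  pos : ∀ X, X ≠ 0 → 0 < B X X
  invariant : ∀ (g : G) X Y, B (Ad E g X) (Ad E g Y) = B X Y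

variable {E}

/-- The coadjoint orbit `𝒪 = G · p₀` as a subset of `𝔤*`. -/
def coadOrbit (p₀ : CoLieAlg E G) : Set (CoLieAlg E G) :=
  {p | ∃ g : G, p = coAd E g p₀}

/-- The points of the orbit fixed by a subgroup `K`. For `K = T` this is the vertex set `V` of the
GKM graph. -/
def fixedSet (p₀ : CoLieAlg E G) (K : Subgroup G) : Set (CoLieAlg E G) :=
  {p | p ∈ coadOrbit p₀ ∧ ∀ k ∈ K, coAd E k p = p}

/-- The moment map `ψ` for the `T`-action on the orbit: the inclusion into `𝔤*` followed by the
restriction `𝔤* → 𝔱*`. -/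
def momentMap (T : Subgroup G) (p : CoLieAlg E G) : TorusDual E T :=
  (p : LieAlg E G →ₗ[ℝ] ℝ).domRestrict (lieAlgOf E T)

/-- The component `φ = ψ^ξ` of the moment map. -/
def momentComponent {T : Subgroup G} (ξ : lieAlgOf E T) (p : CoLieAlg E G) : ℝ :=
  momentMap T p ξ

variable [FiniteDimensional ℝ E] [LieGroup 𝓘(ℝ, E) ∞ G] [CompleteSpace E]

/-- The roots of `G` with respect to the torus `T`: nonzero `α ∈ 𝔱*` such that
`[H, Z] = i α(H) Z` for all `H ∈ 𝔱`, for some nonzero `Z = X - i Y` in the complexification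
of `𝔤`. -/
def roots (T : Subgroup G) : Set (TorusDual E T) :=
  {α | α ≠ 0 ∧ ∃ X Y : LieAlg E G, (X ≠ 0 ∨ Y ≠ 0) ∧ ∀ H : lieAlgOf E T,
    ⁅(H : LieAlg E G), X⁆ = α H • Y ∧ ⁅(H : LieAlg E G), Y⁆ = -(α H) • X}

/-- `p₀` lies in `𝔱*`, embedded in `𝔤*` by means of the invariant form `B`, and it lies in the
interior of a Weyl chamber, that is, on no root hyperplane. For `p₀ = B(H₀, ·)` with `H₀ ∈ 𝔱` the
pairing `⟨p₀, α⟩` is `α(H₀)`. -/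
def IsGenericPoint (B : LinearMap.BilinForm ℝ (LieAlg E G)) (T : Subgroup G)
    (p₀ : CoLieAlg E G) : Prop :=
  ∃ H₀ : lieAlgOf E T, (∀ X, p₀ X = B H₀ X) ∧ ∀ α ∈ roots T, α H₀ ≠ 0

/-- The infinitesimal coadjoint action `X · p = d/dt (exp (t X) · p)` at `t = 0`, so
`(X · p)(Y) = - p [X, Y]`. -/
def coadInf (X : LieAlg E G) : CoLieAlg E G →ₗ[ℝ] CoLieAlg E G where
  toFun p := -(p.comp (LinearMap.toContinuousLinearMap
    (LieAlgebra.ad ℝ (LieAlg E G) X : LieAlg E G →ₗ[ℝ] LieAlg E G)))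
  map_add' p q := by ext; simp; ring
  map_smul' c p := by ext; simp

@[simp] theorem coadInf_apply (X : LieAlg E G) (p : CoLieAlg E G) (Y : LieAlg E G) :
    coadInf X p Y = -p ⁅X, Y⁆ := by
  simp [coadInf]

/-- The map `X ↦ X · p` from `𝔤` onto the tangent space of the orbit at `p`. -/
def orbitVelocity (p : CoLieAlg E G) : LieAlg E G →ₗ[ℝ] CoLieAlg E G where
  toFun X := coadInf X p
  map_add' X Y := by ext Z; simp; ring
  map_smul' c X := by ext Z; simp

/-- The tangent space `T_p 𝒪 = {X · p | X ∈ 𝔤}` of a coadjoint orbit at `p`. -/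
def orbitTangent (p : CoLieAlg E G) : Submodule ℝ (CoLieAlg E G) :=
  LinearMap.range (orbitVelocity p)

/-- Some `X ∈ 𝔤` with `X · p = v`. -/
def lift (p : CoLieAlg E G) (v : orbitTangent p) : LieAlg E G :=
  Classical.choose (LinearMap.mem_range.mp v.2)

theorem coadInf_lift (p : CoLieAlg E G) (v : orbitTangent p) :
    coadInf (lift p v) p = v :=
  Classical.choose_spec (LinearMap.mem_range.mp v.2)

/-- The Kirillov-Kostant form `ω_p (X · p, Y · p) = p [X, Y]` on `T_p 𝒪`. -/
def kksForm (p : CoLieAlg E G) (v w : orbitTangent p) : ℝ :=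
  p ⁅lift p v, lift p w⁆

/-- The Kirillov-Kostant form does not depend on the choice of representatives. -/
theorem kksForm_eq (p : CoLieAlg E G) (v w : orbitTangent p) (X Y : LieAlg E G)
    (hX : coadInf X p = v) (hY : coadInf Y p = w) : kksForm p v w = p ⁅X, Y⁆ := by
  have h1 : coadInf (lift p v) p (lift p w) = coadInf X p (lift p w) := by
    rw [coadInf_lift, hX]
  have h2 : coadInf (lift p w) p X = coadInf Y p X := by rw [coadInf_lift, hY]
  simp only [coadInf_apply, neg_inj] at h1 h2
  rw [kksForm, h1, ← lie_skew, map_neg, h2, ← map_neg, lie_skew]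

/-- The weights of the torus `T` on a `T`-invariant symplectic subspace `S` of `T_p 𝒪`, where `p` is
fixed by `T`. They are taken with respect to an invariant complex structure `J` compatible with the
Kirillov-Kostant form: `η` is a weight if `H · v = η(H) J v` for some `v ≠ 0` and all `H ∈ 𝔱`.
Here `w` is `J v`, which has `ω (v, J v) > 0`; in particular `v ≠ 0`. -/
def weightsOn (T : Subgroup G) (p : CoLieAlg E G) (S : Submodule ℝ (orbitTangent p)) :
    Set (TorusDual E T) :=
  {η | ∃ v ∈ S, ∃ w ∈ S, 0 < kksForm p v w ∧ ∀ H : lieAlgOf E T,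
    coadInf (H : LieAlg E G) (v : CoLieAlg E G) = η H • (w : CoLieAlg E G) ∧
    coadInf (H : LieAlg E G) (w : CoLieAlg E G) = -(η H) • (v : CoLieAlg E G)}

/-- The set `Π_p` of weights of the isotropy representation of `T` on `T_p 𝒪`. -/
def weights (T : Subgroup G) (p : CoLieAlg E G) : Set (TorusDual E T) :=
  weightsOn T p ⊤

/-- `φ = ψ^ξ` is a generic component of the moment map: no weight at a fixed point vanishes
on `ξ`. -/
def IsGenericComponent (p₀ : CoLieAlg E G) (T : Subgroup G) (ξ : lieAlgOf E T) : Prop :=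
  ∀ p ∈ fixedSet p₀ T, ∀ η ∈ weights T p, η ξ ≠ 0

/-- The Hessian of `φ = ψ^ξ` at a critical point `p` of the orbit, as a quadratic form on `T_p 𝒪`:
for `v = X · p` it is the second derivative at `t = 0` of `φ (exp (t X) · p)`,
which equals `φ (X · (X · p))`. -/
def hessian {T : Subgroup G} (ξ : lieAlgOf E T) (p : CoLieAlg E G) (v : orbitTangent p) : ℝ :=
  momentComponent ξ (coadInf (lift p v) (v : CoLieAlg E G))

/-- At a point fixed by the infinitesimal action of `ξ` the Hessian does not depend on the choice
of representatives. -/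
theorem hessian_eq {T : Subgroup G} (ξ : lieAlgOf E T) (p : CoLieAlg E G)
    (hp : coadInf (ξ : LieAlg E G) p = 0) (v : orbitTangent p) (X : LieAlg E G)
    (hX : coadInf X p = v) :
    hessian ξ p v = momentComponent ξ (coadInf X (coadInf X p)) := by
  have key : ∀ Z : LieAlg E G, p ⁅(ξ : LieAlg E G), Z⁆ = 0 := fun Z => by
    have := congrArg (fun f : CoLieAlg E G => f Z) hp
    simpa using this
  have hv : ∀ Z : LieAlg E G, p ⁅lift p v, Z⁆ = p ⁅X, Z⁆ := fun Z => by
    have := congrArg (fun f : CoLieAlg E G => f Z) ((coadInf_lift p v).trans hX.symm)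
    simpa using this
  have jac : ∀ A C : LieAlg E G, p ⁅A, ⁅C, (ξ : LieAlg E G)⁆⁆ = p ⁅C, ⁅A, (ξ : LieAlg E G)⁆⁆ := by
    intro A C
    rw [leibniz_lie A C, map_add, ← lie_skew ⁅A, C⁆, map_neg, key, neg_zero, zero_add]
  have e : ∀ A C : LieAlg E G,
      momentComponent ξ (coadInf A (coadInf C p)) = p ⁅C, ⁅A, (ξ : LieAlg E G)⁆⁆ := by
    intro A C
    simp [momentComponent, momentMap]
  rw [hessian, ← hX, e, e, jac, hv]

/-- The index of `φ = ψ^ξ` at `p`: the largest dimension of a subspace of `T_p 𝒪` on which the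
Hessian is negative definite. -/
def morseIndex {T : Subgroup G} (ξ : lieAlgOf E T) (p : CoLieAlg E G) : ℕ :=
  sSup {k | ∃ N : Submodule ℝ (orbitTangent p), Module.finrank ℝ N = k ∧
    ∀ v ∈ N, v ≠ 0 → hessian ξ p v < 0}

/-- `λ(p)`: the index of `φ` at `p` is `2 λ(p)`. -/
def lam {T : Subgroup G} (ξ : lieAlgOf E T) (p : CoLieAlg E G) : ℕ :=
  morseIndex ξ p / 2

/-- The set `Π_p^-` of weights on the negative normal bundle of `φ` at `p`, i.e. the positive
weights at `p`. -/
def negWeights {T : Subgroup G} (ξ : lieAlgOf E T) (p : CoLieAlg E G) :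
    Set (TorusDual E T) :=
  {η | η ∈ weights T p ∧ 0 < η ξ}

/-- The symmetric algebra `Sym(𝔱*)`. -/
abbrev SymT (E : Type*) [NormedAddCommGroup E] [NormedSpace ℝ E]
    {G : Type*} [TopologicalSpace G] [ChartedSpace E G] [Group G] (T : Subgroup G) :=
  SymmetricAlgebra ℝ (TorusDual E T)

/-- `Λ_p^- ∈ Sym(𝔱*)`, the product of the weights on the negative normal bundle at `p`. -/
def lamMinus {T : Subgroup G} (ξ : lieAlgOf E T) (p : CoLieAlg E G) : SymT E T :=
  ∏ᶠ η ∈ negWeights ξ p, SymmetricAlgebra.ι ℝ (TorusDual E T) η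

/-- The homomorphism `ρ_η` of `Sym(𝔱*)` induced by the projection
`X ↦ X - (⟨X, ξ⟩ / ⟨η, ξ⟩) η`. -/
def rho {T : Subgroup G} (ξ : lieAlgOf E T) (η : TorusDual E T) : SymT E T →ₐ[ℝ] SymT E T :=
  SymmetricAlgebra.lift ((SymmetricAlgebra.ι ℝ (TorusDual E T)).comp
    (LinearMap.id - ((η ξ)⁻¹ • (Module.Dual.eval ℝ (lieAlgOf E T) ξ)).smulRight η))

/-- The subspace of `T_p 𝒪` fixed by a subgroup `K`: the tangent space at `p` of the component
through `p` of the fixed submanifold of `K`. -/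
def fixedTangent (p : CoLieAlg E G) (K : Subgroup G) : Submodule ℝ (orbitTangent p) where
  carrier := {v | ∀ k ∈ K, coAd E k (v : CoLieAlg E G) = v}
  zero_mem' := fun k _ => by simp [coAd]
  add_mem' := fun {v w} hv hw k hk => by
    have h1 := hv k hk
    have h2 := hw k hk
    simp only [coAd] at h1 h2
    simp [coAd, ContinuousLinearMap.add_comp, h1, h2]
  smul_mem' := fun c v hv k hk => by
    have h1 := hv k hk
    simp only [coAd] at h1
    simp [coAd, ContinuousLinearMap.smul_comp, h1]

/-- `K` is a codimension one (closed) subgroup of `T` such that `p` and `q` lie in the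
same connected component of the set of points of the orbit fixed by `K`. -/
def Joins (p₀ : CoLieAlg E G) (T : Subgroup G) (p q : CoLieAlg E G) (K : Subgroup G) : Prop :=
  K ≤ T ∧ IsClosed (K : Set G) ∧
  Module.finrank ℝ (lieAlgOf E K) + 1 = Module.finrank ℝ (lieAlgOf E T) ∧
  q ∈ connectedComponentIn (fixedSet p₀ K) p

/-- `(p, q)` is an edge of the GKM graph of the orbit of `p₀`. -/
def IsGKMEdge (p₀ : CoLieAlg E G) (T : Subgroup G) (p q : CoLieAlg E G) : Prop :=
  p ∈ fixedSet p₀ T ∧ q ∈ fixedSet p₀ T ∧ p ≠ q ∧ ∃ K, Joins p₀ T p q K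

open Classical in
/-- The label `η(p, q)` of an edge: the weight of the isotropy representation of `T` on `T_q N`,
where `N` is the component of the fixed submanifold of `K` through `p` and `q`, for a codimension
one subgroup `K` as in the definition of an edge (value `0` if there is no such weight). -/
def edgeWeight (p₀ : CoLieAlg E G) (T : Subgroup G) (p q : CoLieAlg E G) : TorusDual E T :=
  if h : ∃ η, ∃ K, Joins p₀ T p q K ∧ η ∈ weightsOn T q (fixedTangent q K) then
    Classical.choose h
  else 0

open Classical in
/-- The quotient `a / b` in `Sym(𝔱*)` (value `0` if `b` does not divide `a`). -/
def exactQuot {T : Subgroup G} (a b : SymT E T) : SymT E T :=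
  if h : b ∣ a then Classical.choose h else 0

/-- `Θ(p, q) = ρ_η (Λ_p^-) / ρ_η (Λ_q^- / η)` with `η = η(p, q)`, in the field of fractions of
`Sym(𝔱*)`. -/
def Theta (p₀ : CoLieAlg E G) {T : Subgroup G} (ξ : lieAlgOf E T) (p q : CoLieAlg E G) :
    FractionRing (SymT E T) :=
  algebraMap (SymT E T) (FractionRing (SymT E T))
      (rho ξ (edgeWeight p₀ T p q) (lamMinus ξ p)) /
    algebraMap (SymT E T) (FractionRing (SymT E T))
      (rho ξ (edgeWeight p₀ T p q)
        (exactQuot (lamMinus ξ q) (SymmetricAlgebra.ι ℝ (TorusDual E T) (edgeWeight p₀ T p q))))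

end LieGroups

end CoadjointGKM

end

/-! The form `B` identifies the fixed points `p`, `q` with vectors `P`, `Q ∈ 𝔱`. Both are conjugates
of `H₀`, hence regular and of equal length. The weights at `p` are the roots `β` with `β(P) > 0`
(`weights_eq`). At `X · p` the Hessian is `-∑ β(ξ) β(P) B(X_β, X_β)` over the root components of
`X`. So the index is the sum of the dimensions of the real root spaces over `Π_p^-`
(`morseIndex_eq`).

An edge is a reflection. On the component of the `K`-fixed points, the Killing pairing with a vector
`Z` that commutes with everything fixed by `K` is continuous. It takes finitely many values, because
it is the trace of a product of commuting skew operators with controlled spectra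
(`finite_trace_mul`); hence it is constant. If no root vanished on `Lie K`, this would force `P =
Q`. So the label is a root `α` with kernel `Lie K`; constancy for `Z ∈ ker α` gives `Q - P ∈ ℝ h`
for the coroot `h`, and equality of lengths gives `Q = s P` with the reflection `s` in `α`
(`reflection_of_joins`).

Now let `α(ξ) > 0`. Send `β ∈ Π_p^-` to `β ∘ s` if this is still positive on `ξ`, and to `β`
otherwise. This is an injection of `Π_p^-` into `Π_q^- \ {α}` that preserves the dimensions of root
spaces. Each root space has dimension at least 2, so an index difference of at most 3 leaves no room
for a root outside the image besides `α`. The injection is then a bijection onto `Π_q^- \ {α}` that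
changes each root by a multiple of `α`. Since `ρ_α` kills `α`, numerator and denominator of `Θ`
coincide. The case `α(ξ) < 0` is excluded by the same injection with `p` and `q` exchanged.

The groundwork consists of two facts about Lie groups: the derivative of `Ad` is `ad`, and the Lie
algebra of a maximal torus is its own centralizer (`IsMaximalTorus.mem_lieAlgOf`). Together with `B`
they yield the root space decomposition over `ℝ`. -/

open scoped Manifold ContDiff Topology

noncomputable section

namespace CoadjointGKM

/-! ### Multiplication and translations in the chart at the identity -/

section

variable {E : Type*} [NormedAddCommGroup E] [NormedSpace ℝ E]
  {G : Type*} [TopologicalSpace G] [ChartedSpace E G] [Group G]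

/-- Multiplication read in the chart at the identity. -/
def chartMul (E : Type*) [NormedAddCommGroup E] [NormedSpace ℝ E]
    (G : Type*) [TopologicalSpace G] [ChartedSpace E G] [Group G] (z : E × E) : E :=
  extChartAt 𝓘(ℝ, E) (1 : G)
    ((extChartAt 𝓘(ℝ, E) (1 : G)).symm z.1 * (extChartAt 𝓘(ℝ, E) (1 : G)).symm z.2)

/-- The coordinates of the identity. -/
def chartOne (E : Type*) [NormedAddCommGroup E] [NormedSpace ℝ E]
    (G : Type*) [TopologicalSpace G] [ChartedSpace E G] [Group G] : E :=
  extChartAt 𝓘(ℝ, E) (1 : G) 1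

@[simp] lemma extChartAt_symm_chartOne :
    (extChartAt 𝓘(ℝ, E) (1 : G)).symm (chartOne E G) = 1 := by
  exact (extChartAt 𝓘(ℝ, E) (1 : G)).left_inv (mem_extChartAt_source (1 : G))

variable [LieGroup 𝓘(ℝ, E) ∞ G]

lemma contMDiffAt_extChartAt_one_symm : ContMDiffAt 𝓘(ℝ, E) 𝓘(ℝ, E) ∞
    (extChartAt 𝓘(ℝ, E) (1 : G)).symm (chartOne E G) :=
  (contMDiffOn_extChartAt_symm (1 : G)).contMDiffAt (extChartAt_target_mem_nhds 1)

lemma contDiffAt_chartMul : ContDiffAt ℝ ∞ (chartMul E G) (chartOne E G, chartOne E G) := by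
  rw [← contMDiffAt_iff_contDiffAt]
  have h1 : ContMDiffAt 𝓘(ℝ, E × E) 𝓘(ℝ, E) ∞
      (fun z : E × E => (extChartAt 𝓘(ℝ, E) (1 : G)).symm z.1) (chartOne E G, chartOne E G) :=
    ContMDiffAt.comp (I' := 𝓘(ℝ, E)) _ contMDiffAt_extChartAt_one_symm contDiff_fst.contMDiff.contMDiffAt
  have h2 : ContMDiffAt 𝓘(ℝ, E × E) 𝓘(ℝ, E) ∞
      (fun z : E × E => (extChartAt 𝓘(ℝ, E) (1 : G)).symm z.2) (chartOne E G, chartOne E G) :=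
    ContMDiffAt.comp (I' := 𝓘(ℝ, E)) _ contMDiffAt_extChartAt_one_symm contDiff_snd.contMDiff.contMDiffAt
  refine ContMDiffAt.comp (I' := 𝓘(ℝ, E)) _ ?_ (h1.mul h2)
  simp only [extChartAt_symm_chartOne, mul_one]
  exact contMDiffAt_extChartAt

/-- The differential of the chart at the identity composed with that of left translation. -/
def chartLeft (g : G) : E →L[ℝ] E :=
  (mfderiv 𝓘(ℝ, E) 𝓘(ℝ, E) (extChartAt 𝓘(ℝ, E) (1 : G)) g : E →L[ℝ] E).comp
    (mfderiv 𝓘(ℝ, E) 𝓘(ℝ, E) (fun x : G => g * x) 1 : E →L[ℝ] E)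

/-- The differential of the chart at the identity composed with that of right translation. -/
def chartRight (g : G) : E →L[ℝ] E :=
  (mfderiv 𝓘(ℝ, E) 𝓘(ℝ, E) (extChartAt 𝓘(ℝ, E) (1 : G)) g : E →L[ℝ] E).comp
    (mfderiv 𝓘(ℝ, E) 𝓘(ℝ, E) (fun x : G => x * g) 1 : E →L[ℝ] E)

variable (E) in
/-- The adjoint action as an operator on the model space. -/
def adOp (g : G) : E →L[ℝ] E :=
  mfderiv 𝓘(ℝ, E) 𝓘(ℝ, E) (fun x : G => g * x * g⁻¹) 1

lemma mdifferentiable_mul_left (g : G) :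
    MDifferentiable 𝓘(ℝ, E) 𝓘(ℝ, E) (fun x : G => g * x) :=
  (contMDiff_mul_left (I := 𝓘(ℝ, E)) (n := ∞)).mdifferentiable (by simp)

lemma mdifferentiable_mul_right (g : G) :
    MDifferentiable 𝓘(ℝ, E) 𝓘(ℝ, E) (fun x : G => x * g) :=
  (contMDiff_mul_right (I := 𝓘(ℝ, E)) (n := ∞)).mdifferentiable (by simp)

lemma mdifferentiable_conj (g : G) :
    MDifferentiable 𝓘(ℝ, E) 𝓘(ℝ, E) (fun x : G => g * x * g⁻¹) :=
  (mdifferentiable_mul_right (E := E) g⁻¹).comp (mdifferentiable_mul_left (E := E) g)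

lemma hasMFDerivAt_conj (g : G) :
    HasMFDerivAt 𝓘(ℝ, E) 𝓘(ℝ, E) (fun x : G => g * x * g⁻¹) 1 (adOp E g) :=
  (mdifferentiable_conj g 1).hasMFDerivAt

/-- Chain rule for `g x = (g x g⁻¹) g`. This expresses `Ad g` by the two partial derivatives of the
multiplication. -/
lemma chartLeft_eq (g : G) : (chartLeft g : E →L[ℝ] E) = (chartRight g).comp (adOp E g) := by
  have h1 : HasMFDerivAt 𝓘(ℝ, E) 𝓘(ℝ, E) (fun x : G => g * x) 1
     ((mfderiv 𝓘(ℝ, E) 𝓘(ℝ, E) (fun x : G => x * g) 1 : E →L[ℝ] E).comp (adOp E g)) := by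
    have h2 : HasMFDerivAt 𝓘(ℝ, E) 𝓘(ℝ, E) (fun x : G => x * g) (g * 1 * g⁻¹)
      (mfderiv 𝓘(ℝ, E) 𝓘(ℝ, E) (fun x : G => x * g) 1 : E →L[ℝ] E) := by
      have e : g * 1 * g⁻¹ = 1 := by simp
      rw [e]
      exact (mdifferentiable_mul_right (E := E) g 1).hasMFDerivAt
    have h3 := h2.comp (1 : G) (hasMFDerivAt_conj (E := E) g)
    have e : (fun x : G => x * g) ∘ (fun x : G => g * x * g⁻¹) = fun x => g * x := by
      funext x; simp
    rw [e] at h3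
    exact h3
  have h4 := h1.mfderiv
  ext v
  exact congrArg (fun f : E →L[ℝ] E => (mfderiv 𝓘(ℝ, E) 𝓘(ℝ, E) (extChartAt 𝓘(ℝ, E) (1 : G)) g : E →L[ℝ] E) (f v)) h4

lemma hasMFDerivAt_extChartAt_one_symm : HasMFDerivAt 𝓘(ℝ, E) 𝓘(ℝ, E)
    (extChartAt 𝓘(ℝ, E) (1 : G)).symm (chartOne E G) (ContinuousLinearMap.id ℝ E) := by
  have h := (contMDiffAt_extChartAt_one_symm (E := E) (G := G)).mdifferentiableAt (by simp)
  have h2 := h.hasMFDerivAt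
  have h3 := mfderivWithin_range_extChartAt_symm (I := 𝓘(ℝ, E)) (x := (1 : G))
  rw [show Set.range 𝓘(ℝ, E) = Set.univ from 𝓘(ℝ, E).range_eq_univ, mfderivWithin_univ] at h3
  exact (show _ = (ContinuousLinearMap.id ℝ E) from h3) ▸ h2

lemma hasMFDerivAt_extChartAt_one : HasMFDerivAt 𝓘(ℝ, E) 𝓘(ℝ, E)
    (extChartAt 𝓘(ℝ, E) (1 : G)) 1 (ContinuousLinearMap.id ℝ E) := by
  have h := (contMDiffAt_extChartAt (I := 𝓘(ℝ, E)) (x := (1 : G)) (n := ∞)).mdifferentiableAt (by simp)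
  have h3 := mfderiv_extChartAt_self (I := 𝓘(ℝ, E)) (x := (1 : G))
  exact (show _ = (ContinuousLinearMap.id ℝ E) from h3) ▸ h.hasMFDerivAt

/-- Near the identity `chartLeft` is a partial derivative of the multiplication. -/
lemma hasFDerivAt_chartMul_right (x : E) (hx : (extChartAt 𝓘(ℝ, E) (1 : G)).symm x ∈ (extChartAt 𝓘(ℝ, E) (1 : G)).source) :
    HasFDerivAt (fun y => chartMul E G (x, y)) (chartLeft ((extChartAt 𝓘(ℝ, E) (1 : G)).symm x)) (chartOne E G) := by
  set g := (extChartAt 𝓘(ℝ, E) (1 : G)).symm x with hg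
  have h1 : HasMFDerivAt 𝓘(ℝ, E) 𝓘(ℝ, E) (extChartAt 𝓘(ℝ, E) (1 : G)) (g * (extChartAt 𝓘(ℝ, E) (1 : G)).symm (chartOne E G))
      (mfderiv 𝓘(ℝ, E) 𝓘(ℝ, E) (extChartAt 𝓘(ℝ, E) (1 : G)) g : E →L[ℝ] E) := by
    rw [extChartAt_symm_chartOne, mul_one]
    exact (mdifferentiableAt_extChartAt (by simpa using hx)).hasMFDerivAt
  have h2 : HasMFDerivAt 𝓘(ℝ, E) 𝓘(ℝ, E) (fun y : G => g * y) ((extChartAt 𝓘(ℝ, E) (1 : G)).symm (chartOne E G))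
      (mfderiv 𝓘(ℝ, E) 𝓘(ℝ, E) (fun y : G => g * y) 1 : E →L[ℝ] E) := by
    rw [extChartAt_symm_chartOne]
    exact (mdifferentiable_mul_left (E := E) g 1).hasMFDerivAt
  exact (h1.comp (chartOne E G)
    (h2.comp (chartOne E G) hasMFDerivAt_extChartAt_one_symm)).hasFDerivAt

lemma hasFDerivAt_chartMul_left (x : E) (hx : (extChartAt 𝓘(ℝ, E) (1 : G)).symm x ∈ (extChartAt 𝓘(ℝ, E) (1 : G)).source) :
    HasFDerivAt (fun y => chartMul E G (y, x)) (chartRight ((extChartAt 𝓘(ℝ, E) (1 : G)).symm x)) (chartOne E G) := by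
  set g := (extChartAt 𝓘(ℝ, E) (1 : G)).symm x with hg
  have h1 : HasMFDerivAt 𝓘(ℝ, E) 𝓘(ℝ, E) (extChartAt 𝓘(ℝ, E) (1 : G)) ((extChartAt 𝓘(ℝ, E) (1 : G)).symm (chartOne E G) * g)
      (mfderiv 𝓘(ℝ, E) 𝓘(ℝ, E) (extChartAt 𝓘(ℝ, E) (1 : G)) g : E →L[ℝ] E) := by
    rw [extChartAt_symm_chartOne, one_mul]
    exact (mdifferentiableAt_extChartAt (by simpa using hx)).hasMFDerivAt
  have h2 : HasMFDerivAt 𝓘(ℝ, E) 𝓘(ℝ, E) (fun y : G => y * g) ((extChartAt 𝓘(ℝ, E) (1 : G)).symm (chartOne E G))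
      (mfderiv 𝓘(ℝ, E) 𝓘(ℝ, E) (fun y : G => y * g) 1 : E →L[ℝ] E) := by
    rw [extChartAt_symm_chartOne]
    exact (mdifferentiable_mul_right (E := E) g 1).hasMFDerivAt
  exact (h1.comp (chartOne E G)
    (h2.comp (chartOne E G) hasMFDerivAt_extChartAt_one_symm)).hasFDerivAt

lemma eventually_symm_mem_source : ∀ᶠ x in 𝓝 (chartOne E G),
    (extChartAt 𝓘(ℝ, E) (1 : G)).symm x ∈ (extChartAt 𝓘(ℝ, E) (1 : G)).source := by
  filter_upwards [extChartAt_target_mem_nhds (I := 𝓘(ℝ, E)) (1 : G)] with x hx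
  exact (extChartAt 𝓘(ℝ, E) (1 : G)).map_target hx

variable (E G) in
/-- The derivative of the multiplication in the second variable at `(x, 1)`. -/
def dRight (x : E) : E →L[ℝ] E :=
  (fderiv ℝ (chartMul E G) (x, chartOne E G)).comp (ContinuousLinearMap.inr ℝ E E)

variable (E G) in
/-- The derivative of the multiplication in the first variable at `(1, x)`. -/
def dLeft (x : E) : E →L[ℝ] E :=
  (fderiv ℝ (chartMul E G) (chartOne E G, x)).comp (ContinuousLinearMap.inl ℝ E E)

lemma eventually_differentiableAt_chartMul :
    ∀ᶠ z in 𝓝 (chartOne E G, chartOne E G), DifferentiableAt ℝ (chartMul E G) z := by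
  have h := (contDiffAt_chartMul (E := E) (G := G)).of_le (m := 1) (by norm_cast)
  filter_upwards [h.eventually (by simp)] with z hz
  exact hz.differentiableAt (by simp)

lemma eventually_dRight_eq : ∀ᶠ x in 𝓝 (chartOne E G),
    dRight E G x = chartLeft ((extChartAt 𝓘(ℝ, E) (1 : G)).symm x) := by
  have hc : Filter.Tendsto (fun x : E => (x, chartOne E G)) (𝓝 (chartOne E G))
      (𝓝 (chartOne E G, chartOne E G)) := by
    exact Continuous.tendsto (f := fun x : E => (x, chartOne E G)) (by fun_prop) _
  filter_upwards [eventually_symm_mem_source, hc.eventually eventually_differentiableAt_chartMul]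
    with x hx hd
  have h1 := HasFDerivAt.comp (chartOne E G) (f := fun y => (x, y)) hd.hasFDerivAt (hasFDerivAt_prodMk_right x (chartOne E G))
  exact h1.unique (hasFDerivAt_chartMul_right x hx)

lemma eventually_dLeft_eq : ∀ᶠ x in 𝓝 (chartOne E G),
    dLeft E G x = chartRight ((extChartAt 𝓘(ℝ, E) (1 : G)).symm x) := by
  have hc : Filter.Tendsto (fun x : E => (chartOne E G, x)) (𝓝 (chartOne E G))
      (𝓝 (chartOne E G, chartOne E G)) := by
    exact Continuous.tendsto (f := fun x : E => (chartOne E G, x)) (by fun_prop) _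
  filter_upwards [eventually_symm_mem_source, hc.eventually eventually_differentiableAt_chartMul]
    with x hx hd
  have h1 := HasFDerivAt.comp (chartOne E G) (f := fun y => (y, x)) hd.hasFDerivAt (hasFDerivAt_prodMk_left (chartOne E G) x)
  exact h1.unique (hasFDerivAt_chartMul_left x hx)

/-- The second derivative of the multiplication. -/
abbrev d2Mul (E : Type*) [NormedAddCommGroup E] [NormedSpace ℝ E]
    (G : Type*) [TopologicalSpace G] [ChartedSpace E G] [Group G] : (E × E) →L[ℝ] (E × E) →L[ℝ] E :=
  fderiv ℝ (fderiv ℝ (chartMul E G)) (chartOne E G, chartOne E G)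

lemma hasFDerivAt_fderiv_chartMul :
    HasFDerivAt (fderiv ℝ (chartMul E G)) (d2Mul E G) (chartOne E G, chartOne E G) := by
  have h := (contDiffAt_chartMul (E := E) (G := G)).fderiv_right (m := 1) (by norm_cast)
  exact (h.differentiableAt (by simp)).hasFDerivAt

lemma hasFDerivAt_dRight_apply (Y : E) : HasFDerivAt (fun x => dRight E G x Y)
    (((d2Mul E G).flip (0, Y)).comp (ContinuousLinearMap.inl ℝ E E)) (chartOne E G) := by
  have h1 := HasFDerivAt.comp (chartOne E G) (f := fun x => (x, chartOne E G))
    (hasFDerivAt_fderiv_chartMul (E := E) (G := G)) (hasFDerivAt_prodMk_left (𝕜 := ℝ) (chartOne E G) (chartOne E G))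
  have h2 := h1.clm_apply (hasFDerivAt_const ((0 : E), Y) (chartOne E G))
  refine (h2.congr_fderiv ?_).congr_of_eventuallyEq (Filter.Eventually.of_forall fun x => ?_)
  · ext v; simp
  · simp [dRight]

lemma chartLeft_one : (chartLeft (1 : G) : E →L[ℝ] E) = ContinuousLinearMap.id ℝ E := by
  have h1 := (hasMFDerivAt_extChartAt_one (E := E) (G := G)).mfderiv
  have h2 : HasMFDerivAt 𝓘(ℝ, E) 𝓘(ℝ, E) (fun x : G => 1 * x) 1 (ContinuousLinearMap.id ℝ E) := by
    rw [show (fun x : G => 1 * x) = id from funext one_mul]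
    exact hasMFDerivAt_id 1
  have h3 := h2.mfderiv
  ext v
  exact (congrArg (fun f : E →L[ℝ] E => f _) h1).trans (congrArg (fun f : E →L[ℝ] E => f v) h3)

lemma chartRight_one : (chartRight (1 : G) : E →L[ℝ] E) = ContinuousLinearMap.id ℝ E := by
  have h1 := (hasMFDerivAt_extChartAt_one (E := E) (G := G)).mfderiv
  have h2 : HasMFDerivAt 𝓘(ℝ, E) 𝓘(ℝ, E) (fun x : G => x * 1) 1 (ContinuousLinearMap.id ℝ E) := by
    rw [show (fun x : G => x * 1) = id from funext mul_one]
    exact hasMFDerivAt_id 1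
  have h3 := h2.mfderiv
  ext v
  exact (congrArg (fun f : E →L[ℝ] E => f _) h1).trans (congrArg (fun f : E →L[ℝ] E => f v) h3)

lemma dRight_one : dRight E G (chartOne E G) = ContinuousLinearMap.id ℝ E := by
  rw [eventually_dRight_eq.self_of_nhds, extChartAt_symm_chartOne, chartLeft_one]

lemma dLeft_one : dLeft E G (chartOne E G) = ContinuousLinearMap.id ℝ E := by
  rw [eventually_dLeft_eq.self_of_nhds, extChartAt_symm_chartOne, chartRight_one]



/-- In the chart the differential of left translation is the partial derivative of the
multiplication in the second variable, so brackets of invariant fields reduce to second derivatives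
of `chartMul`. -/
lemma invariantField_chart (X : E) : ∀ᶠ x in 𝓝 (chartOne E G),
    (VectorField.mpullbackWithin 𝓘(ℝ, E) 𝓘(ℝ, E) (extChartAt 𝓘(ℝ, E) (1 : G)).symm
      (mulInvariantVectorField (I := 𝓘(ℝ, E)) (G := G) X) (Set.range 𝓘(ℝ, E)) x : E) =
      dRight E G x X := by
  filter_upwards [eventually_dRight_eq, extChartAt_target_mem_nhds (I := 𝓘(ℝ, E)) (1 : G)]
    with x hx ht
  rw [hx]
  have h1 := mfderiv_extChartAt_comp_mfderivWithin_extChartAt_symm (I := 𝓘(ℝ, E)) ht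
  have h2 := mfderivWithin_extChartAt_symm_comp_mfderiv_extChartAt (I := 𝓘(ℝ, E)) ht
  have h3 := ContinuousLinearMap.inverse_eq h2 h1
  exact congrArg (fun f : E →L[ℝ] E => f _) h3

end

/-! ### The Lie bracket and the derivative of `Ad` via the second derivative of the multiplication
-/

section

variable {E : Type*} [NormedAddCommGroup E] [NormedSpace ℝ E]
  {G : Type*} [TopologicalSpace G] [ChartedSpace E G] [Group G] [LieGroup 𝓘(ℝ, E) ∞ G]

lemma mlieBracket_mulInvariantVectorField (X Y : E) :
    (VectorField.mlieBracket 𝓘(ℝ, E) (mulInvariantVectorField (I := 𝓘(ℝ, E)) (G := G) X)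
      (mulInvariantVectorField (I := 𝓘(ℝ, E)) (G := G) Y) 1 : E) =
    d2Mul E G (X, 0) (0, Y) - d2Mul E G (Y, 0) (0, X) := by
  let V : E → E → E := fun X => VectorField.mpullbackWithin 𝓘(ℝ, E) 𝓘(ℝ, E)
    (extChartAt 𝓘(ℝ, E) (1 : G)).symm
      (mulInvariantVectorField (I := 𝓘(ℝ, E)) (G := G) X) (Set.range 𝓘(ℝ, E))
  have hV : ∀ X, V X =ᶠ[𝓝 (chartOne E G)] fun x => dRight E G x X :=
    fun X => invariantField_chart X
  have hd : ∀ X, fderiv ℝ (V X) (chartOne E G) =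
      ((d2Mul E G).flip (0, X)).comp (ContinuousLinearMap.inl ℝ E E) := fun X =>
    ((hasFDerivAt_dRight_apply (G := G) X).congr_of_eventuallyEq (hV X)).fderiv
  have hV1 : ∀ X, V X (chartOne E G) = X := fun X => by
    rw [(hV X).self_of_nhds]
    simp [dRight_one]
  have h1 : (mfderiv 𝓘(ℝ, E) 𝓘(ℝ, E) (extChartAt 𝓘(ℝ, E) (1 : G)) 1).inverse =
      ContinuousLinearMap.id ℝ E := by
    rw [mfderiv_extChartAt_self]
    exact ContinuousLinearMap.inverse_id
  have h2 : VectorField.lieBracketWithin ℝ (V X) (V Y)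
      ((extChartAt 𝓘(ℝ, E) (1 : G)).symm ⁻¹' Set.univ ∩ Set.range 𝓘(ℝ, E)) (chartOne E G) =
      d2Mul E G (X, 0) (0, Y) - d2Mul E G (Y, 0) (0, X) := by
    rw [show ((extChartAt 𝓘(ℝ, E) (1 : G)).symm ⁻¹' Set.univ ∩ Set.range 𝓘(ℝ, E)) = Set.univ by
      simp, VectorField.lieBracketWithin_univ, VectorField.lieBracket, hd, hd, hV1, hV1]
    simp
  exact (congrArg (fun f : E →L[ℝ] E => f _) h1).trans h2

lemma d2Mul_symm (u v : E × E) : d2Mul E G u v = d2Mul E G v u :=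
  (contDiffAt_chartMul (E := E) (G := G)).isSymmSndFDerivAt
    (by rw [minSmoothness_of_isRCLikeNormedField]; norm_cast) u v

lemma continuousAt_dLeft : ContinuousAt (dLeft E G) (chartOne E G) := by
  have h := (hasFDerivAt_fderiv_chartMul (E := E) (G := G)).continuousAt
  have h2 : ContinuousAt (fun x => fderiv ℝ (chartMul E G) (chartOne E G, x)) (chartOne E G) :=
    ContinuousAt.comp (f := fun x => (chartOne E G, x)) h (by fun_prop)
  exact h2.clm_comp continuousAt_const

lemma continuousAt_dRight : ContinuousAt (dRight E G) (chartOne E G) := by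
  have h := (hasFDerivAt_fderiv_chartMul (E := E) (G := G)).continuousAt
  have h2 : ContinuousAt (fun x => fderiv ℝ (chartMul E G) (x, chartOne E G)) (chartOne E G) :=
    ContinuousAt.comp (f := fun x => (x, chartOne E G)) h (by fun_prop)
  exact h2.clm_comp continuousAt_const

lemma adOp_one : adOp E (1 : G) = ContinuousLinearMap.id ℝ E := by
  have h : HasMFDerivAt 𝓘(ℝ, E) 𝓘(ℝ, E) (fun x : G => 1 * x * 1⁻¹) 1
      (ContinuousLinearMap.id ℝ E) := by
    rw [show (fun x : G => 1 * x * 1⁻¹) = id by funext x; simp]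
    exact hasMFDerivAt_id 1
  exact h.mfderiv

lemma adOp_mul (g h : G) : adOp E (g * h) = adOp E g * adOp E h := by
  have h1 := hasMFDerivAt_conj (E := E) g
  have h2 := hasMFDerivAt_conj (E := E) h
  have h3 : HasMFDerivAt 𝓘(ℝ, E) 𝓘(ℝ, E) (fun x : G => g * x * g⁻¹) (h * 1 * h⁻¹) (adOp E g) := by
    rw [show h * 1 * h⁻¹ = 1 by simp]
    exact h1
  have h4 := h3.comp (1 : G) h2
  rw [show (fun x : G => g * x * g⁻¹) ∘ (fun x : G => h * x * h⁻¹) =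
    fun x => (g * h) * x * (g * h)⁻¹ by funext x; simp [mul_assoc]] at h4
  exact h4.mfderiv

lemma adOp_mul_inv (g : G) : adOp E g * adOp E g⁻¹ = 1 := by
  rw [← adOp_mul, mul_inv_cancel, adOp_one]; rfl

variable [CompleteSpace E]

/-- The adjoint action near the identity, in the chart. -/
lemma eventually_adOp_eq : ∀ᶠ x in 𝓝 (chartOne E G),
    adOp E ((extChartAt 𝓘(ℝ, E) (1 : G)).symm x) = Ring.inverse (dLeft E G x) * dRight E G x := by
  have hu : ∀ᶠ x in 𝓝 (chartOne E G), IsUnit (dLeft E G x) := by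
    apply continuousAt_dLeft.eventually
    rw [dLeft_one]
    exact Units.nhds (1 : (E →L[ℝ] E)ˣ)
  filter_upwards [hu, eventually_dLeft_eq, eventually_dRight_eq] with x h1 h2 h3
  rw [h3, chartLeft_eq, ← h2, ← ContinuousLinearMap.mul_def, ← mul_assoc,
    Ring.inverse_mul_cancel _ h1, one_mul]

lemma eventually_adOp_eq' : ∀ᶠ g in 𝓝 (1 : G), adOp E g =
    Ring.inverse (dLeft E G (extChartAt 𝓘(ℝ, E) (1 : G) g)) *
      dRight E G (extChartAt 𝓘(ℝ, E) (1 : G) g) := by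
  have hc := continuousAt_extChartAt (I := 𝓘(ℝ, E)) (1 : G)
  filter_upwards [hc.eventually eventually_adOp_eq, extChartAt_source_mem_nhds (I := 𝓘(ℝ, E)) (1 : G)]
    with g hg hs
  rwa [(extChartAt 𝓘(ℝ, E) (1 : G)).left_inv hs] at hg

variable (E G) in
lemma continuous_adOp : Continuous (fun g : G => adOp E g) := by
  have h0 : ContinuousAt (fun g : G => adOp E g) 1 := by
    refine ContinuousAt.congr ?_ (eventually_adOp_eq'.mono fun g hg => hg.symm)
    have hc := continuousAt_extChartAt (I := 𝓘(ℝ, E)) (1 : G)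
    have h1 : ContinuousAt (fun g : G => dLeft E G (extChartAt 𝓘(ℝ, E) (1 : G) g)) 1 :=
      ContinuousAt.comp (f := extChartAt 𝓘(ℝ, E) (1 : G)) (g := dLeft E G) continuousAt_dLeft hc
    have h2 : ContinuousAt (fun g : G => dRight E G (extChartAt 𝓘(ℝ, E) (1 : G) g)) 1 :=
      ContinuousAt.comp (f := extChartAt 𝓘(ℝ, E) (1 : G)) (g := dRight E G) continuousAt_dRight hc
    have h3 : ContinuousAt Ring.inverse (dLeft E G (extChartAt 𝓘(ℝ, E) (1 : G) 1)) := by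
      change ContinuousAt Ring.inverse (dLeft E G (chartOne E G))
      rw [dLeft_one]
      exact NormedRing.inverse_continuousAt (1 : (E →L[ℝ] E)ˣ)
    exact (ContinuousAt.comp (f := fun g : G => dLeft E G (extChartAt 𝓘(ℝ, E) (1 : G) g)) h3 h1).mul h2
  have := topologicalGroup_of_lieGroup 𝓘(ℝ, E) ∞ (G := G)
  rw [continuous_iff_continuousAt]
  intro g
  have h1 : ContinuousAt (fun h : G => adOp E g * adOp E (g⁻¹ * h)) g := by
    refine continuousAt_const.mul ?_
    refine ContinuousAt.comp (f := fun h : G => g⁻¹ * h) (g := fun h : G => adOp E h) ?_ (by fun_prop)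
    simpa using h0
  refine h1.congr (Filter.Eventually.of_forall fun h => ?_)
  simp [← adOp_mul]

/-- The derivative of the adjoint action along a curve through the identity. -/
lemma hasDerivAt_adOp_curve {γ : ℝ → G} (hγ0 : γ 0 = 1) (X Y : E)
    (hγ : HasMFDerivAt 𝓘(ℝ, ℝ) 𝓘(ℝ, E) γ 0 (ContinuousLinearMap.toSpanSingleton ℝ X)) :
    HasDerivAt (fun t => adOp E (γ t) Y) (d2Mul E G (X, 0) (0, Y) - d2Mul E G (Y, 0) (0, X)) 0 := by
  set c : ℝ → E := fun t => extChartAt 𝓘(ℝ, E) (1 : G) (γ t) with hc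
  have hc0 : c 0 = chartOne E G := by simp only [hc, hγ0]; rfl
  have hcd : HasDerivAt c X 0 := by
    have h1 : HasMFDerivAt 𝓘(ℝ, E) 𝓘(ℝ, E) (extChartAt 𝓘(ℝ, E) (1 : G)) (γ 0)
      (ContinuousLinearMap.id ℝ E) := by rw [hγ0]; exact hasMFDerivAt_extChartAt_one
    have h2 : HasFDerivAt c (ContinuousLinearMap.toSpanSingleton ℝ X) 0 := (h1.comp (0 : ℝ) hγ).hasFDerivAt
    have h3 := h2.hasDerivAt
    simpa using h3
  have hγc : ContinuousAt γ 0 := hγ.continuousAt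
  have hcc : Filter.Tendsto c (𝓝 0) (𝓝 (chartOne E G)) := by
    have := hcd.continuousAt.tendsto; rwa [hc0] at this
  have he : ∀ᶠ t in 𝓝 (0 : ℝ), dLeft E G (c t) (adOp E (γ t) Y) = dRight E G (c t) Y := by
    have hs := hγc.eventually (by rw [hγ0]; exact extChartAt_source_mem_nhds (I := 𝓘(ℝ, E)) (1 : G))
    filter_upwards [hs, hcc.eventually eventually_dLeft_eq, hcc.eventually eventually_dRight_eq]
      with t h0 h1 h2
    rw [h1, h2, hc]
    simp only [(extChartAt 𝓘(ℝ, E) (1 : G)).left_inv h0, chartLeft_eq]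
    rfl
  have hop : HasFDerivAt (dLeft E G) _ (chartOne E G) :=
    (HasFDerivAt.comp (chartOne E G) (f := fun x => (chartOne E G, x))
      (hasFDerivAt_fderiv_chartMul (E := E) (G := G))
      (hasFDerivAt_prodMk_right (𝕜 := ℝ) (chartOne E G) (chartOne E G))).clm_comp
      (hasFDerivAt_const (ContinuousLinearMap.inl ℝ E E) (chartOne E G))
  have hopc : HasDerivAt (fun t => dLeft E G (c t)) _ 0 :=
    HasFDerivAt.comp_hasDerivAt_of_eq (0 : ℝ) hop hcd hc0.symm
  -- Inversion of operators has derivative `-1` at the identity. Differentiating `Ad = dLeft⁻¹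
  -- dRight` thus gives a difference of two mixed second derivatives, which is the bracket by
  -- symmetry of `d2Mul`.
  have hinv : HasFDerivAt Ring.inverse (-(ContinuousLinearMap.mulLeftRight ℝ (E →L[ℝ] E) 1 1))
      (dLeft E G (c 0)) := by
    rw [hc0, dLeft_one]
    have h := hasFDerivAt_ringInverse (𝕜 := ℝ) (1 : (E →L[ℝ] E)ˣ)
    rw [inv_one, Units.val_one] at h
    exact h
  have h1 := hinv.comp_hasDerivAt (0 : ℝ) hopc
  have h2 : HasDerivAt (fun t => dRight E G (c t) Y) _ 0 :=
    HasFDerivAt.comp_hasDerivAt_of_eq (0 : ℝ) (hasFDerivAt_dRight_apply (G := G) Y) hcd hc0.symm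
  have h3 := h1.clm_apply h2
  have hu : ∀ᶠ t in 𝓝 (0 : ℝ), adOp E (γ t) Y =
      Ring.inverse (dLeft E G (c t)) (dRight E G (c t) Y) := by
    have h : ∀ᶠ x in 𝓝 (chartOne E G), IsUnit (dLeft E G x) := by
      apply continuousAt_dLeft.eventually
      rw [dLeft_one]
      exact Units.nhds (1 : (E →L[ℝ] E)ˣ)
    filter_upwards [hcc.eventually h, he] with t h1 h2
    rw [← h2, ← mul_apply_eq_comp, Ring.inverse_mul_cancel _ h1]
    rfl
  refine (h3.congr_of_eventuallyEq hu).congr_deriv ?_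
  have hi : Ring.inverse (ContinuousLinearMap.id ℝ E) = ContinuousLinearMap.id ℝ E :=
    Ring.inverse_one (E →L[ℝ] E)
  have hsymm := d2Mul_symm (G := G) ((0 : E), X) (Y, 0)
  simp [hc0, dLeft_one, dRight_one, hi, hsymm]
  abel

end

/-! ### One-parameter subgroups -/

section

variable {E : Type*} [NormedAddCommGroup E] [NormedSpace ℝ E]
  {G : Type*} [TopologicalSpace G] [ChartedSpace E G] [Group G] [LieGroup 𝓘(ℝ, E) ∞ G]

/-- `γ` is the one-parameter subgroup with velocity `X`. -/
def IsOneParam (X : E) (γ : ℝ → G) : Prop :=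
  γ 0 = 1 ∧ IsMIntegralCurve (I := 𝓘(ℝ, E)) γ (mulInvariantVectorField (I := 𝓘(ℝ, E)) (G := G) X)

lemma mfderiv_mul_left_mulInvariantVectorField (X : E) (g h : G) :
    HasMFDerivAt 𝓘(ℝ, E) 𝓘(ℝ, E) (fun x : G => g * x) h
      (mfderiv 𝓘(ℝ, E) 𝓘(ℝ, E) (fun x : G => g * x) h : E →L[ℝ] E) ∧
    (mfderiv 𝓘(ℝ, E) 𝓘(ℝ, E) (fun x : G => g * x) h : E →L[ℝ] E)
      (mulInvariantVectorField (I := 𝓘(ℝ, E)) X h) =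
      mulInvariantVectorField (I := 𝓘(ℝ, E)) X (g * h) := by
  refine ⟨(mdifferentiable_mul_left (E := E) g h).hasMFDerivAt, ?_⟩
  have h1 : HasMFDerivAt 𝓘(ℝ, E) 𝓘(ℝ, E) (fun x : G => h * x) 1
      (mfderiv 𝓘(ℝ, E) 𝓘(ℝ, E) (fun x : G => h * x) 1 : E →L[ℝ] E) :=
    (mdifferentiable_mul_left (E := E) h 1).hasMFDerivAt
  have h2 : HasMFDerivAt 𝓘(ℝ, E) 𝓘(ℝ, E) (fun x : G => g * x) (h * 1)
      (mfderiv 𝓘(ℝ, E) 𝓘(ℝ, E) (fun x : G => g * x) h : E →L[ℝ] E) := by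
    rw [mul_one]; exact (mdifferentiable_mul_left (E := E) g h).hasMFDerivAt
  have h3 := h2.comp (1 : G) h1
  rw [show (fun x : G => g * x) ∘ (fun x : G => h * x) = fun x => g * h * x by
    funext x; simp [mul_assoc]] at h3
  exact (congrArg (fun f : E →L[ℝ] E => f X) h3.mfderiv).symm

lemma isMIntegralCurveOn_mul_left {X : E} {γ : ℝ → G} {s : Set ℝ} (g : G)
    (h : IsMIntegralCurveOn (I := 𝓘(ℝ, E)) γ (mulInvariantVectorField (I := 𝓘(ℝ, E)) X) s) :
    IsMIntegralCurveOn (I := 𝓘(ℝ, E)) (fun t => g * γ t)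
      (mulInvariantVectorField (I := 𝓘(ℝ, E)) X) s := by
  intro t ht
  obtain ⟨h1, h2⟩ := mfderiv_mul_left_mulInvariantVectorField X g (γ t)
  have h3 := h1.comp_hasMFDerivWithinAt t (h t ht)
  rw [← h2]
  refine h3.congr_mfderiv (ContinuousLinearMap.ext_ring ?_)
  change (mfderiv 𝓘(ℝ, E) 𝓘(ℝ, E) (fun x : G => g * x) (γ t) : E →L[ℝ] E) ((1 : ℝ) • _) = (1 : ℝ) • _
  rw [map_smul]

lemma isMIntegralCurve_mul_left {X : E} {γ : ℝ → G} (g : G)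
    (h : IsMIntegralCurve (I := 𝓘(ℝ, E)) γ (mulInvariantVectorField (I := 𝓘(ℝ, E)) X)) :
    IsMIntegralCurve (I := 𝓘(ℝ, E)) (fun t => g * γ t)
      (mulInvariantVectorField (I := 𝓘(ℝ, E)) X) := by
  rw [isMIntegralCurve_iff_isMIntegralCurveOn] at h ⊢
  exact isMIntegralCurveOn_mul_left g h

lemma isMIntegralCurve_conj {X : E} {γ : ℝ → G} (g : G)
    (h : IsMIntegralCurve (I := 𝓘(ℝ, E)) γ (mulInvariantVectorField (I := 𝓘(ℝ, E)) X)) :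
    IsMIntegralCurve (I := 𝓘(ℝ, E)) (fun t => g * γ t * g⁻¹)
      (mulInvariantVectorField (I := 𝓘(ℝ, E)) (adOp E g X)) := by
  intro t
  have h1 := (mdifferentiable_conj (E := E) g (γ t)).hasMFDerivAt
  have h3 := h1.comp t (h t)
  have key : (mfderiv 𝓘(ℝ, E) 𝓘(ℝ, E) (fun x : G => g * x * g⁻¹) (γ t) : E →L[ℝ] E)
      (mulInvariantVectorField (I := 𝓘(ℝ, E)) X (γ t)) =
      mulInvariantVectorField (I := 𝓘(ℝ, E)) (adOp E g X) (g * γ t * g⁻¹) := by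
    have a1 : HasMFDerivAt 𝓘(ℝ, E) 𝓘(ℝ, E) (fun x : G => γ t * x) 1
        (mfderiv 𝓘(ℝ, E) 𝓘(ℝ, E) (fun x : G => γ t * x) 1 : E →L[ℝ] E) :=
      (mdifferentiable_mul_left (E := E) (γ t) 1).hasMFDerivAt
    have a2 : HasMFDerivAt 𝓘(ℝ, E) 𝓘(ℝ, E) (fun x : G => g * x * g⁻¹) (γ t * 1)
        (mfderiv 𝓘(ℝ, E) 𝓘(ℝ, E) (fun x : G => g * x * g⁻¹) (γ t) : E →L[ℝ] E) := by
      rw [mul_one]; exact h1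
    have a3 : HasMFDerivAt 𝓘(ℝ, E) 𝓘(ℝ, E) (fun x : G => g * γ t * g⁻¹ * x) (g * 1 * g⁻¹)
        (mfderiv 𝓘(ℝ, E) 𝓘(ℝ, E) (fun x : G => g * γ t * g⁻¹ * x) 1 : E →L[ℝ] E) := by
      rw [show g * 1 * g⁻¹ = 1 by simp]
      exact (mdifferentiable_mul_left (E := E) (g * γ t * g⁻¹) 1).hasMFDerivAt
    have a4 := a2.comp (1 : G) a1
    have a5 := a3.comp (1 : G) (hasMFDerivAt_conj (E := E) g)
    rw [show (fun x : G => g * x * g⁻¹) ∘ (fun x : G => γ t * x) =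
      (fun x : G => g * γ t * g⁻¹ * x) ∘ (fun x : G => g * x * g⁻¹) by
      funext x; simp [mul_assoc]] at a4
    exact congrArg (fun f : E →L[ℝ] E => f X) (a4.mfderiv.symm.trans a5.mfderiv)
  rw [← key]
  refine h3.congr_mfderiv (ContinuousLinearMap.ext_ring ?_)
  change (mfderiv 𝓘(ℝ, E) 𝓘(ℝ, E) (fun x : G => g * x * g⁻¹) (γ t) : E →L[ℝ] E) ((1 : ℝ) • _) = (1 : ℝ) • _
  rw [map_smul]

lemma contMDiff_one_mulInvariantVectorField (X : E) : ContMDiff 𝓘(ℝ, E) 𝓘(ℝ, E).tangent 1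
    (fun g : G => (⟨g, mulInvariantVectorField (I := 𝓘(ℝ, E)) X g⟩ : TangentBundle 𝓘(ℝ, E) G)) := by
  refine (contMDiff_mulInvariantVectorField (I := 𝓘(ℝ, E)) (G := G) X).of_le ?_
  rw [minSmoothness_of_isRCLikeNormedField]
  norm_num

section
variable [T2Space G]

lemma IsOneParam.unique {X : E} {γ γ' : ℝ → G} (h : IsOneParam X γ) (h' : IsOneParam X γ') :
    γ = γ' :=
  isMIntegralCurve_Ioo_eq_of_contMDiff_boundaryless (t₀ := 0)
    (contMDiff_one_mulInvariantVectorField X) h.2 h'.2 (h.1.trans h'.1.symm)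

/-- As functions of `t`, both sides are integral curves of the same left invariant field through `γ
s`. -/
lemma IsOneParam.add {X : E} {γ : ℝ → G} (h : IsOneParam X γ) (s t : ℝ) :
    γ (s + t) = γ s * γ t := by
  have h1 := h.2.comp_add s
  have h2 := isMIntegralCurve_mul_left (γ s) h.2
  have := isMIntegralCurve_Ioo_eq_of_contMDiff_boundaryless (t₀ := 0)
    (contMDiff_one_mulInvariantVectorField X) h1 h2 (by simp [h.1])
  have := congrFun this t
  simpa [add_comm] using this

lemma IsOneParam.neg {X : E} {γ : ℝ → G} (h : IsOneParam X γ) (t : ℝ) :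
    γ (-t) = (γ t)⁻¹ := by
  rw [eq_inv_iff_mul_eq_one, ← h.add]
  simp [h.1]

variable [CompleteSpace E]

/-- Left translates of one local integral curve exist for the same time `ε` at every point, so
solutions extend to all of `ℝ`. -/
lemma exists_isOneParam (X : E) : ∃ γ : ℝ → G, IsOneParam X γ := by
  obtain ⟨γ, h0, hγ⟩ := exists_isMIntegralCurveAt_of_contMDiffAt_boundaryless (t₀ := 0) (x₀ := (1 : G))
    (contMDiff_one_mulInvariantVectorField (G := G) X).contMDiffAt
  obtain ⟨ε, hε, h⟩ := isMIntegralCurveAt_iff'.1 hγ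
  refine exists_isMIntegralCurve_of_isMIntegralCurveOn (contMDiff_one_mulInvariantVectorField X) hε
    (fun g => ⟨fun t => g * γ t, by simp [h0], isMIntegralCurveOn_mul_left g (h.mono ?_)⟩) 1
  rw [Real.ball_eq_Ioo]; simp
end

lemma IsOneParam.conj {X : E} {γ : ℝ → G} (h : IsOneParam X γ) (g : G) :
    IsOneParam (adOp E g X) (fun t => g * γ t * g⁻¹) :=
  ⟨by simp [h.1], isMIntegralCurve_conj g h.2⟩

lemma IsOneParam.continuous {X : E} {γ : ℝ → G} (h : IsOneParam X γ) : Continuous γ :=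
  h.2.continuous

lemma IsOneParam.hasMFDerivAt_zero {X : E} {γ : ℝ → G} (h : IsOneParam X γ) :
    HasMFDerivAt 𝓘(ℝ, ℝ) 𝓘(ℝ, E) γ 0 (ContinuousLinearMap.toSpanSingleton ℝ X) := by
  have h1 := h.2 0
  have h2 : (mulInvariantVectorField (I := 𝓘(ℝ, E)) X (γ 0) : E) = X := by
    rw [h.1]
    have a : HasMFDerivAt 𝓘(ℝ, E) 𝓘(ℝ, E) (fun x : G => 1 * x) 1 (ContinuousLinearMap.id ℝ E) := by
      rw [show (fun x : G => 1 * x) = id from funext one_mul]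
      exact hasMFDerivAt_id 1
    exact congrArg (fun f : E →L[ℝ] E => f X) a.mfderiv
  refine h1.congr_mfderiv (ContinuousLinearMap.ext_ring ?_)
  change (1 : ℝ) • _ = (1 : ℝ) • X
  exact congrArg (fun v : E => (1 : ℝ) • v) h2

variable (E G) in
/-- The Lie bracket of the Lie algebra, on the model space. -/
def lieOp (X Y : E) : E :=
  Bracket.bracket (L := LieAlg E G) (M := LieAlg E G) X Y

section
variable [CompleteSpace E]

lemma hasDerivAt_adOp_zero {γ : ℝ → G} (hγ0 : γ 0 = 1) (X Y : E)
    (hγ : HasMFDerivAt 𝓘(ℝ, ℝ) 𝓘(ℝ, E) γ 0 (ContinuousLinearMap.toSpanSingleton ℝ X)) :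
    HasDerivAt (fun t => adOp E (γ t) Y) (lieOp E G X Y) 0 := by
  exact (hasDerivAt_adOp_curve hγ0 X Y hγ).congr_deriv
    (mlieBracket_mulInvariantVectorField (G := G) X Y).symm

/-- The derivative at `0` is transported to `t` by `Ad (γ s) = Ad (γ t) Ad (γ (s - t))`. -/
lemma IsOneParam.hasDerivAt_adOp [T2Space G] {X : E} {γ : ℝ → G} (h : IsOneParam X γ) (Y : E) (t : ℝ) :
    HasDerivAt (fun t => adOp E (γ t) Y) (adOp E (γ t) (lieOp E G X Y)) t := by
  have h1 := hasDerivAt_adOp_zero h.1 X Y h.hasMFDerivAt_zero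
  have h2 := (adOp E (γ t)).hasFDerivAt.comp_hasDerivAt (0 : ℝ) h1
  have h3 : HasDerivAt (fun s => s - t) 1 t := (hasDerivAt_id t).sub_const t
  have h4 := HasDerivAt.scomp_of_eq t h2 h3 (sub_self t).symm
  rw [one_smul] at h4
  refine h4.congr_of_eventuallyEq (Filter.Eventually.of_forall fun s => ?_)
  simp only [Function.comp]
  rw [← mul_apply_eq_comp, ← adOp_mul, ← h.add]
  simp

/-- The adjoint action respects the Lie bracket. -/
lemma adOp_lieOp [T2Space G] (g : G) (X Y : E) :
    adOp E g (lieOp E G X Y) = lieOp E G (adOp E g X) (adOp E g Y) := by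
  obtain ⟨γ, h⟩ := exists_isOneParam (G := G) X
  have h1 := hasDerivAt_adOp_zero h.1 X Y h.hasMFDerivAt_zero
  have h2 := (adOp E g).hasFDerivAt.comp_hasDerivAt (0 : ℝ) h1
  have h3 := h.conj g
  have h4 := hasDerivAt_adOp_zero h3.1 (adOp E g X) (adOp E g Y) h3.hasMFDerivAt_zero
  refine h2.unique (h4.congr_of_eventuallyEq (Filter.Eventually.of_forall fun s => ?_))
  simp only [Function.comp]
  rw [← mul_apply_eq_comp, ← mul_apply_eq_comp, ← adOp_mul, ← adOp_mul]
  simp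
end

end

/-! ### The adjoint action by automorphisms, and invariance of the form -/

section

variable {E : Type*} [NormedAddCommGroup E] [NormedSpace ℝ E]
  {G : Type*} [TopologicalSpace G] [ChartedSpace E G] [Group G] [LieGroup 𝓘(ℝ, E) ∞ G]

lemma Ad_one (X : LieAlg E G) : Ad E (1 : G) X = X :=
  congrArg (fun f : E →L[ℝ] E => f X) (adOp_one (E := E) (G := G))

lemma Ad_mul (g h : G) (X : LieAlg E G) : Ad E (g * h) X = Ad E g (Ad E h X) :=
  congrArg (fun f : E →L[ℝ] E => f X) (adOp_mul (E := E) g h)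

@[simp] lemma Ad_inv_Ad (g : G) (X : LieAlg E G) : Ad E g⁻¹ (Ad E g X) = X := by
  rw [← Ad_mul, inv_mul_cancel, Ad_one]

@[simp] lemma Ad_Ad_inv (g : G) (X : LieAlg E G) : Ad E g (Ad E g⁻¹ X) = X := by
  rw [← Ad_mul, mul_inv_cancel, Ad_one]

/-- `Ad` is continuous in the group element. -/
lemma continuous_Ad_apply [CompleteSpace E] (X : LieAlg E G) :
    Continuous (fun g : G => Ad E g X) :=
  (continuous_adOp E G).clm_apply continuous_const

variable [CompleteSpace E] [T2Space G]

lemma Ad_lie (g : G) (X Y : LieAlg E G) : Ad E g ⁅X, Y⁆ = ⁅Ad E g X, Ad E g Y⁆ :=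
  adOp_lieOp (E := E) g X Y

/-- The adjoint action by Lie algebra automorphisms. -/
def AdEquiv (g : G) : LieAlg E G ≃ₗ⁅ℝ⁆ LieAlg E G :=
  { (Ad E g : LieAlg E G →ₗ[ℝ] LieAlg E G) with
    map_lie' := fun {X Y} => Ad_lie g X Y
    invFun := fun X => Ad E g⁻¹ X
    left_inv := fun X => Ad_inv_Ad g X
    right_inv := fun X => Ad_Ad_inv g X }

@[simp] lemma AdEquiv_apply (g : G) (X : LieAlg E G) : AdEquiv g X = Ad E g X := rfl

lemma IsOneParam.adOp_eq_self {X Y : E} {γ : ℝ → G}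
    (h : IsOneParam X γ) (hXY : lieOp E G X Y = 0) (t : ℝ) : adOp E (γ t) Y = Y := by
  have hd : ∀ s, HasDerivAt (fun s => adOp E (γ s) Y) 0 s := fun s => by
    have h1 := h.hasDerivAt_adOp Y s
    rwa [hXY, map_zero] at h1
  have h2 := is_const_of_deriv_eq_zero (fun s => (hd s).differentiableAt) (fun s => (hd s).deriv) t 0
  rw [h2, h.1, adOp_one, ContinuousLinearMap.id_apply]

lemma IsOneParam.lieOp_eq_zero {X Y : E} {γ : ℝ → G}
    (h : IsOneParam X γ) (hY : ∀ t, adOp E (γ t) Y = Y) : lieOp E G X Y = 0 := by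
  have h1 := hasDerivAt_adOp_zero h.1 X Y h.hasMFDerivAt_zero
  refine (h1.congr_of_eventuallyEq (Filter.Eventually.of_forall fun s => (hY s).symm)).unique
    (hasDerivAt_const _ _)

lemma IsOneParam.hasDerivAt_dual_adOp {X : E} {γ : ℝ → G}
    (h : IsOneParam X γ) (f : E →L[ℝ] ℝ) Y :
    HasDerivAt (fun t => f (adOp E (γ t) Y)) (f (lieOp E G X Y)) 0 :=
  f.hasFDerivAt.comp_hasDerivAt (0 : ℝ) (hasDerivAt_adOp_zero h.1 X Y h.hasMFDerivAt_zero)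

lemma IsOneParam.Ad_eq_self {X Y : LieAlg E G} {γ : ℝ → G}
    (h : IsOneParam (E := E) X γ) (hXY : ⁅X, Y⁆ = 0) (t : ℝ) : Ad E (γ t) Y = Y :=
  h.adOp_eq_self hXY t

lemma IsOneParam.lie_eq_zero {X Y : LieAlg E G} {γ : ℝ → G}
    (h : IsOneParam (E := E) X γ) (hY : ∀ t, Ad E (γ t) Y = Y) : ⁅X, Y⁆ = 0 :=
  h.lieOp_eq_zero hY

lemma IsOneParam.hasDerivAt_dual {X : LieAlg E G} {γ : ℝ → G}
    (h : IsOneParam (E := E) X γ) (f : CoLieAlg E G) (Y : LieAlg E G) :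
    HasDerivAt (fun t => f (Ad E (γ t) Y)) (f ⁅X, Y⁆) 0 :=
  h.hasDerivAt_dual_adOp (E := E) f Y

/-- Rotation in the three-dimensional subalgebra spanned by `X, Y, Z`. -/
lemma IsOneParam.adOp_rotate {X Y Z : E} {γ : ℝ → G} (h : IsOneParam X γ)
    {c : ℝ} (hc : 0 < c) (hXY : lieOp E G X Y = Z) (hXZ : lieOp E G X Z = -(c ^ 2) • Y) :
    adOp E (γ (Real.pi / c)) Z = -Z := by
  have hY := h.hasDerivAt_adOp Y
  have hZ := h.hasDerivAt_adOp Z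
  rw [hXY] at hY
  rw [hXZ] at hZ
  have hcos : ∀ t, HasDerivAt (fun t => Real.cos (c * t)) (-Real.sin (c * t) * (c * 1)) t := fun t =>
    ((hasDerivAt_id t).const_mul c).cos
  have hsin : ∀ t, HasDerivAt (fun t => c * Real.sin (c * t)) (c * (Real.cos (c * t) * (c * 1))) t := fun t =>
    (((hasDerivAt_id t).const_mul c).sin).const_mul c
  -- Rotating back in the plane of `Y` and `Z` gives a constant curve; it is compared at the times
  -- `0` and `π / c`.
  have hd : ∀ t, HasDerivAt (fun t => Real.cos (c * t) • adOp E (γ t) Z +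
      (c * Real.sin (c * t)) • adOp E (γ t) Y) (0 : E) t := fun t => by
    have h1 := ((hcos t).smul (hZ t)).add ((hsin t).smul (hY t))
    refine h1.congr_deriv ?_
    rw [map_smul]
    module
  have h2 := is_const_of_deriv_eq_zero (fun s => (hd s).differentiableAt) (fun s => (hd s).deriv)
    (Real.pi / c) 0
  have hpi : c * (Real.pi / c) = Real.pi := by field_simp
  simp only [hpi, Real.cos_pi, Real.sin_pi, mul_zero, Real.cos_zero, Real.sin_zero, zero_smul,
    add_zero, neg_smul, one_smul, h.1, adOp_one] at h2
  rw [← neg_eq_iff_eq_neg]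
  simpa using h2

lemma IsOneParam.Ad_rotate {X Y Z : LieAlg E G} {γ : ℝ → G} (h : IsOneParam (E := E) X γ)
    {c : ℝ} (hc : 0 < c) (hXY : ⁅X, Y⁆ = Z) (hXZ : ⁅X, Z⁆ = -(c ^ 2) • Y) :
    Ad E (γ (Real.pi / c)) Z = -Z :=
  h.adOp_rotate hc hXY hXZ

/-- Differentiate `B (Ad (γ t) Y) Z = B Y (Ad (γ (-t)) Z)` at `t = 0`. -/
lemma IsInvariantInner.lie_left [FiniteDimensional ℝ E] {B : LinearMap.BilinForm ℝ (LieAlg E G)}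
    (hB : IsInvariantInner E B) (X Y Z : LieAlg E G) : B ⁅X, Y⁆ Z = -B Y ⁅X, Z⁆ := by
  obtain ⟨γ, h⟩ := exists_isOneParam (E := E) (G := G) X
  have hf : ∀ f : LieAlg E G →ₗ[ℝ] ℝ, ∀ W, HasDerivAt (fun t => f (Ad E (γ t) W)) (f ⁅X, W⁆) 0 :=
    fun f W => IsOneParam.hasDerivAt_dual (X := X) h (LinearMap.toContinuousLinearMap f) W
  have h1 := hf (B.flip Z) Y
  have h2 := hf (B Y) Z
  have h2' : HasDerivAt (fun t => B Y (Ad E (γ t) Z)) (B Y ⁅X, Z⁆) (-0) := by simpa using h2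
  have h3 := HasDerivAt.scomp (0 : ℝ) h2' (hasDerivAt_neg 0)
  refine (h1.unique (h3.congr_of_eventuallyEq (Filter.Eventually.of_forall fun t => ?_))).trans (by simp)
  simp only [Function.comp]
  rw [h.neg, ← hB.invariant (γ t) Y, Ad_Ad_inv]
  rfl

end

/-! ### Closed subgroups of the units of a commutative Banach algebra -/

section

open Filter NormedSpace

section ClosedSubgroup
variable {𝔸 : Type*} [NormedCommRing 𝔸] [NormedAlgebra ℝ 𝔸] [FiniteDimensional ℝ 𝔸]

/-- A closed subgroup of the unit group of a commutative Banach algebra. -/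
structure IsClosedUnitGroup (S : Set 𝔸) : Prop where
  isClosed : IsClosed S
  one_mem : 1 ∈ S
  mul_mem : ∀ {a b}, a ∈ S → b ∈ S → a * b ∈ S
  exists_inv : ∀ {a}, a ∈ S → ∃ b ∈ S, a * b = 1

variable [CompleteSpace 𝔸]

lemma exp_add_comm (a b : 𝔸) : exp (a + b) = exp a * exp b := by
  let _ : NormedAlgebra ℚ 𝔸 := NormedAlgebra.restrictScalars ℚ ℝ 𝔸
  exact exp_add

lemma exp_mul_exp_neg (a : 𝔸) : exp a * exp (-a) = 1 := by
  rw [← exp_add_comm, add_neg_cancel, exp_zero]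

lemma continuous_exp' : Continuous (exp : 𝔸 → 𝔸) := by
  let _ : NormedAlgebra ℚ 𝔸 := NormedAlgebra.restrictScalars ℚ ℝ 𝔸
  exact exp_continuous

/-- The Lie algebra of a closed subgroup of the unit group of a commutative Banach algebra. -/
def expLie (S : Set 𝔸) (hS : IsClosedUnitGroup S) : Submodule ℝ 𝔸 where
  carrier := {a | ∀ r : ℝ, exp (r • a) ∈ S}
  zero_mem' r := by simpa using hS.one_mem
  add_mem' {a b} ha hb r := by
    rw [smul_add, exp_add_comm]; exact hS.mul_mem (ha r) (hb r)
  smul_mem' c a ha r := by rw [smul_smul]; exact ha _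

lemma IsClosedUnitGroup.exp_int_smul_mem {S : Set 𝔸} (hS : IsClosedUnitGroup S) {a : 𝔸}
    (ha : exp a ∈ S) (k : ℤ) : exp ((k : ℝ) • a) ∈ S := by
  have hnat : ∀ n : ℕ, ∀ b : 𝔸, exp b ∈ S → exp ((n : ℝ) • b) ∈ S := by
    intro n b hb
    induction n with
    | zero => simpa using hS.one_mem
    | succ n ih =>
      rw [Nat.cast_succ, add_smul, one_smul, exp_add_comm]
      exact hS.mul_mem ih hb
  have hneg : exp (-a) ∈ S := by
    obtain ⟨b, hb, hab⟩ := hS.exists_inv ha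
    have : b = exp (-a) := by
      calc b = (exp a * exp (-a)) * b := by rw [exp_mul_exp_neg, one_mul]
        _ = exp (-a) * (exp a * b) := by ring
        _ = exp (-a) := by rw [hab, mul_one]
    rwa [← this]
  obtain ⟨n, rfl | rfl⟩ := k.eq_nat_or_neg
  · exact_mod_cast hnat n a ha
  · have := hnat n (-a) hneg
    rw [smul_neg] at this
    simpa using this

/-- Otherwise there are `a n → 0` in `W`, nonzero, with exponentials in `S`. A limit `b` of their
directions is a unit vector that lies both in `W` and in the Lie algebra. -/
lemma IsClosedUnitGroup.exists_forall_norm_lt {S : Set 𝔸} (hS : IsClosedUnitGroup S)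
    {W : Submodule ℝ 𝔸} (hW : Disjoint (expLie S hS) W) :
    ∃ ε > 0, ∀ a ∈ W, ‖a‖ < ε → exp a ∈ S → a = 0 := by
  by_contra! hcon
  choose a haW han haS ha0 using fun n : ℕ => hcon (1 / ((n : ℝ) + 1)) (by positivity)
  have hnorm : Tendsto (fun n => ‖a n‖) atTop (𝓝 0) :=
    squeeze_zero (fun n => norm_nonneg _) (fun n => (han n).le) tendsto_one_div_add_atTop_nhds_zero_nat
  have hu : ∀ n, ‖a n‖⁻¹ • a n ∈ Metric.sphere (0 : 𝔸) 1 := fun n => by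
    simp [norm_smul, norm_ne_zero_iff.2 (ha0 n)]
  have : ProperSpace 𝔸 := FiniteDimensional.proper ℝ 𝔸
  obtain ⟨b, hb, φ, hφ, hlim⟩ := (isCompact_sphere (0 : 𝔸) 1).tendsto_subseq hu
  have hbW : b ∈ W := W.closed_of_finiteDimensional.mem_of_tendsto hlim
    (Eventually.of_forall fun n => W.smul_mem _ (haW _))
  have hbS : b ∈ expLie S hS := by
    intro r
    -- Integer multiples of `a n` approximate `r • b`, since rounding `r / ‖a n‖` costs at most `‖a
    -- n‖`. Their exponentials lie in the closed set `S`.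
    have hk : Tendsto (fun n => (⌊r * ‖a (φ n)‖⁻¹⌋ : ℝ) * ‖a (φ n)‖) atTop (𝓝 r) := by
      have h1 : Tendsto (fun n => ‖a (φ n)‖) atTop (𝓝 0) := hnorm.comp hφ.tendsto_atTop
      rw [tendsto_iff_norm_sub_tendsto_zero]
      refine squeeze_zero (fun n => norm_nonneg _) (fun n => ?_) h1
      have hp : 0 < ‖a (φ n)‖ := norm_pos_iff.2 (ha0 _)
      have e : r = r * ‖a (φ n)‖⁻¹ * ‖a (φ n)‖ := by field_simp
      nth_rewrite 2 [e]
      rw [← sub_mul, norm_mul, norm_norm, Real.norm_eq_abs]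
      refine mul_le_of_le_one_left hp.le ?_
      rw [abs_le]
      constructor <;> linarith [Int.floor_le (r * ‖a (φ n)‖⁻¹), Int.lt_floor_add_one (r * ‖a (φ n)‖⁻¹)]
    have h2 := hk.smul hlim
    have h3 := (continuous_exp' (𝔸 := 𝔸)).continuousAt.tendsto.comp h2
    refine hS.isClosed.mem_of_tendsto h3 (Eventually.of_forall fun n => ?_)
    simp only [Function.comp, smul_smul, mul_assoc]
    rw [mul_inv_cancel₀ (norm_ne_zero_iff.2 (ha0 _)), mul_one]
    exact hS.exp_int_smul_mem (haS _) _
  have hb0 : b = 0 := Submodule.disjoint_def.1 hW b hbS hbW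
  rw [hb0] at hb
  simp at hb

/-- Near `1` every element is `exp a` with `a` small. Splitting off the Lie algebra part leaves `exp
(π a) ∈ S` with `π a` small in a complement, so `π a = 0`. -/
lemma IsClosedUnitGroup.eventually_mem_exp {S : Set 𝔸} (hS : IsClosedUnitGroup S) :
    ∀ᶠ s in 𝓝 (1 : 𝔸), s ∈ S → ∃ a ∈ expLie S hS, exp a = s := by
  obtain ⟨W, hW⟩ := (expLie S hS).exists_isCompl
  obtain ⟨ε, hε, h⟩ := hS.exists_forall_norm_lt hW.disjoint
  let π : 𝔸 →ₗ[ℝ] 𝔸 := W.subtype ∘ₗ W.projectionOnto (expLie S hS) hW.symm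
  have hπ : Continuous π := π.continuous_of_finiteDimensional
  have hmap : map (exp : 𝔸 → 𝔸) (𝓝 0) = 𝓝 1 := by
    have h1 : HasStrictFDerivAt (exp : 𝔸 → 𝔸)
        ((ContinuousLinearEquiv.refl ℝ 𝔸 : 𝔸 ≃L[ℝ] 𝔸) : 𝔸 →L[ℝ] 𝔸) 0 :=
      hasStrictFDerivAt_exp_zero
    simpa using h1.map_nhds_eq_of_equiv
  rw [← hmap, eventually_map]
  have hev : ∀ᶠ a in 𝓝 (0 : 𝔸), ‖π a‖ < ε := by
    have : Tendsto (fun a => ‖π a‖) (𝓝 0) (𝓝 0) := by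
      have := (hπ.norm).tendsto 0
      simpa using this
    exact this.eventually (gt_mem_nhds hε)
  filter_upwards [hev] with a ha haS
  have hsub : a - π a ∈ expLie S hS := by
    rw [← W.projectionOnto_apply_eq_zero_iff hW.symm, map_sub, sub_eq_zero]
    exact (Submodule.projectionOnto_apply_left hW.symm _).symm
  have hπS : exp (π a) ∈ S := by
    have h1 := (expLie S hS).neg_mem hsub 1
    have h2 := hS.mul_mem haS h1
    rw [← exp_add_comm] at h2
    simpa using h2
  have := h (π a) (Submodule.coe_mem _) ha hπS
  rw [this, sub_zero] at hsub
  exact ⟨a, hsub, rfl⟩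

/-- Elements of a connected closed subgroup of the unit group of a commutative Banach algebra
are exponentials. -/
theorem IsClosedUnitGroup.exists_exp_eq {S : Set 𝔸} (hS : IsClosedUnitGroup S)
    (hc : IsPreconnected S) {s : 𝔸} (hs : s ∈ S) : ∃ a ∈ expLie S hS, exp a = s := by
  have hmem : ∀ a ∈ expLie S hS, exp a ∈ S := fun a ha => by simpa using ha 1
  have : PreconnectedSpace S := isPreconnected_iff_preconnectedSpace.1 hc
  let P : Set S := {x | ∃ a ∈ expLie S hS, exp a = (x : 𝔸)}
  -- Nearby elements of `S` differ by an exponential from the Lie algebra. Being an exponential is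
  -- therefore an open and closed condition on `S`.
  have hloc : ∀ x : S, ∀ᶠ y : S in 𝓝 x, ∃ a ∈ expLie S hS, (y : 𝔸) = exp a * x := by
    intro x
    obtain ⟨t, ht, hxt⟩ := hS.exists_inv x.2
    have hcont : Tendsto (fun y : S => t * (y : 𝔸)) (𝓝 x) (𝓝 1) := by
      have : Continuous (fun y : S => t * (y : 𝔸)) := by fun_prop
      have := this.tendsto x
      rwa [mul_comm t, hxt] at this
    filter_upwards [hcont.eventually hS.eventually_mem_exp] with y hy
    obtain ⟨a, ha, hay⟩ := hy (hS.mul_mem ht y.2)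
    refine ⟨a, ha, ?_⟩
    rw [hay, mul_right_comm, mul_comm t, hxt, one_mul]
  have hP : IsClopen P := by
    constructor
    · rw [← isOpen_compl_iff, isOpen_iff_mem_nhds]
      intro x hx
      filter_upwards [hloc x] with y ⟨a, ha, hy⟩ ⟨b, hb, hby⟩
      refine hx ⟨b - a, (expLie S hS).sub_mem hb ha, ?_⟩
      rw [sub_eq_add_neg, exp_add_comm, hby, hy, mul_right_comm, exp_mul_exp_neg, one_mul]
    · rw [isOpen_iff_mem_nhds]
      rintro x ⟨b, hb, hbx⟩
      filter_upwards [hloc x] with y ⟨a, ha, hy⟩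
      exact ⟨a + b, (expLie S hS).add_mem ha hb, by rw [exp_add_comm, hbx, hy]⟩
  have huniv := hP.eq_univ ⟨⟨1, hS.one_mem⟩, 0, Submodule.zero_mem _, exp_zero⟩
  have : (⟨s, hs⟩ : S) ∈ P := huniv ▸ Set.mem_univ _
  exact this

end ClosedSubgroup

end

/-! ### Maximal tori and their centralizers -/

section

open Filter NormedSpace
variable {E : Type*} [NormedAddCommGroup E] [NormedSpace ℝ E] [FiniteDimensional ℝ E] [CompleteSpace E]

lemma coe_exp_subalgebra (A : Subalgebra ℝ (E →L[ℝ] E)) (b : A) :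
    ((exp b : A) : E →L[ℝ] E) = exp (b : E →L[ℝ] E) := by
  have : CompleteSpace A := FiniteDimensional.complete ℝ A
  let i1 : NormedAlgebra ℚ A := NormedAlgebra.restrictScalars ℚ ℝ A
  let _ : NormedAlgebra ℚ (E →L[ℝ] E) := NormedAlgebra.restrictScalars ℚ ℝ _
  exact @map_exp A (E →L[ℝ] E) _ i1 _ _ _ _ _ _ A.val continuous_subtype_val b

/-- Elements of a compact connected commutative group of operators are exponentials of elements of
its Lie algebra. -/
theorem exists_exp_eq_of_commute {S : Set (E →L[ℝ] E)} (hcl : IsClosed S) (hcon : IsPreconnected S)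
    (h1 : 1 ∈ S) (hmul : ∀ a ∈ S, ∀ b ∈ S, a * b ∈ S) (hinv : ∀ a ∈ S, ∃ b ∈ S, a * b = 1)
    (hcomm : ∀ a ∈ S, ∀ b ∈ S, a * b = b * a) {s : E →L[ℝ] E} (hs : s ∈ S) :
    ∃ D : E →L[ℝ] E, (∀ r : ℝ, exp (r • D) ∈ S) ∧ exp D = s ∧ ∀ a ∈ S, a * D = D * a := by
  -- The algebra generated by commuting operators is commutative and finite dimensional, so the
  -- previous theorem applies inside it.
  let A := Algebra.adjoin ℝ S
  have hA : IsMulCommutative A := Algebra.isMulCommutative_adjoin ℝ hcomm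
  let inst : NormedCommRing A := { (inferInstance : NormedRing A) with mul_comm := hA.is_comm.comm }
  have hsub : S ⊆ A := Algebra.subset_adjoin
  have hemb : Topology.IsClosedEmbedding (Subtype.val : A → (E →L[ℝ] E)) := by
    refine ⟨Topology.IsEmbedding.subtypeVal, ?_⟩
    rw [Subtype.range_coe]
    exact (Subalgebra.toSubmodule A).closed_of_finiteDimensional
  have hcomp : CompleteSpace A := FiniteDimensional.complete ℝ A
  let S' : Set A := Subtype.val ⁻¹' S
  have hS' : IsClosedUnitGroup S' :=
    { isClosed := hcl.preimage continuous_subtype_val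
      one_mem := h1
      mul_mem := fun ha hb => hmul _ ha _ hb
      exists_inv := fun {a} ha => by
        obtain ⟨b, hb, hab⟩ := hinv _ ha
        exact ⟨⟨b, hsub hb⟩, hb, Subtype.ext hab⟩ }
  have hcon' : IsPreconnected S' := by
    refine hcon.preimage_of_isClosedMap Subtype.val_injective hemb.isClosedMap ?_
    rw [Subtype.range_coe]; exact hsub
  obtain ⟨a, ha, hexp⟩ := hS'.exists_exp_eq hcon' (s := ⟨s, hsub hs⟩) hs
  have hmap : ∀ b : A, exp (b : E →L[ℝ] E) = (exp b : A) := fun b => (coe_exp_subalgebra A b).symm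
  refine ⟨a, fun r => ?_, ?_, fun b hb => ?_⟩
  · have := ha r
    have h2 := hmap (r • a)
    change exp ((r • a : A) : E →L[ℝ] E) ∈ S
    rw [h2]; exact this
  · rw [hmap, hexp]
  · exact congrArg Subtype.val (hA.is_comm.comm (⟨b, hsub hb⟩ : A) a)

variable {G : Type*} [TopologicalSpace G] [ChartedSpace E G] [Group G] [LieGroup 𝓘(ℝ, E) ∞ G]

variable (E G) in
/-- The Lie bracket as a continuous bilinear map. -/
def lieOpL : E →L[ℝ] E →L[ℝ] E :=
  LinearMap.toContinuousBilinearMap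
    (E := E) (F := E) (G := E) (𝕜 := ℝ)
    (show E →ₗ[ℝ] E →ₗ[ℝ] E from ((LieModule.toEnd ℝ (LieAlg E G) (LieAlg E G) :
      LieAlg E G →ₗ[ℝ] Module.End ℝ (LieAlg E G))))

lemma lieOpL_apply (X Y : E) : lieOpL E G X Y = lieOp E G X Y := rfl

/-- The generator of a one-parameter group of automorphisms is a derivation. -/
lemma leibniz_of_exp {D : E →L[ℝ] E}
    (h : ∀ r : ℝ, ∀ X Y, exp (r • D) (lieOp E G X Y) = lieOp E G (exp (r • D) X) (exp (r • D) Y))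
    (X Y : E) : D (lieOp E G X Y) = lieOp E G X (D Y) + lieOp E G (D X) Y := by
  have hd : ∀ Z : E, HasDerivAt (fun r : ℝ => exp (r • D) Z) (D Z) 0 := fun Z => by
    have h1 := (hasDerivAt_exp_smul_const (𝕂 := ℝ) D 0).clm_apply (hasDerivAt_const (0 : ℝ) Z)
    simpa using h1
  have h3 := (lieOpL E G).hasDerivAt_of_bilinear (fun _ => hd X) (fun _ => hd Y)
  have h4 := (hd (lieOp E G X Y)).congr_of_eventuallyEq (Eventually.of_forall fun r => (h r X Y).symm)
  have h5 := h4.unique h3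
  simpa [lieOpL_apply] using h5

lemma IsOneParam.velocity_unique {X Y : E} {γ : ℝ → G} (h : IsOneParam X γ) (h' : IsOneParam Y γ) :
    X = Y := by
  have h1 := hasMFDerivAt_unique h.hasMFDerivAt_zero h'.hasMFDerivAt_zero
  have h2 := congrArg (fun f : ℝ →L[ℝ] E => f 1) h1
  exact (one_smul ℝ X).symm.trans (h2.trans (one_smul ℝ Y))

section Torus
variable [T2Space G]

lemma exists_isOneParam_lieAlg (X : LieAlg E G) : ∃ γ : ℝ → G, IsOneParam (E := E) X γ :=
  exists_isOneParam (E := E) X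

lemma mem_lieAlgOf_of_isOneParam {S : Subgroup G} {X : LieAlg E G} {γ : ℝ → G}
    (h : IsOneParam (E := E) X γ) (hS : ∀ t, γ t ∈ S) : X ∈ lieAlgOf E S :=
  Submodule.subset_span ⟨γ, h.1, h.2, hS⟩

lemma lieAlgOf_induction {S : Subgroup G} {V : Submodule ℝ (LieAlg E G)}
    (h : ∀ X γ, IsOneParam (E := E) X γ → (∀ t, γ t ∈ S) → X ∈ V) : lieAlgOf E S ≤ V := by
  refine Submodule.span_le.2 ?_
  rintro X ⟨γ, h0, h1, hS⟩
  exact h X γ ⟨h0, h1⟩ hS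

/-- The vectors fixed by the adjoint action of a set. -/
def fixedVectors (S : Set G) : Submodule ℝ (LieAlg E G) where
  carrier := {X | ∀ g ∈ S, Ad E g X = X}
  zero_mem' g _ := map_zero _
  add_mem' ha hb g hg := by rw [map_add, ha g hg, hb g hg]
  smul_mem' c X hX g hg := by rw [map_smul, hX g hg]

variable [CompactSpace G] {T : Subgroup G}

/-- The Lie algebra of a maximal torus consists of the vectors fixed by the torus. -/
lemma IsMaximalTorus.lieAlgOf_eq (hT : IsMaximalTorus T) :
    lieAlgOf E T = fixedVectors (T : Set G) := by
  have := topologicalGroup_of_lieGroup 𝓘(ℝ, E) ∞ (G := G)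
  obtain ⟨⟨hcl, hcon, hcomm⟩, hmax⟩ := hT
  apply le_antisymm
  · refine lieAlgOf_induction fun X γ h hγ g hg => ?_
    have h1 := h.conj g
    have h2 : (fun t => g * γ t * g⁻¹) = γ := by
      funext t; rw [hcomm g hg _ (hγ t), mul_inv_cancel_right]
    rw [h2] at h1
    exact IsOneParam.velocity_unique (E := E) h1 h
  · intro X hX
    obtain ⟨γ, h⟩ := exists_isOneParam_lieAlg X
    have hc : ∀ g ∈ T, ∀ t, g * γ t = γ t * g := fun g hg t => by
      have h1 := IsOneParam.conj h g
      have h2 : adOp E g (X : E) = X := hX g hg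
      rw [h2] at h1
      have h3 := congrFun (h1.unique h) t
      exact mul_inv_eq_iff_eq_mul.1 h3
    -- `T · γ(ℝ)` is connected and commutative. So is its closure, which lies in `T` by maximality.
    let S0 : Subgroup G :=
      { carrier := {x | ∃ g ∈ T, ∃ t, x = g * γ t}
        one_mem' := ⟨1, T.one_mem, 0, by rw [h.1, mul_one]⟩
        mul_mem' := by
          rintro _ _ ⟨g, hg, t, rfl⟩ ⟨g', hg', t', rfl⟩
          refine ⟨g * g', T.mul_mem hg hg', t + t', ?_⟩
          rw [h.add, mul_assoc, ← mul_assoc (γ t), ← hc g' hg' t]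
          simp only [mul_assoc]
        inv_mem' := by
          rintro _ ⟨g, hg, t, rfl⟩
          exact ⟨g⁻¹, T.inv_mem hg, -t, by rw [mul_inv_rev, h.neg, ← h.neg, hc _ (T.inv_mem hg)]⟩ }
    have hS0 : ∀ a ∈ S0, ∀ b ∈ S0, a * b = b * a := by
      rintro _ ⟨g, hg, t, rfl⟩ _ ⟨g', hg', t', rfl⟩
      have e1 : γ t * γ t' = γ t' * γ t := by rw [← h.add, add_comm, h.add]
      calc g * γ t * (g' * γ t') = g * (γ t * g') * γ t' := by simp only [mul_assoc]
        _ = (g * g') * (γ t * γ t') := by rw [← hc g' hg' t]; simp only [mul_assoc]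
        _ = (g' * g) * (γ t' * γ t) := by rw [hcomm g hg g' hg', e1]
        _ = g' * (g * γ t') * γ t := by simp only [mul_assoc]
        _ = g' * γ t' * (g * γ t) := by rw [hc g hg t']; simp only [mul_assoc]
    have hS0con : IsConnected (S0 : Set G) := by
      have : (S0 : Set G) = (fun z : G × ℝ => z.1 * γ z.2) '' ((T : Set G) ×ˢ Set.univ) := by
        ext x
        constructor
        · rintro ⟨g, hg, t, rfl⟩; exact ⟨(g, t), ⟨hg, trivial⟩, rfl⟩
        · rintro ⟨⟨g, t⟩, ⟨hg, -⟩, rfl⟩; exact ⟨g, hg, t, rfl⟩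
      rw [this]
      refine (hcon.prod isConnected_univ).image _ ?_
      exact (continuous_fst.mul (h.continuous.comp continuous_snd)).continuousOn
    have hle : T ≤ S0.topologicalClosure := fun g hg =>
      S0.le_topologicalClosure ⟨g, hg, 0, by rw [h.1, mul_one]⟩
    have hS : S0.topologicalClosure ≤ T := by
      refine hmax ⟨S0.isClosed_topologicalClosure, hS0con.closure, ?_⟩ hle
      intro a ha b hb
      let _ := S0.commGroupTopologicalClosure fun x y => Subtype.ext (hS0 x x.2 y y.2)
      exact congrArg Subtype.val (mul_comm (⟨a, ha⟩ : S0.topologicalClosure) ⟨b, hb⟩)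
    exact mem_lieAlgOf_of_isOneParam h fun t => hS (S0.le_topologicalClosure ⟨1, T.one_mem, t, by rw [one_mul]⟩)

lemma exp_apply_eq_self {D : E →L[ℝ] E} {X : E} (h : D X = 0) : exp D X = X := by
  have hd : ∀ r : ℝ, HasDerivAt (fun r : ℝ => exp (r • D) X) 0 r := fun r => by
    have h1 := (hasDerivAt_exp_smul_const (𝕂 := ℝ) D r).clm_apply (hasDerivAt_const r X)
    simpa [h] using h1
  have h2 := is_const_of_deriv_eq_zero (fun s => (hd s).differentiableAt) (fun s => (hd s).deriv) 1 0
  simpa using h2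

/-- The Lie algebra of a maximal torus is its own centralizer. -/
theorem IsMaximalTorus.mem_lieAlgOf [LieAlgebra.IsKilling ℝ (LieAlg E G)] (hT : IsMaximalTorus T)
    {X : LieAlg E G} (hX : ∀ H ∈ lieAlgOf E T, ⁅H, X⁆ = 0) : X ∈ lieAlgOf E T := by
  have := topologicalGroup_of_lieGroup 𝓘(ℝ, E) ∞ (G := G)
  obtain ⟨hcl, hcon, hcomm⟩ := hT.prop
  have hfix : lieAlgOf E T = fixedVectors (T : Set G) := hT.lieAlgOf_eq
  rw [hfix]
  intro t ht
  let S : Set (E →L[ℝ] E) := (fun g : G => adOp E g) '' T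
  -- `Ad T` is a compact connected commutative group of operators. Writing `Ad t = exp D` inside it
  -- replaces the surjectivity of the exponential map of `T`.
  obtain ⟨D, hDS, hD, hDc⟩ := exists_exp_eq_of_commute (S := S)
    ((hcl.isCompact.image (continuous_adOp E G)).isClosed)
    (hcon.isPreconnected.image _ (continuous_adOp E G).continuousOn)
    ⟨1, T.one_mem, adOp_one⟩
    (by rintro _ ⟨a, ha, rfl⟩ _ ⟨b, hb, rfl⟩; exact ⟨a * b, T.mul_mem ha hb, adOp_mul a b⟩)
    (by rintro _ ⟨a, ha, rfl⟩; exact ⟨_, ⟨a⁻¹, T.inv_mem ha, rfl⟩, adOp_mul_inv a⟩)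
    (by
      rintro _ ⟨a, ha, rfl⟩ _ ⟨b, hb, rfl⟩
      change adOp E a * adOp E b = adOp E b * adOp E a
      rw [← adOp_mul, ← adOp_mul, hcomm a ha b hb])
    (s := adOp E t) ⟨t, ht, rfl⟩
  have hleib := leibniz_of_exp (G := G) (D := D) (by
    intro r X Y
    obtain ⟨g, -, hg⟩ := hDS r
    rw [← hg]
    exact adOp_lieOp g X Y)
  let δ : LieDerivation ℝ (LieAlg E G) (LieAlg E G) :=
    { toLinearMap := (show LieAlg E G →ₗ[ℝ] LieAlg E G from (D : E →ₗ[ℝ] E))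
      leibniz' := fun X Y => by
        rw [sub_eq_add_neg, lie_skew]
        exact hleib X Y }
  -- The generator `D` is a derivation, hence inner. Its generating vector `W` is fixed by `T`
  -- because `D` commutes with `Ad T` and the centre vanishes; so `W ∈ 𝔱`, and `D X = ⁅W, X⁆ = 0`.
  obtain ⟨W, hW⟩ := LieDerivation.IsKilling.exists_eq_ad δ
  have hWD : ∀ Y : LieAlg E G, ⁅W, Y⁆ = δ Y := fun Y => by simp [← hW]
  have hWT : W ∈ lieAlgOf E T := by
    rw [hfix]
    intro g hg
    rw [← sub_eq_zero, ← LieDerivation.IsKilling.ad_apply_eq_zero_iff ℝ]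
    ext Y
    rw [LieDerivation.ad_apply_apply, LieDerivation.zero_apply, sub_lie, sub_eq_zero]
    have h1 : ⁅Ad E g W, Y⁆ = Ad E g ⁅W, Ad E g⁻¹ Y⁆ := by rw [Ad_lie, Ad_Ad_inv]
    rw [h1, hWD, hWD]
    have h2 : adOp E g (D (Ad E g⁻¹ Y)) = D (adOp E g (Ad E g⁻¹ Y)) :=
      congrArg (fun f : E →L[ℝ] E => f (Ad E g⁻¹ Y)) (hDc (adOp E g) ⟨g, hg, rfl⟩)
    exact h2.trans (congrArg D (Ad_Ad_inv g Y))
  have hDX : D X = 0 := (hWD X).symm.trans (hX W hWT)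
  have h3 := exp_apply_eq_self hDX
  rw [hD] at h3
  exact h3

lemma IsMaximalTorus.lie_eq_zero (hT : IsMaximalTorus T) {X Y : LieAlg E G}
    (hX : X ∈ lieAlgOf E T) (hY : Y ∈ lieAlgOf E T) : ⁅X, Y⁆ = 0 := by
  have hfix : lieAlgOf E T = fixedVectors (T : Set G) := hT.lieAlgOf_eq
  rw [hfix] at hY
  have hle : lieAlgOf E T ≤ LinearMap.ker ((LieModule.toEnd ℝ (LieAlg E G) (LieAlg E G) :
      LieAlg E G →ₗ[ℝ] Module.End ℝ (LieAlg E G)).flip Y) := by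
    refine lieAlgOf_induction fun Z γ h hγ => ?_
    exact h.lie_eq_zero fun t => hY _ (hγ t)
  exact hle hX

end Torus

end

/-! ### Root pairs and real root spaces -/

section

section Algebra
variable {L : Type*} [LieRing L] [LieAlgebra ℝ L]

/-- A positive definite ad-invariant form together with a self-centralizing abelian subspace. -/
structure IsTorusForm (B : LinearMap.BilinForm ℝ L) (t : Submodule ℝ L) : Prop where
  symm : ∀ X Y : L, B X Y = B Y X
  pos : ∀ X : L, X ≠ 0 → 0 < B X X
  lie_left : ∀ X Y Z : L, B ⁅X, Y⁆ Z = -B Y ⁅X, Z⁆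
  comm : ∀ H : t, ∀ H' : t, ⁅(H : L), (H' : L)⁆ = 0
  mem_of_lie : ∀ X : L, (∀ H : t, ⁅(H : L), X⁆ = 0) → X ∈ t

/-- The real root space: the sum of the weight spaces of `β` and `-β`. -/
def rootSp (t : Submodule ℝ L) (β : Module.Dual ℝ t) : Submodule ℝ L where
  carrier := {X | ∀ H H' : t, ⁅(H : L), ⁅(H' : L), X⁆⁆ = -(β H * β H') • X}
  zero_mem' H H' := by simp
  add_mem' ha hb H H' := by simp only [lie_add, ha H H', hb H H', smul_add]
  smul_mem' c X hX H H' := by simp only [lie_smul, hX H H', smul_comm c]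

lemma mem_rootSp {t : Submodule ℝ L} {β : Module.Dual ℝ t} {X : L} :
    X ∈ rootSp t β ↔ ∀ H H' : t, ⁅(H : L), ⁅(H' : L), X⁆⁆ = -(β H * β H') • X := Iff.rfl

lemma rootSp_neg (t : Submodule ℝ L) (β : Module.Dual ℝ t) : rootSp t (-β) = rootSp t β := by
  ext X; simp [mem_rootSp]

/-- The set of roots, by means of the real root spaces. -/
def rootSet (t : Submodule ℝ L) : Set (Module.Dual ℝ t) := {β | β ≠ 0 ∧ rootSp t β ≠ ⊥}

lemma neg_mem_rootSet {t : Submodule ℝ L} {β : Module.Dual ℝ t} (h : β ∈ rootSet t) :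
    -β ∈ rootSet t := ⟨neg_ne_zero.2 h.1, by rw [rootSp_neg]; exact h.2⟩

/-- `X` and `Y` are the real and imaginary part of a root vector. -/
def IsRootPair (t : Submodule ℝ L) (β : Module.Dual ℝ t) (X Y : L) : Prop :=
  ∀ H : t, ⁅(H : L), X⁆ = β H • Y ∧ ⁅(H : L), Y⁆ = -(β H) • X

lemma IsRootPair.mem_left {t : Submodule ℝ L} {β : Module.Dual ℝ t} {X Y : L}
    (h : IsRootPair t β X Y) : X ∈ rootSp t β := fun H H' => by
  rw [(h H').1, lie_smul, (h H).2, smul_smul]; congr 1; ring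

lemma IsRootPair.swap {t : Submodule ℝ L} {β : Module.Dual ℝ t} {X Y : L}
    (h : IsRootPair t β X Y) : IsRootPair t β Y (-X) := fun H => by
  rw [(h H).2, lie_neg, (h H).1]; simp

lemma IsRootPair.mem_right {t : Submodule ℝ L} {β : Module.Dual ℝ t} {X Y : L}
    (h : IsRootPair t β X Y) : Y ∈ rootSp t β := h.swap.mem_left

lemma dual_eq_or_eq_neg {V : Type*} [AddCommGroup V] [Module ℝ V] {β γ : Module.Dual ℝ V}
    (h : ∀ v w, β v * β w = γ v * γ w) : γ = β ∨ γ = -β := by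
  by_cases hβ : β = 0
  · left
    ext v
    have := h v v
    simp only [hβ, LinearMap.zero_apply, mul_zero] at this ⊢
    exact mul_self_eq_zero.1 this.symm
  · obtain ⟨v, hv⟩ : ∃ v, β v ≠ 0 := by
      by_contra! hc
      exact hβ (LinearMap.ext hc)
    rcases mul_self_eq_mul_self_iff.1 (h v v) with h1 | h1
    · left; ext w
      have := h v w
      rw [← h1] at this
      exact (mul_left_cancel₀ hv this).symm
    · right; ext w
      have := h v w
      rw [h1] at this
      have hv' : γ v ≠ 0 := fun h0 => hv (by rw [h1, h0, neg_zero])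
      have h3 : γ v * (-β w) = γ v * γ w := by rw [← this]; ring
      simpa using (mul_left_cancel₀ hv' h3).symm

namespace IsTorusForm
variable {B : LinearMap.BilinForm ℝ L} {t : Submodule ℝ L} (hB : IsTorusForm B t)
include hB

lemma eq_zero_of_self {X : L} (h : B X X = 0) : X = 0 := by
  by_contra h0
  exact (hB.pos X h0).ne' h

lemma self_nonneg (X : L) : 0 ≤ B X X := by
  by_cases h : X = 0
  · simp [h]
  · exact (hB.pos X h).le

lemma lie_comm (H H' : t) (X : L) : ⁅(H : L), ⁅(H' : L), X⁆⁆ = ⁅(H' : L), ⁅(H : L), X⁆⁆ := by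
  rw [leibniz_lie, hB.comm, zero_lie, zero_add]

lemma lie_lie_left (H H' : t) (X Y : L) :
    B ⁅(H : L), ⁅(H' : L), X⁆⁆ Y = B X ⁅(H : L), ⁅(H' : L), Y⁆⁆ := by
  rw [hB.lie_left, hB.lie_left, neg_neg, hB.lie_comm]

/-- By invariance, the length of `⁅H, X⁆` is a pairing of `X` with a bracket of two elements of `t`.
-/
lemma eq_zero_of_lie_mem {H : t} {X : L} (h : ⁅(H : L), X⁆ ∈ t) : ⁅(H : L), X⁆ = 0 := by
  apply hB.eq_zero_of_self
  rw [hB.lie_left, hB.comm H ⟨_, h⟩, map_zero, neg_zero]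

/-- Every vector of a root space is part of a root pair. -/
lemma exists_isRootPair {β : Module.Dual ℝ t} (hβ : β ≠ 0) {X : L} (hX : X ∈ rootSp t β) :
    ∃ Y, IsRootPair t β X Y := by
  obtain ⟨H₁, h1⟩ : ∃ v, β v ≠ 0 := by
    by_contra! hc
    exact hβ (LinearMap.ext hc)
  have h2 : ∀ H : t, ⁅(H : L), (β H₁)⁻¹ • ⁅(H₁ : L), X⁆⁆ = -(β H) • X := fun H => by
    rw [lie_smul, hX, smul_smul]; congr 1; field_simp
  refine ⟨(β H₁)⁻¹ • ⁅(H₁ : L), X⁆, fun H => ⟨?_, h2 H⟩⟩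
  -- This combination lies in `ker β`, so its bracket with `X` is killed by all of `t`. The bracket
  -- is then in `t`, hence zero, and `⁅H, X⁆` depends only on `β H`.
  have h3 : ⁅((β H₁ • H - β H • H₁ : t) : L), X⁆ ∈ t := by
    apply hB.mem_of_lie
    intro H'
    rw [hX]
    simp [mul_comm]
  have h4 := hB.eq_zero_of_lie_mem h3
  simp only [Submodule.coe_sub, Submodule.coe_smul, sub_lie, smul_lie, sub_eq_zero] at h4
  rw [smul_smul, mul_comm, ← smul_smul, ← h4, smul_smul, inv_mul_cancel₀ h1, one_smul]

lemma IsRootPair_self_eq {β : Module.Dual ℝ t} (hβ : β ≠ 0) {X Y : L} (h : IsRootPair t β X Y) :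
    B Y Y = B X X ∧ B X Y = 0 := by
  obtain ⟨H, h1⟩ : ∃ v, β v ≠ 0 := by
    by_contra! hc
    exact hβ (LinearMap.ext hc)
  have e1 := hB.lie_left H X Y
  have e2 := hB.lie_left H X X
  rw [(h H).1, (h H).2] at e1
  rw [(h H).1, hB.symm X] at e2
  simp only [map_smul, LinearMap.smul_apply, smul_eq_mul, neg_mul, neg_neg] at e1 e2
  refine ⟨mul_left_cancel₀ h1 e1, ?_⟩
  rw [hB.symm]
  have : β H * B Y X = 0 := by linarith
  exact (mul_eq_zero.1 this).resolve_left h1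

lemma mem_rootSet_iff {β : Module.Dual ℝ t} :
    β ∈ rootSet t ↔ β ≠ 0 ∧ ∃ X Y : L, (X ≠ 0 ∨ Y ≠ 0) ∧ IsRootPair t β X Y := by
  constructor
  · rintro ⟨h0, h⟩
    obtain ⟨X, hX, hX0⟩ := (Submodule.ne_bot_iff _).1 h
    obtain ⟨Y, hY⟩ := hB.exists_isRootPair h0 hX
    exact ⟨h0, X, Y, Or.inl hX0, hY⟩
  · rintro ⟨h0, X, Y, h, hXY⟩
    refine ⟨h0, (Submodule.ne_bot_iff _).2 ?_⟩
    rcases h with h | h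
    · exact ⟨X, hXY.mem_left, h⟩
    · exact ⟨Y, hXY.mem_right, h⟩

/-- The two members of a root pair are orthogonal and of equal length. Only this lower bound for the
dimension is needed, not equality. -/
lemma two_le_finrank_rootSp [FiniteDimensional ℝ L] {β : Module.Dual ℝ t} (hβ : β ∈ rootSet t) :
    2 ≤ Module.finrank ℝ (rootSp t β) := by
  obtain ⟨X, hX, hX0⟩ := (Submodule.ne_bot_iff _).1 hβ.2
  obtain ⟨Y, hY⟩ := hB.exists_isRootPair hβ.1 hX
  obtain ⟨e1, e2⟩ := hB.IsRootPair_self_eq hβ.1 hY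
  have hp := hB.pos X hX0
  have hli : LinearIndependent ℝ ![(⟨X, hX⟩ : rootSp t β), ⟨Y, hY.mem_right⟩] := by
    rw [LinearIndependent.pair_iff]
    intro a b hab
    have hab' : a • X + b • Y = 0 := congrArg Subtype.val hab
    have h1 : B X (a • X + b • Y) = 0 := by rw [hab', map_zero]
    have h2 : B Y (a • X + b • Y) = 0 := by rw [hab', map_zero]
    simp only [map_add, map_smul, smul_eq_mul, e2, hB.symm Y X, e1, mul_zero, add_zero, zero_add, mul_eq_zero] at h1 h2
    exact ⟨h1.resolve_right hp.ne', h2.resolve_right hp.ne'⟩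
  simpa using hli.fintype_card_le_finrank

/-- Root spaces are orthogonal. -/
lemma rootSp_orthogonal {β γ : Module.Dual ℝ t} (h1 : γ ≠ β) (h2 : γ ≠ -β) {X Y : L}
    (hX : X ∈ rootSp t β) (hY : Y ∈ rootSp t γ) : B X Y = 0 := by
  by_contra h0
  have key : ∀ H H' : t, β H * β H' = γ H * γ H' := fun H H' => by
    have h := hB.lie_lie_left H H' X Y
    rw [hX, hY] at h
    simp only [map_smul, LinearMap.smul_apply, smul_eq_mul, neg_mul, neg_inj] at h
    exact mul_right_cancel₀ h0 h
  exact (dual_eq_or_eq_neg key).elim h1 h2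

lemma le_rootSp_zero : t ≤ rootSp t 0 := fun X hX H H' => by
  rw [hB.comm H' ⟨X, hX⟩]; simp

lemma rootSp_orthogonal_torus {β : Module.Dual ℝ t} (h0 : β ≠ 0) {X H : L}
    (hX : X ∈ rootSp t β) (hH : H ∈ t) : B X H = 0 :=
  hB.rootSp_orthogonal (γ := 0) h0.symm (by simpa using h0) hX (hB.le_rootSp_zero hH)

end IsTorusForm
end Algebra

end

/-! ### Euclidean linear algebra and the root space decomposition -/

section

section Euclid
variable {V : Type*} [AddCommGroup V] [Module ℝ V] [FiniteDimensional ℝ V]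
  {B : LinearMap.BilinForm ℝ V}

/-- The inner product space core of a positive definite form. -/
abbrev coreOfForm (hs : ∀ X Y, B X Y = B Y X) (hp : ∀ X, X ≠ 0 → 0 < B X X) :
    InnerProductSpace.Core ℝ V where
  inner X Y := B X Y
  conj_inner_symm X Y := by simp [hs X Y]
  re_inner_nonneg X := by
    by_cases h : X = 0
    · simp [h]
    · simpa using (hp X h).le
  add_left X Y Z := by simp
  smul_left X Y r := by simp
  definite X h := by
    by_contra h0
    exact (hp X h0).ne' h

lemma exists_basis_trace_eq (hs : ∀ X Y, B X Y = B Y X) (hp : ∀ X, X ≠ 0 → 0 < B X X) :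
    ∃ e : Module.Basis (Fin (Module.finrank ℝ V)) ℝ V,
      ∀ D : Module.End ℝ V, LinearMap.trace ℝ V D = ∑ i, B (e i) (D (e i)) := by
  let _ : NormedAddCommGroup V := (coreOfForm hs hp).toNormedAddCommGroup
  let _ : InnerProductSpace ℝ V := InnerProductSpace.ofCore (coreOfForm hs hp).toCore
  exact ⟨(stdOrthonormalBasis ℝ V).toBasis, fun D => by
    rw [LinearMap.trace_eq_sum_inner D (stdOrthonormalBasis ℝ V)]
    simp; rfl⟩

lemma iSup_iInf_eigenspace_eq_top (hs : ∀ X Y, B X Y = B Y X) (hp : ∀ X, X ≠ 0 → 0 < B X X)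
    {ι : Type*} {F : ι → Module.End ℝ V} (hF : ∀ i X Y, B (F i X) Y = B X (F i Y))
    (hc : ∀ i j, Commute (F i) (F j)) :
    ⨆ χ : ι → ℝ, ⨅ i, Module.End.eigenspace (F i) (χ i) = ⊤ := by
  let _ : NormedAddCommGroup V := (coreOfForm hs hp).toNormedAddCommGroup
  let _ : InnerProductSpace ℝ V := InnerProductSpace.ofCore (coreOfForm hs hp).toCore
  exact LinearMap.IsSymmetric.iSup_iInf_eq_top_of_commute (𝕜 := ℝ) (T := F) (fun i X Y => hF i X Y)
    fun i j _ => hc i j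

/-- In an orthonormal basis, `tr (D²) = -∑ |D eᵢ|²` for skew `D`. -/
lemma trace_mul_self_nonpos (hs : ∀ X Y, B X Y = B Y X) (hp : ∀ X, X ≠ 0 → 0 < B X X)
    {D : Module.End ℝ V} (hD : ∀ X Y, B (D X) Y = -B X (D Y)) :
    LinearMap.trace ℝ V (D * D) ≤ 0 ∧ (LinearMap.trace ℝ V (D * D) = 0 → D = 0) := by
  obtain ⟨e, he⟩ := exists_basis_trace_eq hs hp
  have h0 : ∀ X, 0 ≤ B X X := fun X => by
    by_cases h : X = 0
    · simp [h]
    · exact (hp X h).le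
  have h1 : ∀ i, B (e i) ((D * D) (e i)) = -B (D (e i)) (D (e i)) := fun i => by
    rw [hD, neg_neg]; rfl
  rw [he]
  simp only [h1, Finset.sum_neg_distrib, neg_nonpos, neg_eq_zero]
  refine ⟨Finset.sum_nonneg fun i _ => h0 _, fun h => e.ext fun i => ?_⟩
  have := (Finset.sum_eq_zero_iff_of_nonneg fun i _ => h0 _).1 h i (Finset.mem_univ i)
  by_contra hc
  exact (hp _ hc).ne' this
end Euclid

section Algebra
variable {L : Type*} [LieRing L] [LieAlgebra ℝ L] [FiniteDimensional ℝ L]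
namespace IsTorusForm
variable {B : LinearMap.BilinForm ℝ L} {t : Submodule ℝ L} (hB : IsTorusForm B t)
include hB

/-- The root space decomposition. -/
lemma sup_iSup_rootSp_eq_top : t ⊔ ⨆ β ∈ rootSet t, rootSp t β = ⊤ := by
  rw [eq_top_iff, ← iSup_iInf_eigenspace_eq_top hB.symm hB.pos
    (F := fun i : t × t => LieAlgebra.ad ℝ L i.1 * LieAlgebra.ad ℝ L i.2)
    (fun i X Y => hB.lie_lie_left i.1 i.2 X Y) ?_]
  · refine iSup_le fun χ X hX => ?_
    have hX' : ∀ H H' : t, ⁅(H : L), ⁅(H' : L), X⁆⁆ = χ (H, H') • X := fun H H' =>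
      Module.End.mem_eigenspace_iff.1 ((Submodule.mem_iInf _).1 hX (H, H'))
    by_cases hc : ∀ H, χ (H, H) • X = 0
    · refine Submodule.mem_sup_left (hB.mem_of_lie _ fun H => hB.eq_zero_of_self ?_)
      rw [hB.lie_left, hX', hc, map_zero, neg_zero]
    · push Not at hc
      obtain ⟨H₁, h1⟩ := hc
      have hX0 : X ≠ 0 := fun h => h1 (by rw [h, smul_zero])
      have hneg : χ (H₁, H₁) < 0 := by
        have h2 : B ⁅(H₁ : L), X⁆ ⁅(H₁ : L), X⁆ = -(χ (H₁, H₁) * B X X) := by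
          rw [hB.lie_left, hX', map_smul, smul_eq_mul]
        have h3 := hB.self_nonneg ⁅(H₁ : L), X⁆
        rw [h2] at h3
        have h4 := hB.pos X hX0
        rcases lt_trichotomy (χ (H₁, H₁)) 0 with h | h | h
        · exact h
        · exact absurd (by rw [h, zero_smul]) h1
        · nlinarith [mul_pos h h4]
      -- The joint eigenvalues should satisfy `χ (H, H') = -β(H) β(H')`. This determines `β` up to
      -- sign; the sign is fixed by `β(H₁) = c > 0`.
      set c := Real.sqrt (-χ (H₁, H₁)) with hcdef
      have hcpos : 0 < c := Real.sqrt_pos.2 (by linarith)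
      have hc2 : c * c = -χ (H₁, H₁) := Real.mul_self_sqrt (by linarith)
      have hadd : ∀ H H' K : t, χ (H + H', K) = χ (H, K) + χ (H', K) := fun H H' K => by
        have : χ (H + H', K) • X = (χ (H, K) + χ (H', K)) • X := by
          rw [← hX', add_smul, ← hX', ← hX']; simp
        exact smul_left_injective ℝ hX0 this
      have hsmul : ∀ (r : ℝ) (H K : t), χ (r • H, K) = r * χ (H, K) := fun r H K => by
        have : χ (r • H, K) • X = (r * χ (H, K)) • X := by
          rw [← hX', mul_smul, ← hX']; simp
        exact smul_left_injective ℝ hX0 this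
      let β : Module.Dual ℝ t :=
        { toFun := fun H => -χ (H, H₁) / c
          map_add' := fun H H' => by rw [hadd]; ring
          map_smul' := fun r H => by rw [hsmul]; simp; ring }
      have hβ : ∀ H, χ (H, H₁) = -(c * β H) := fun H => by
        change _ = -(c * (-χ (H, H₁) / c))
        field_simp
      have hβ1 : β H₁ = c := by
        have := hβ H₁
        rw [← neg_eq_iff_eq_neg, ← hc2] at this
        exact (mul_left_cancel₀ hcpos.ne' this).symm
      -- Apply `(ad H₁)²` to `⁅H, X⁆`: commuting the operators in two ways gives `χ (H, H₁) • ⁅H₁,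
      -- X⁆` and `χ (H₁, H₁) • ⁅H, X⁆`.
      have h5 : ∀ H : t, ⁅(H : L), X⁆ = (β H / c) • ⁅(H₁ : L), X⁆ := fun H => by
        have h6 : ⁅(H₁ : L), ⁅(H₁ : L), ⁅(H : L), X⁆⁆⁆ = χ (H, H₁) • ⁅(H₁ : L), X⁆ := by
          rw [hB.lie_comm H₁ H, hX', lie_smul]
        rw [hB.lie_comm H₁ H, hB.lie_comm H₁ H, hX', lie_smul, hβ, hβ, hβ1] at h6
        have h7 : -(c * c) ≠ 0 := by simpa using hcpos.ne'
        apply smul_right_injective L h7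
        simp only [h6, smul_smul]
        congr 1; field_simp
      have hXβ : X ∈ rootSp t β := fun H H' => by
        rw [h5 H', lie_smul, hX', smul_smul, hβ]
        congr 1; field_simp
      exact Submodule.mem_sup_right (Submodule.mem_iSup_of_mem β (Submodule.mem_iSup_of_mem
        ⟨fun h => hcpos.ne' (by rw [← hβ1, h]; rfl), (Submodule.ne_bot_iff _).2 ⟨X, hXβ, hX0⟩⟩ hXβ))
  · intro i j
    ext X
    simp only [Module.End.mul_apply, LieAlgebra.ad_apply]
    rw [hB.lie_comm i.2 j.1, hB.lie_comm i.1 j.1, hB.lie_comm i.2 j.2, hB.lie_comm i.1 j.2]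
end IsTorusForm
end Algebra

end

/-! ### The Morse index as a sum over roots -/

section

section Index
variable {L V : Type*} [AddCommGroup L] [Module ℝ L] [FiniteDimensional ℝ L]
  [AddCommGroup V] [Module ℝ V]

/-- The index of a function that is negative on `N₁` and nonnegative on a complement. -/
lemma sSup_finrank_eq {f : L →ₗ[ℝ] V} (hf : Function.Surjective f) {q : V → ℝ} (hq : q 0 = 0)
    {N₁ N₂ : Submodule ℝ L} (hsup : N₁ ⊔ N₂ = ⊤) (h1 : ∀ X ∈ N₁, X ≠ 0 → q (f X) < 0)
    (h2 : ∀ X ∈ N₂, 0 ≤ q (f X)) :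
    sSup {k | ∃ N : Submodule ℝ V, Module.finrank ℝ N = k ∧ ∀ v ∈ N, v ≠ 0 → q v < 0} =
      Module.finrank ℝ N₁ := by
  have : FiniteDimensional ℝ V := Module.Finite.of_surjective f hf
  have hinj : ∀ X ∈ N₁, f X = 0 → X = 0 := fun X hX h => by
    by_contra h0
    have := h1 X hX h0
    rw [h, hq] at this
    exact lt_irrefl _ this
  have hr : Module.finrank ℝ (N₁.map f) = Module.finrank ℝ N₁ := by
    rw [← LinearMap.range_domRestrict]
    refine LinearMap.finrank_range_of_inj ((injective_iff_map_eq_zero _).2 fun X hX => ?_)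
    exact Subtype.ext (hinj X X.2 hX)
  have hle : ∀ N : Submodule ℝ V, (∀ v ∈ N, v ≠ 0 → q v < 0) →
      Module.finrank ℝ N ≤ Module.finrank ℝ N₁ := fun N hN => by
    -- A negative subspace meets `f(N₂)` only in `0`. Its dimension is at most the codimension of
    -- `f(N₂)`, hence at most `dim N₁`.
    have hdis : N ⊓ N₂.map f = ⊥ := by
      rw [eq_bot_iff]
      rintro _ ⟨ha, X, hX, rfl⟩
      by_contra h0
      exact absurd (hN _ ha h0) (not_lt.2 (h2 X hX))
    have e1 := Submodule.finrank_sup_add_finrank_inf_eq N (N₂.map f)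
    have e2 := Submodule.finrank_sup_add_finrank_inf_eq (N₁.map f) (N₂.map f)
    have e3 := Submodule.finrank_le (N ⊔ N₂.map f)
    rw [hdis, finrank_bot] at e1
    rw [← Submodule.map_sup, hsup, Submodule.map_top, LinearMap.range_eq_top.2 hf, finrank_top, hr] at e2
    omega
  apply IsGreatest.csSup_eq
  refine ⟨⟨N₁.map f, hr, ?_⟩, ?_⟩
  · rintro _ ⟨X, hX, rfl⟩ h0
    exact h1 X hX fun h => h0 (by rw [h, map_zero])
  · rintro _ ⟨N, rfl, hN⟩
    exact hle N hN

end Index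

section Algebra
variable {L : Type*} [LieRing L] [LieAlgebra ℝ L] [FiniteDimensional ℝ L]

/-- The roots that are positive on `ξ`. -/
def posRoots (t : Submodule ℝ L) (ξ : t) : Set (Module.Dual ℝ t) := {β ∈ rootSet t | 0 < β ξ}

namespace IsTorusForm
variable {B : LinearMap.BilinForm ℝ L} {t : Submodule ℝ L} (hB : IsTorusForm B t)
include hB

omit [FiniteDimensional ℝ L] in
lemma rootSp_orthogonal_of_pos {ξ : t} {β γ : Module.Dual ℝ t} (hβ : 0 < β ξ) (hγ : 0 < γ ξ)
    (h : β ≠ γ) {X Y : L} (hX : X ∈ rootSp t β) (hY : Y ∈ rootSp t γ) : B X Y = 0 :=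
  hB.rootSp_orthogonal h.symm (fun h => by rw [h] at hγ; simp at hγ; linarith) hX hY

/-- Nonzero vectors chosen from the root spaces of distinct positive roots are orthogonal, hence
linearly independent. -/
lemma finite_posRoots (ξ : t) : (posRoots t ξ).Finite := by
  have hne : ∀ β : posRoots t ξ, ∃ X ∈ rootSp t β.1, X ≠ 0 := fun β =>
    (Submodule.ne_bot_iff _).1 β.2.1.2
  choose v hv hv0 using hne
  have hli : LinearIndependent ℝ v := LinearMap.BilinForm.linearIndependent_of_iIsOrtho (B := B)
    (fun β γ h => hB.rootSp_orthogonal_of_pos β.2.2 γ.2.2 (fun h' => h (Subtype.ext h')) (hv β) (hv γ))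
    fun β h => hv0 β (hB.eq_zero_of_self h)
  have := hli.finite_of_isNoetherian
  exact Set.toFinite _

lemma sup_iSup_posRoots_eq_top {ξ : t} (hξ : ∀ β ∈ rootSet t, β ξ ≠ 0) :
    t ⊔ ⨆ β ∈ posRoots t ξ, rootSp t β = ⊤ := by
  rw [eq_top_iff, ← hB.sup_iSup_rootSp_eq_top]
  refine sup_le le_sup_left (iSup₂_le fun β hβ => le_sup_of_le_right ?_)
  rcases (hξ β hβ).lt_or_gt with h | h
  · rw [← rootSp_neg]
    exact le_iSup₂_of_le (-β) ⟨neg_mem_rootSet hβ, by simpa using h⟩ le_rfl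
  · exact le_iSup₂_of_le β ⟨hβ, h⟩ le_rfl

lemma finrank_iSup_rootSp {ξ : t} (F : Finset (Module.Dual ℝ t)) (hF : ∀ β ∈ F, 0 < β ξ) :
    Module.finrank ℝ (⨆ β ∈ F, rootSp t β : Submodule ℝ L) =
      ∑ β ∈ F, Module.finrank ℝ (rootSp t β) := by
  classical
  induction F using Finset.induction_on with
  | empty => simp
  | insert β F hβ ih =>
    rw [Finset.sum_insert hβ, ← ih fun γ hγ => hF γ (Finset.mem_insert_of_mem hγ),
      ← Submodule.finrank_sup_add_finrank_inf_eq, Finset.iSup_insert]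
    have : rootSp t β ⊓ ⨆ γ ∈ F, rootSp t γ = ⊥ := by
      rw [eq_bot_iff]
      rintro X ⟨h1, h2⟩
      obtain ⟨μ, hμ⟩ := (Submodule.mem_iSup_finset_iff_exists_sum _ _).1 h2
      refine hB.eq_zero_of_self ((congrArg (B X) hμ.symm).trans ?_)
      rw [map_sum]
      refine Finset.sum_eq_zero fun γ hγ => ?_
      exact hB.rootSp_orthogonal_of_pos (hF β (Finset.mem_insert_self _ _))
        (hF γ (Finset.mem_insert_of_mem hγ)) (fun h => hβ (h ▸ hγ)) h1 (μ γ).2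
    rw [this, finrank_bot, add_zero]

-- This diagonalizes the Hessian: the sign on the root space of `β` is that of `-β(ξ) β(P)`.
omit [FiniteDimensional ℝ L] in
lemma form_eq_sum {ξ : t} (P : t) (F : Finset (Module.Dual ℝ t)) (hF : ∀ β ∈ F, 0 < β ξ)
    (μ : ∀ β : Module.Dual ℝ t, rootSp t β) :
    B ⁅(ξ : L), ⁅(P : L), ∑ β ∈ F, (μ β : L)⁆⁆ (∑ β ∈ F, (μ β : L)) =
      -∑ β ∈ F, β ξ * β P * B (μ β) (μ β) := by
  rw [lie_sum, lie_sum, map_sum B, LinearMap.sum_apply, ← Finset.sum_neg_distrib]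
  refine Finset.sum_congr rfl fun β hβ => ?_
  rw [(μ β).2, map_sum, Finset.sum_eq_single β]
  · simp
  · intro γ hγ h
    rw [map_smul, LinearMap.smul_apply, hB.rootSp_orthogonal_of_pos (hF β hβ) (hF γ hγ) h.symm (μ β).2 (μ γ).2, smul_zero]
  · exact fun h => absurd hβ h

/-- The index of the Hessian in terms of the root spaces. -/
lemma sSup_finrank_eq_sum {V : Type*} [AddCommGroup V] [Module ℝ V] {ξ : t}
    (hξ : ∀ β ∈ rootSet t, β ξ ≠ 0) (P : t) {f : L →ₗ[ℝ] V} (hf : Function.Surjective f)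
    {q : V → ℝ} (hq : ∀ X, q (f X) = B ⁅(ξ : L), ⁅(P : L), X⁆⁆ X)
    {A : Finset (Module.Dual ℝ t)} (hA : ∀ β, β ∈ A ↔ β ∈ posRoots t ξ ∧ 0 < β P) :
    sSup {k | ∃ N : Submodule ℝ V, Module.finrank ℝ N = k ∧ ∀ v ∈ N, v ≠ 0 → q v < 0} =
      ∑ β ∈ A, Module.finrank ℝ (rootSp t β) := by
  classical
  have hA' : ∀ β ∈ A, 0 < β ξ := fun β hβ => ((hA β).1 hβ).1.2
  rw [← hB.finrank_iSup_rootSp A hA']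
  set C : Finset (Module.Dual ℝ t) := {β ∈ (hB.finite_posRoots ξ).toFinset | ¬ 0 < β P} with hC
  have hC' : ∀ β ∈ C, 0 < β ξ ∧ β P ≤ 0 := fun β hβ => by
    simp [hC] at hβ
    exact ⟨hβ.1.2, hβ.2⟩
  refine sSup_finrank_eq hf (by simpa using hq 0) (N₂ := t ⊔ ⨆ β ∈ C, rootSp t β) ?_ ?_ ?_
  · rw [eq_top_iff, ← hB.sup_iSup_posRoots_eq_top hξ]
    refine sup_le (le_sup_of_le_right le_sup_left) (iSup₂_le fun β hβ => ?_)
    by_cases h : 0 < β P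
    · exact le_sup_of_le_left (le_iSup₂_of_le β ((hA β).2 ⟨hβ, h⟩) le_rfl)
    · exact le_sup_of_le_right (le_sup_of_le_right (le_iSup₂_of_le β (by simp [hC, hβ]; linarith) le_rfl))
  · intro X hX hX0
    obtain ⟨μ, rfl⟩ := (Submodule.mem_iSup_finset_iff_exists_sum _ _).1 hX
    rw [hq, hB.form_eq_sum P A hA', neg_lt_zero]
    have h0 : ∀ β ∈ A, 0 ≤ β ξ * β P * B (μ β) (μ β) := fun β hβ =>
      mul_nonneg (mul_pos (hA' β hβ) ((hA β).1 hβ).2).le (hB.self_nonneg _)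
    refine (Finset.sum_nonneg h0).lt_of_ne fun h => hX0 ?_
    refine Finset.sum_eq_zero fun β hβ => hB.eq_zero_of_self ?_
    have := (Finset.sum_eq_zero_iff_of_nonneg h0).1 h.symm β hβ
    exact (mul_eq_zero.1 this).resolve_left (mul_pos (hA' β hβ) ((hA β).1 hβ).2).ne'
  · intro X hX
    obtain ⟨H, hH, Y, hY, rfl⟩ := Submodule.mem_sup.1 hX
    obtain ⟨μ, rfl⟩ := (Submodule.mem_iSup_finset_iff_exists_sum _ _).1 hY
    have h1 : ⁅(P : L), H⁆ = 0 := hB.comm P ⟨H, hH⟩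
    have h2 : ∀ Y : L, B ⁅(ξ : L), Y⁆ H = 0 := fun Y => by
      rw [hB.lie_left, hB.comm ξ ⟨H, hH⟩, map_zero, neg_zero]
    rw [hq, lie_add, h1, zero_add, map_add, h2, zero_add,
      hB.form_eq_sum P C fun β hβ => (hC' β hβ).1, ← Finset.sum_neg_distrib]
    refine Finset.sum_nonneg fun β hβ => ?_
    have := mul_nonneg (mul_nonneg (hC' β hβ).1.le (neg_nonneg.2 (hC' β hβ).2)) (hB.self_nonneg (μ β : L))
    linarith

/-- The centralizer of a subset on which no root vanishes is the torus. -/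
lemma mem_of_forall_lie_eq_zero {ξ : t} (hξ : ∀ β ∈ rootSet t, β ξ ≠ 0) {C : Set t}
    (hC : ∀ β ∈ rootSet t, ∃ H ∈ C, β H ≠ 0) {X : L} (hX : ∀ H ∈ C, ⁅(H : L), X⁆ = 0) :
    X ∈ t := by
  classical
  obtain ⟨H, hH, Y, hY, rfl⟩ := Submodule.mem_sup.1
    ((hB.sup_iSup_posRoots_eq_top hξ).ge (Submodule.mem_top (x := X)))
  have hfin := hB.finite_posRoots ξ
  rw [show (⨆ β ∈ posRoots t ξ, rootSp t β) = ⨆ β ∈ hfin.toFinset, rootSp t β by simp] at hY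
  obtain ⟨μ, rfl⟩ := (Submodule.mem_iSup_finset_iff_exists_sum _ _).1 hY
  have hpos : ∀ β ∈ hfin.toFinset, 0 < β ξ := fun β hβ => ((hfin.mem_toFinset).1 hβ).2
  have hsum : ∑ β ∈ hfin.toFinset, (μ β : L) = 0 := by
    refine Finset.sum_eq_zero fun β hβ => ?_
    obtain ⟨K, hK, hβK⟩ := hC β ((hfin.mem_toFinset).1 hβ).1
    have h := hX K hK
    rw [lie_add, hB.comm K ⟨H, hH⟩, zero_add] at h
    have h1 : B ⁅(K : L), ⁅(K : L), ∑ γ ∈ hfin.toFinset, (μ γ : L)⁆⁆ (μ β) =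
        -(β K * β K * B (μ β) (μ β)) := by
      rw [hB.lie_lie_left, (μ β).2, map_smul, map_sum B, LinearMap.sum_apply,
        Finset.sum_eq_single β]
      · simp
      · exact fun γ hγ hne => hB.rootSp_orthogonal_of_pos (hpos γ hγ) (hpos β hβ) hne (μ γ).2 (μ β).2
      · exact fun h => absurd hβ h
    rw [h, lie_zero, map_zero, LinearMap.zero_apply, eq_comm, neg_eq_zero] at h1
    exact hB.eq_zero_of_self ((mul_eq_zero.1 h1).resolve_left (mul_ne_zero hβK hβK))
  rw [hsum, add_zero]
  exact hH

end IsTorusForm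
end Algebra

end

/-! ### The Killing form, automorphisms preserving the torus, and coroots -/

section

section Killing
variable {L : Type*} [LieRing L] [LieAlgebra ℝ L] [FiniteDimensional ℝ L]
  {B : LinearMap.BilinForm ℝ L}

/-- The Killing form is negative if there is a positive definite ad-invariant form. -/
lemma killingForm_self_nonpos (hs : ∀ X Y, B X Y = B Y X) (hp : ∀ X, X ≠ 0 → 0 < B X X)
    (hl : ∀ X Y Z : L, B ⁅X, Y⁆ Z = -B Y ⁅X, Z⁆) (hz : LieAlgebra.center ℝ L = ⊥) {X : L}
    (h : killingForm ℝ L X X = 0) : X = 0 := by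
  rw [killingForm_apply_apply] at h
  have h1 := (trace_mul_self_nonpos hs hp (D := LieAlgebra.ad ℝ L X) (hl X)).2 h
  have h2 : X ∈ LieAlgebra.center ℝ L := by
    rw [LieAlgebra.center, LieModule.mem_maxTrivSubmodule]
    intro Y
    rw [← lie_skew, ← LieAlgebra.ad_apply ℝ, h1, LinearMap.zero_apply, neg_zero]
  rw [hz] at h2
  exact h2

lemma isKilling_of_form (hs : ∀ X Y, B X Y = B Y X) (hp : ∀ X, X ≠ 0 → 0 < B X X)
    (hl : ∀ X Y Z : L, B ⁅X, Y⁆ Z = -B Y ⁅X, Z⁆) (hz : LieAlgebra.center ℝ L = ⊥) :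
    LieAlgebra.IsKilling ℝ L := ⟨by
  rw [LieSubmodule.eq_bot_iff]
  intro X hX
  exact killingForm_self_nonpos hs hp hl hz ((LieIdeal.mem_killingCompl ℝ L ⊤).1 hX X (by simp))⟩

end Killing

section Algebra
variable {L : Type*} [LieRing L] [LieAlgebra ℝ L]

lemma IsRootPair.lie_lie_eq_zero {t : Submodule ℝ L} {β : Module.Dual ℝ t} {X Y : L}
    (h : IsRootPair t β X Y) (H : t) : ⁅(H : L), ⁅X, Y⁆⁆ = 0 := by
  rw [leibniz_lie, (h H).1, (h H).2]; simp

/-- Only ad-invariance of `D` enters, so this serves for both `B` and the Killing form. -/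
lemma IsRootPair.form_lie {t : Submodule ℝ L} {β : Module.Dual ℝ t} {X Y : L}
    (h : IsRootPair t β X Y) {D : LinearMap.BilinForm ℝ L}
    (hD : ∀ X Y Z : L, D ⁅X, Y⁆ Z = -D Y ⁅X, Z⁆) (H : t) : D H ⁅X, Y⁆ = β H * D Y Y := by
  rw [← neg_eq_iff_eq_neg.2 (hD X H Y), ← lie_skew, (h H).1]; simp

lemma rootSp_map {t : Submodule ℝ L} {s : t →ₗ[ℝ] t} (hs : ∀ H, s (s H) = H) {w : L ≃ₗ⁅ℝ⁆ L}
    (hw : ∀ H : t, w H = s H) (β : Module.Dual ℝ t) {X : L} (hX : X ∈ rootSp t β) :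
    w X ∈ rootSp t (β ∘ₗ s) := fun H H' => by
  have h1 : ∀ K : t, (K : L) = w (s K) := fun K => by rw [hw, hs]
  rw [h1 H, h1 H', ← LieEquiv.map_lie, ← LieEquiv.map_lie, hX, map_smul]
  rfl

lemma comp_mem_rootSet {t : Submodule ℝ L} {s : t →ₗ[ℝ] t} (hs : ∀ H, s (s H) = H) {w : L ≃ₗ⁅ℝ⁆ L}
    (hw : ∀ H : t, w H = s H) {β : Module.Dual ℝ t} (hβ : β ∈ rootSet t) :
    β ∘ₗ s ∈ rootSet t := by
  refine ⟨fun h => hβ.1 (LinearMap.ext fun H => ?_), ?_⟩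
  · have := LinearMap.congr_fun h (s H)
    simpa [hs] using this
  · obtain ⟨X, hX, h0⟩ := (Submodule.ne_bot_iff _).1 hβ.2
    exact (Submodule.ne_bot_iff _).2 ⟨w X, rootSp_map hs hw β hX, by simpa using h0⟩

variable [FiniteDimensional ℝ L]

lemma finrank_rootSp_comp {t : Submodule ℝ L} {s : t →ₗ[ℝ] t} (hs : ∀ H, s (s H) = H)
    {w : L ≃ₗ⁅ℝ⁆ L} (hw : ∀ H : t, w H = s H) (β : Module.Dual ℝ t) :
    Module.finrank ℝ (rootSp t (β ∘ₗ s)) = Module.finrank ℝ (rootSp t β) := by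
  have key : ∀ γ : Module.Dual ℝ t,
      Module.finrank ℝ (rootSp t γ) ≤ Module.finrank ℝ (rootSp t (γ ∘ₗ s)) := fun γ =>
    LinearMap.finrank_le_finrank_of_injective
      (f := (w.toLinearEquiv : L →ₗ[ℝ] L).restrict fun X hX => rootSp_map hs hw γ hX)
      fun X Y h => Subtype.ext (w.injective (congrArg Subtype.val h))
  refine le_antisymm ((key _).trans_eq ?_) (key β)
  have : (β ∘ₗ s) ∘ₗ s = β := by ext H; simp [hs]
  rw [this]

namespace IsTorusForm
variable {B : LinearMap.BilinForm ℝ L} {t : Submodule ℝ L} (hB : IsTorusForm B t)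
include hB

-- The coroot is a positive multiple of `⁅X, Y⁆` for a root pair. It is orthogonal to `ker α` for
-- both forms: the Killing form locates `Q - P` on its line, and `B` compares lengths.
omit [FiniteDimensional ℝ L] in
lemma exists_coroot {α : Module.Dual ℝ t} (hα : α ∈ rootSet t) :
    ∃ (h : t) (r k k' : ℝ) (X Y : L), 0 < r ∧ 0 < k ∧ α h = 2 ∧ IsRootPair t α X Y ∧
      ⁅X, Y⁆ = r • (h : L) ∧ (∀ H : t, B H h = k * α H) ∧
      ∀ H : t, killingForm ℝ L H h = k' * α H := by
  obtain ⟨X, hX, hX0⟩ := (Submodule.ne_bot_iff _).1 hα.2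
  obtain ⟨Y, hXY⟩ := hB.exists_isRootPair hα.1 hX
  obtain ⟨e1, -⟩ := hB.IsRootPair_self_eq hα.1 hXY
  have hpos : 0 < B Y Y := e1 ▸ hB.pos X hX0
  obtain ⟨H, h1⟩ : ∃ v, α v ≠ 0 := by
    by_contra! hc
    exact hα.1 (LinearMap.ext hc)
  set Z : t := ⟨⁅X, Y⁆, hB.mem_of_lie _ hXY.lie_lie_eq_zero⟩ with hZ
  have hBZ : ∀ H : t, B H Z = α H * B Y Y := hXY.form_lie hB.lie_left
  have hKZ : ∀ H : t, killingForm ℝ L H Z = α H * killingForm ℝ L Y Y :=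
    hXY.form_lie (LieModule.traceForm_apply_lie_apply' ℝ L L)
  have hZ0 : (Z : L) ≠ 0 := fun h => by
    have := hBZ H
    rw [h, map_zero, eq_comm, mul_eq_zero] at this
    exact this.elim h1 hpos.ne'
  have hαZ : 0 < α Z := by
    have := hB.pos _ hZ0
    rw [hBZ] at this
    exact pos_of_mul_pos_left this hpos.le
  refine ⟨(2 / α Z) • Z, α Z / 2, 2 / α Z * B Y Y, 2 / α Z * killingForm ℝ L Y Y, X, Y,
    by positivity, by positivity, ?_, hXY, ?_, fun H => ?_, fun H => ?_⟩
  · simp; field_simp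
  · simp only [Submodule.coe_smul, smul_smul]
    have : α Z / 2 * (2 / α Z) = 1 := by field_simp
    rw [this, one_smul]
  · rw [Submodule.coe_smul, map_smul, hBZ, smul_eq_mul]; ring
  · rw [Submodule.coe_smul, map_smul, hKZ, smul_eq_mul]; ring

end IsTorusForm
end Algebra

end

/-! ### Finitely many values of the Killing pairing on a conjugacy class -/

section

section Euclid
variable {V : Type*} [AddCommGroup V] [Module ℝ V] [FiniteDimensional ℝ V]
  {B : LinearMap.BilinForm ℝ V}

lemma trace_eq_sum_eigenvalues_of_form (hs : ∀ X Y, B X Y = B Y X)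
    (hp : ∀ X, X ≠ 0 → 0 < B X X) {M : Module.End ℝ V} (hM : ∀ X Y, B (M X) Y = B X (M Y)) :
    ∃ f : Fin (Module.finrank ℝ V) → ℝ, (∀ i, M.HasEigenvalue (f i)) ∧
      LinearMap.trace ℝ V M = ∑ i, f i := by
  let _ : NormedAddCommGroup V := (coreOfForm hs hp).toNormedAddCommGroup
  let _ : InnerProductSpace ℝ V := InnerProductSpace.ofCore (coreOfForm hs hp).toCore
  have hM' : M.IsSymmetric := fun X Y => hM X Y
  exact ⟨hM'.eigenvalues rfl, fun i => hM'.hasEigenvalue_eigenvalues rfl i,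
    hM'.trace_eq_sum_eigenvalues rfl⟩

lemma exists_hasEigenvector_of_form (hs : ∀ X Y, B X Y = B Y X)
    (hp : ∀ X, X ≠ 0 → 0 < B X X) {M : Module.End ℝ V} (hM : ∀ X Y, B (M X) Y = B X (M Y))
    {W : Submodule ℝ V} (hW : W ≠ ⊥) (hMW : ∀ X ∈ W, M X ∈ W) :
    ∃ X ∈ W, X ≠ 0 ∧ ∃ μ : ℝ, M X = μ • X := by
  let _ : NormedAddCommGroup V := (coreOfForm hs hp).toNormedAddCommGroup
  let _ : InnerProductSpace ℝ V := InnerProductSpace.ofCore (coreOfForm hs hp).toCore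
  have hM' : M.IsSymmetric := fun X Y => hM X Y
  have hr := hM'.restrict_invariant hMW
  have : Nontrivial W := Submodule.nontrivial_iff_ne_bot.2 hW
  obtain ⟨v, hv⟩ := hr.hasEigenvalue_iSup_of_finiteDimensional.exists_hasEigenvector
  exact ⟨v, v.2, fun h => hv.2 (Subtype.ext h), _, congrArg Subtype.val hv.apply_eq_smul⟩

/-- For commuting skew operators `A` and `D` there are finitely many possible traces of `A D`
if `D` and the spectrum of `A ^ 2` are given. -/
lemma finite_trace_mul (hs : ∀ X Y, B X Y = B Y X) (hp : ∀ X, X ≠ 0 → 0 < B X X)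
    {D : Module.End ℝ V} (hD : ∀ X Y, B (D X) Y = -B X (D Y)) {S : Set ℝ} (hS : S.Finite) :
    {r | ∃ A : Module.End ℝ V, (∀ X Y, B (A X) Y = -B X (A Y)) ∧ Commute A D ∧
      (∀ μ, (A * A).HasEigenvalue μ → μ ∈ S) ∧ r = LinearMap.trace ℝ V (A * D)}.Finite := by
  set S' : Set ℝ := {ν | (D * D).HasEigenvalue ν} with hS'
  have hfin' : S'.Finite := Module.End.finite_hasEigenvalue (D * D)
  -- `A D` is symmetric. Each eigenvalue `l` is `0` or satisfies `l² = μ ν` with `μ` in the spectrum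
  -- of `A²` and `ν` in that of `D²`.
  set Λ : Set ℝ := insert 0 (⋃ x ∈ S ×ˢ S', {l : ℝ | l ^ 2 = x.1 * x.2}) with hΛ
  have hΛfin : Λ.Finite := by
    refine Set.Finite.insert _ ((hS.prod hfin').biUnion fun x _ => ?_)
    refine (Set.toFinite {Real.sqrt (x.1 * x.2), -Real.sqrt (x.1 * x.2)}).subset fun l hl => ?_
    have hl' : l ^ 2 = x.1 * x.2 := hl
    rw [← hl', Real.sqrt_sq_eq_abs]
    rcases abs_choice l with h | h <;> rw [h] <;> simp
  refine ((Set.Finite.pi' (ι := Fin (Module.finrank ℝ V)) fun _ => hΛfin).image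
    fun f => ∑ i, f i).subset ?_
  rintro r ⟨A, hA, hc, hAS, rfl⟩
  have hAD : ∀ X, A (D X) = D (A X) := fun X => LinearMap.congr_fun hc.eq X
  obtain ⟨f, hf, htr⟩ := trace_eq_sum_eigenvalues_of_form hs hp (M := A * D) fun X Y => by
    change B (A (D X)) Y = B X (A (D Y))
    rw [hA, hD, neg_neg, hAD]
  refine ⟨f, fun i => ?_, htr.symm⟩
  set l := f i
  -- `A²` preserves the eigenspaces of `A D`, so there is a common eigenvector `u`. For it `l² u =
  -- A² D² u = μ D² u`.
  obtain ⟨u, hu, hu0, μ, hμ⟩ := exists_hasEigenvector_of_form hs hp (M := A * A)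
    (fun X Y => by
      change B (A (A X)) Y = B X (A (A Y))
      rw [hA, hA, neg_neg]) (W := (A * D).eigenspace l) (hf i)
    (fun X hX => by
      rw [Module.End.mem_eigenspace_iff] at hX ⊢
      simp only [Module.End.mul_apply] at hX ⊢
      rw [← hAD, ← hAD, hX, map_smul, map_smul])
  rw [Module.End.mem_eigenspace_iff] at hu
  simp only [Module.End.mul_apply] at hu hμ
  have h1 : (l ^ 2) • u = μ • D (D u) := by
    rw [← map_smul, ← map_smul, ← hμ, ← hAD, ← hAD, ← hAD, hu, map_smul, map_smul, hu, smul_smul, sq]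
  by_cases h0 : μ = 0
  · left
    rw [h0, zero_smul, smul_eq_zero] at h1
    exact pow_eq_zero_iff (two_ne_zero) |>.1 (h1.resolve_right hu0)
  · right
    refine Set.mem_biUnion (x := (μ, μ⁻¹ * l ^ 2)) ⟨hAS μ ?_, ?_⟩ ?_
    · exact Module.End.hasEigenvalue_of_hasEigenvector (x := u) ⟨Module.End.mem_eigenspace_iff.2 hμ, hu0⟩
    · refine Module.End.hasEigenvalue_of_hasEigenvector (x := u)
        ⟨Module.End.mem_eigenspace_iff.2 ?_, hu0⟩
      rw [← smul_smul, h1, smul_smul, inv_mul_cancel₀ h0, one_smul]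
      rfl
    · change l ^ 2 = μ * (μ⁻¹ * l ^ 2)
      field_simp
end Euclid

section Algebra
variable {L : Type*} [LieRing L] [LieAlgebra ℝ L] [FiniteDimensional ℝ L]
  {B : LinearMap.BilinForm ℝ L}

/-- An automorphism does not change the spectrum of `(ad H₀)²`, and `⁅w H₀, h⁆ = 0` makes the two
adjoint operators commute. -/
lemma finite_killingForm (hs : ∀ X Y, B X Y = B Y X) (hp : ∀ X, X ≠ 0 → 0 < B X X)
    (hl : ∀ X Y Z : L, B ⁅X, Y⁆ Z = -B Y ⁅X, Z⁆) (H₀ h : L) :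
    {r | ∃ w : L ≃ₗ⁅ℝ⁆ L, ⁅w H₀, h⁆ = 0 ∧ r = killingForm ℝ L (w H₀) h}.Finite := by
  refine (finite_trace_mul hs hp (D := LieAlgebra.ad ℝ L h) (hl h) (Module.End.finite_hasEigenvalue
    (LieAlgebra.ad ℝ L H₀ * LieAlgebra.ad ℝ L H₀))).subset ?_
  rintro r ⟨w, hw, rfl⟩
  refine ⟨LieAlgebra.ad ℝ L (w H₀), hl _, ?_, fun μ hμ => ?_, rfl⟩
  · refine LinearMap.ext fun X => ?_
    simp only [Module.End.mul_apply, LieAlgebra.ad_apply]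
    rw [leibniz_lie, hw, zero_lie, zero_add]
  · obtain ⟨v, hv⟩ := hμ.exists_hasEigenvector
    refine Module.End.hasEigenvalue_of_hasEigenvector (x := w.symm v)
      ⟨Module.End.mem_eigenspace_iff.2 (w.injective ?_), by simpa using hv.2⟩
    have := hv.apply_eq_smul
    simpa using this

omit [FiniteDimensional ℝ L] in
lemma finrank_ker_ad (w : L ≃ₗ⁅ℝ⁆ L) (X : L) :
    Module.finrank ℝ (LinearMap.ker (LieAlgebra.ad ℝ L (w X))) =
      Module.finrank ℝ (LinearMap.ker (LieAlgebra.ad ℝ L X)) := by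
  have : LinearMap.ker (LieAlgebra.ad ℝ L (w X)) =
      (LinearMap.ker (LieAlgebra.ad ℝ L X)).map (w.toLinearEquiv : L →ₗ[ℝ] L) := by
    ext Y
    simp only [LinearMap.mem_ker, Submodule.mem_map, LieAlgebra.ad_apply]
    constructor
    · intro h
      exact ⟨w.symm Y, w.injective (by simpa using h), by simp⟩
    · rintro ⟨Z, hZ, rfl⟩
      change ⁅w X, w Z⁆ = 0
      rw [← LieEquiv.map_lie, hZ, map_zero]
  rw [this]
  exact LinearEquiv.finrank_map_eq w.toLinearEquiv _

variable {t : Submodule ℝ L}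

/-- A conjugate of a regular element in the torus is regular. -/
lemma IsTorusForm.regular_of_conj (hB : IsTorusForm B t) {H₀ P : t} (hH : ∀ β ∈ rootSet t, β H₀ ≠ 0)
    (w : L ≃ₗ⁅ℝ⁆ L) (hw : w H₀ = P) : ∀ β ∈ rootSet t, β P ≠ 0 := by
  have h1 : LinearMap.ker (LieAlgebra.ad ℝ L (H₀ : L)) = t := by
    refine le_antisymm (fun X hX => ?_) fun X hX => hB.comm H₀ ⟨X, hX⟩
    exact hB.mem_of_forall_lie_eq_zero hH (C := {H₀}) (fun β hβ => ⟨H₀, rfl, hH β hβ⟩)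
      (by rintro _ rfl; exact hX)
  -- The centralizer of `H₀` is `t`, so that of `P` has the same dimension and is also `t`. A root
  -- vanishing on `P` would put its root vectors into `t`, to which they are orthogonal.
  have h2 := finrank_ker_ad w (H₀ : L)
  rw [hw, h1] at h2
  have h3 : t = LinearMap.ker (LieAlgebra.ad ℝ L (P : L)) :=
    Submodule.eq_of_le_of_finrank_eq (fun X hX => hB.comm P ⟨X, hX⟩) h2.symm
  intro β hβ h0
  obtain ⟨X, hX, hX0⟩ := (Submodule.ne_bot_iff _).1 hβ.2
  obtain ⟨Y, hY⟩ := hB.exists_isRootPair hβ.1 hX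
  have h4 : X ∈ t := by
    rw [h3, LinearMap.mem_ker, LieAlgebra.ad_apply, (hY P).1, h0, zero_smul]
  exact hX0 (hB.eq_zero_of_self (hB.rootSp_orthogonal_torus hβ.1 hX h4))

end Algebra

end

/-! ### Fixed points, Hessian and isotropy weights in terms of roots -/

section

section Orbit
variable {E : Type*} [NormedAddCommGroup E] [NormedSpace ℝ E] [FiniteDimensional ℝ E]
  [CompleteSpace E]
  {G : Type*} [TopologicalSpace G] [ChartedSpace E G] [Group G] [LieGroup 𝓘(ℝ, E) ∞ G]
  {B : LinearMap.BilinForm ℝ (LieAlg E G)}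

/-- The functional `p` is represented by the vector `P`. -/
def Represents (B : LinearMap.BilinForm ℝ (LieAlg E G)) (P : LieAlg E G) (p : CoLieAlg E G) : Prop :=
  ∀ X, p X = B P X

lemma IsInvariantInner.coAd_eq (hB : IsInvariantInner E B) {P : LieAlg E G} {p : CoLieAlg E G}
    (h : Represents B P p) (g : G) : Represents B (Ad E g P) (coAd E g p) := fun X => by
  rw [← Ad_Ad_inv g X, hB.invariant, ← h, Ad_Ad_inv]
  rfl

lemma IsInvariantInner.ext (hB : IsInvariantInner E B) {P Q : LieAlg E G}
    (h : ∀ X, B P X = B Q X) : P = Q := by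
  by_contra h0
  have := hB.pos (P - Q) (sub_ne_zero.2 h0)
  rw [map_sub B, LinearMap.sub_apply, h, sub_self] at this
  exact lt_irrefl _ this

lemma IsInvariantInner.exists_representing (hB : IsInvariantInner E B) (f : LieAlg E G →ₗ[ℝ] ℝ) :
    ∃ P, ∀ X, f X = B P X := by
  have hsurj : Function.Surjective B := by
    apply (LinearMap.injective_iff_surjective_of_finrank_eq_finrank
      (Subspace.dual_finrank_eq (K := ℝ) (V := LieAlg E G)).symm).1
    intro P Q h
    exact hB.ext fun X => by rw [h]
  obtain ⟨P, rfl⟩ := hsurj f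
  exact ⟨P, fun X => rfl⟩

lemma exists_represents_of_mem_fixedSet (hB : IsInvariantInner E B) {H₀ : LieAlg E G}
    {p₀ p : CoLieAlg E G} (h : Represents B H₀ p₀) {K : Subgroup G} (hp : p ∈ fixedSet p₀ K) :
    ∃ g : G, Represents B (Ad E g H₀) p ∧ Ad E g H₀ ∈ fixedVectors (K : Set G) := by
  obtain ⟨⟨g, rfl⟩, hfix⟩ := hp
  refine ⟨g, hB.coAd_eq h g, fun k hk => hB.ext fun X => ?_⟩
  rw [← hB.coAd_eq (hB.coAd_eq h g) k, hfix k hk, hB.coAd_eq h g]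

lemma lie_eq_zero_of_mem_fixedVectors [T2Space G] {K : Subgroup G} {X P : LieAlg E G}
    (hX : X ∈ lieAlgOf E K) (hP : P ∈ fixedVectors (K : Set G)) : ⁅X, P⁆ = 0 := by
  have hle : lieAlgOf E K ≤ LinearMap.ker ((LieModule.toEnd ℝ (LieAlg E G) (LieAlg E G) :
      LieAlg E G →ₗ[ℝ] Module.End ℝ (LieAlg E G)).flip P) := by
    refine lieAlgOf_induction fun Z γ h hγ => ?_
    exact h.lie_eq_zero fun t => hP _ (hγ t)
  exact hle hX

variable {T : Subgroup G}

lemma IsInvariantInner.isTorusForm [T2Space G] [CompactSpace G] (hB : IsInvariantInner E B)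
    (hG : LieAlgebra.IsSimple ℝ (LieAlg E G)) (hT : IsMaximalTorus T) :
    IsTorusForm B (lieAlgOf E T) := by
  have hz : LieAlgebra.center ℝ (LieAlg E G) = ⊥ := LieAlgebra.center_eq_bot ℝ _
  have := isKilling_of_form hB.symm hB.pos hB.lie_left hz
  exact ⟨hB.symm, hB.pos, hB.lie_left, fun H H' => hT.lie_eq_zero H.2 H'.2,
    fun X hX => hT.mem_lieAlgOf fun H hH => hX ⟨H, hH⟩⟩

variable (hBT : IsTorusForm B (lieAlgOf E T))
include hBT

lemma roots_eq : roots T = rootSet (lieAlgOf E T) := by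
  ext β
  exact hBT.mem_rootSet_iff.symm

variable {P : lieAlgOf E T} {p : CoLieAlg E G} (hp : Represents B P p)
include hp

lemma represents_coadInf (X : LieAlg E G) : Represents B ⁅X, (P : LieAlg E G)⁆ (coadInf X p) :=
  fun Y => by rw [coadInf_apply, hp, hBT.lie_left]

omit hp in
lemma represents_coadInf' {V : LieAlg E G} {v : CoLieAlg E G} (hv : Represents B V v)
    (X : LieAlg E G) : Represents B ⁅X, V⁆ (coadInf X v) :=
  fun Y => by rw [coadInf_apply, hv, hBT.lie_left]

omit hp in
lemma eq_of_represents {V W : LieAlg E G} {v : CoLieAlg E G} (hv : Represents B V v)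
    (hw : Represents B W v) : V = W := by
  rw [← sub_eq_zero]
  apply hBT.eq_zero_of_self
  rw [map_sub B, LinearMap.sub_apply, ← hv, ← hw, sub_self]

/-- The index of `φ` at a fixed point in terms of roots. -/
lemma morseIndex_eq {ξ : lieAlgOf E T} (hξ : ∀ β ∈ rootSet (lieAlgOf E T), β ξ ≠ 0)
    {A : Finset (TorusDual E T)} (hA : ∀ β, β ∈ A ↔ β ∈ posRoots (lieAlgOf E T) ξ ∧ 0 < β P) :
    morseIndex ξ p = ∑ β ∈ A, Module.finrank ℝ (rootSp (lieAlgOf E T) β) := by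
  have hcrit : coadInf (ξ : LieAlg E G) p = 0 := by
    ext Y
    rw [represents_coadInf hBT hp, hBT.comm]
    simp
  refine hBT.sSup_finrank_eq_sum hξ P (f := (orbitVelocity p).rangeRestrict)
    (LinearMap.surjective_rangeRestrict _) (q := hessian ξ p) (fun X => ?_) hA
  rw [hessian_eq ξ p hcrit _ X rfl]
  change coadInf X (coadInf X p) ξ = _
  -- Invariance turns both `B ⁅X, ⁅X, P⁆⁆ ξ` and `B ⁅ξ, ⁅P, X⁆⁆ X` into `-B ⁅X, P⁆ ⁅X, ξ⁆`.
  rw [represents_coadInf' hBT (represents_coadInf hBT hp X), hBT.lie_left X,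
    hBT.lie_left (ξ : LieAlg E G), ← lie_skew (P : LieAlg E G) X, ← lie_skew (ξ : LieAlg E G) X]
  simp only [map_neg, LinearMap.neg_apply, neg_neg]

/-- The vectors representing `v` and `w` form a root pair, and the positivity `ω(v, w) > 0` fixes
the sign of `η(P)`. -/
lemma exists_rootPair_of_mem_weightsOn {S : Submodule ℝ (orbitTangent p)} {η : TorusDual E T}
    (h : η ∈ weightsOn T p S) : η ∈ rootSet (lieAlgOf E T) ∧ 0 < η P ∧
      ∃ v ∈ S, ∃ w ∈ S, ∃ V W : LieAlg E G, Represents B V v ∧ Represents B W w ∧ W ≠ 0 ∧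
        IsRootPair (lieAlgOf E T) η V W := by
  obtain ⟨v, hv, w, hw, hω, hH⟩ := h
  obtain ⟨X, hX⟩ := v.2
  obtain ⟨Y, hY⟩ := w.2
  have hX' : coadInf X p = v := hX
  have hY' : coadInf Y p = w := hY
  rw [kksForm_eq p v w X Y hX' hY', hp] at hω
  have hV := represents_coadInf hBT hp X
  have hW := represents_coadInf hBT hp Y
  rw [hX'] at hV
  rw [hY'] at hW
  have hpair : IsRootPair (lieAlgOf E T) η ⁅X, (P : LieAlg E G)⁆ ⁅Y, (P : LieAlg E G)⁆ := fun H => by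
    constructor
    · refine eq_of_represents hBT (represents_coadInf' hBT hV H) ?_
      rw [(hH H).1]
      intro Z
      simp [← hW Z]
    · refine eq_of_represents hBT (represents_coadInf' hBT hW H) ?_
      rw [(hH H).2]
      intro Z
      simp [← hV Z]
  have hWW : B ⁅Y, (P : LieAlg E G)⁆ ⁅Y, (P : LieAlg E G)⁆ = η P * B P ⁅X, Y⁆ := by
    have h1 := (hpair P).2
    have h2 := hBT.lie_left (P : LieAlg E G) ⁅Y, (P : LieAlg E G)⁆ Y
    rw [h1, map_smul, LinearMap.smul_apply, hBT.lie_left X (P : LieAlg E G) Y,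
      ← lie_skew Y (P : LieAlg E G)] at h2
    rw [← lie_skew Y (P : LieAlg E G)]
    simp only [map_neg, LinearMap.neg_apply, smul_eq_mul, neg_neg] at h2 ⊢
    linarith
  have hW0 : ⁅Y, (P : LieAlg E G)⁆ ≠ 0 := fun h0 => by
    rw [← lie_skew, map_neg, ← hBT.lie_left, h0] at hω
    simp at hω
  have hηP : 0 < η P := pos_of_mul_pos_left (hWW ▸ hBT.pos _ hW0) hω.le
  refine ⟨hBT.mem_rootSet_iff.2 ⟨fun h => ?_, _, _, Or.inr hW0, hpair⟩, hηP,
    v, hv, w, hw, _, _, hV, hW, hW0, hpair⟩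
  rw [h] at hηP
  simp at hηP

lemma mem_weightsOn {S : Submodule ℝ (orbitTangent p)} {β : TorusDual E T}
    (hβ : β ∈ rootSet (lieAlgOf E T)) (hβP : 0 < β P)
    (hS : ∀ v : orbitTangent p, ∀ V ∈ rootSp (lieAlgOf E T) β, Represents B V v → v ∈ S) :
    β ∈ weightsOn T p S := by
  obtain ⟨V, hV, hV0⟩ := (Submodule.ne_bot_iff _).1 hβ.2
  obtain ⟨W, hVW⟩ := hBT.exists_isRootPair hβ.1 hV
  have hWW : 0 < B W W := (hBT.IsRootPair_self_eq hβ.1 hVW).1 ▸ hBT.pos V hV0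
  -- Chosen so that `X · p` and `Y · p` are represented by `V` and `W`.
  set X : LieAlg E G := (β P)⁻¹ • W with hXdef
  set Y : LieAlg E G := -((β P)⁻¹ • V) with hYdef
  have hX : ⁅X, (P : LieAlg E G)⁆ = V := by
    rw [hXdef, smul_lie, ← lie_skew, (hVW P).2, neg_smul, neg_neg, smul_smul, inv_mul_cancel₀ hβP.ne', one_smul]
  have hY : ⁅Y, (P : LieAlg E G)⁆ = W := by
    rw [hYdef, neg_lie, smul_lie, ← lie_skew, (hVW P).1, smul_neg, neg_neg, smul_smul, inv_mul_cancel₀ hβP.ne', one_smul]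
  have hv := represents_coadInf hBT hp X
  have hw := represents_coadInf hBT hp Y
  rw [hX] at hv
  rw [hY] at hw
  refine ⟨⟨coadInf X p, X, rfl⟩, hS _ V hV hv, ⟨coadInf Y p, Y, rfl⟩, hS _ W hVW.mem_right hw, ?_, fun H => ⟨?_, ?_⟩⟩
  · rw [kksForm_eq p _ _ X Y rfl rfl, hp]
    have h1 := hVW.form_lie hBT.lie_left P
    have h2 : ⁅X, Y⁆ = ((β P)⁻¹ * (β P)⁻¹) • ⁅V, W⁆ := by
      rw [hXdef, hYdef, lie_neg, smul_lie, lie_smul, smul_smul, ← lie_skew, smul_neg, neg_neg]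
    rw [h2, map_smul, h1, smul_eq_mul]
    positivity
  · ext Z
    rw [represents_coadInf' hBT hv, (hVW H).1]
    simp [hw Z]
  · ext Z
    rw [represents_coadInf' hBT hw, (hVW H).2]
    simp [hv Z]

lemma weights_eq : weights T p = {β ∈ rootSet (lieAlgOf E T) | 0 < β P} := by
  ext β
  constructor
  · intro h
    obtain ⟨h1, h2, -⟩ := exists_rootPair_of_mem_weightsOn hBT hp h
    exact ⟨h1, h2⟩
  · rintro ⟨h1, h2⟩
    exact mem_weightsOn hBT hp h1 h2 fun _ _ _ _ => trivial

end Orbit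

end

/-! ### Edges and reflections -/

section

section Edge
variable {E : Type*} [NormedAddCommGroup E] [NormedSpace ℝ E] [FiniteDimensional ℝ E]
  [CompleteSpace E]
  {G : Type*} [TopologicalSpace G] [ChartedSpace E G] [Group G] [LieGroup 𝓘(ℝ, E) ∞ G]
  [T2Space G] {B : LinearMap.BilinForm ℝ (LieAlg E G)}

/-- The Killing form pairing with `h` is constant on a component of a fixed point set if `h`
commutes with all the vectors that are fixed. -/
lemma killingForm_eq_of_mem_connectedComponentIn (hB : IsInvariantInner E B)
    {H₀ P Q h : LieAlg E G} {p₀ p q : CoLieAlg E G} (hp₀ : Represents B H₀ p₀)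
    (hp : Represents B P p) (hq : Represents B Q q) {K : Subgroup G} (hpK : p ∈ fixedSet p₀ K)
    (hqp : q ∈ connectedComponentIn (fixedSet p₀ K) p)
    (hh : ∀ g : G, Ad E g H₀ ∈ fixedVectors (K : Set G) → ⁅Ad E g H₀, h⁆ = 0) :
    killingForm ℝ (LieAlg E G) P h = killingForm ℝ (LieAlg E G) Q h := by
  -- Representing the Killing pairing with `h` by `B` makes it evaluation at `h'`, a continuous
  -- function on the dual. A finite set is totally disconnected, so the function is constant on the
  -- component.
  obtain ⟨h', hh'⟩ := hB.exists_representing (killingForm ℝ (LieAlg E G) h)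
  have hval : ∀ {R : LieAlg E G} {r : CoLieAlg E G}, Represents B R r →
      r h' = killingForm ℝ (LieAlg E G) R h := fun {R r} hr => by
    rw [hr, hB.symm, ← hh', LieModule.traceForm_comm]
  rw [← hval hp, ← hval hq]
  have hpre : IsPreconnected ((fun r : CoLieAlg E G => r h') ''
      connectedComponentIn (fixedSet p₀ K) p) :=
    isPreconnected_connectedComponentIn.image _ (by fun_prop)
  refine ((finite_killingForm hB.symm hB.pos hB.lie_left H₀ h).subset ?_ |>.countable.isTotallyDisconnected) _ subset_rfl hpre
    ⟨p, mem_connectedComponentIn hpK, rfl⟩ ⟨q, hqp, rfl⟩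
  rintro _ ⟨r, hr, rfl⟩
  obtain ⟨g, hg, hfix⟩ := exists_represents_of_mem_fixedSet hB hp₀
    (connectedComponentIn_subset _ _ hr)
  exact ⟨AdEquiv g, hh g hfix, hval hg⟩

variable {T K : Subgroup G} {p₀ p q : CoLieAlg E G}
  (hB : IsInvariantInner E B) (hBT : IsTorusForm B (lieAlgOf E T))
  {H₀ P Q : lieAlgOf E T} (hp₀ : Represents B H₀ p₀)
  (hH₀ : ∀ β ∈ rootSet (lieAlgOf E T), β H₀ ≠ 0)
  (hp : Represents B P p) (hq : Represents B Q q)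
  (hpT : p ∈ fixedSet p₀ T)
include hB hBT hp₀ hp hq hpT

/-- If no root vanished on `Lie K`, every conjugate of `H₀` fixed by `K` would lie in `𝔱`. The
Killing pairing with all of `𝔱` would be constant on the component, and `P - Q ∈ 𝔱` would be
Killing-orthogonal to itself. -/
lemma exists_root_vanishing (hkill : ∀ X : LieAlg E G, killingForm ℝ (LieAlg E G) X X = 0 → X = 0)
    (hH₀ : ∀ β ∈ rootSet (lieAlgOf E T), β H₀ ≠ 0) (hpq : p ≠ q) (hJ : Joins p₀ T p q K) :
    ∃ β ∈ rootSet (lieAlgOf E T), ∀ H : lieAlgOf E T, (H : LieAlg E G) ∈ lieAlgOf E K → β H = 0 := by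
  by_contra! hc
  have hkT : ∀ h ∈ lieAlgOf E T, killingForm ℝ (LieAlg E G) P h = killingForm ℝ (LieAlg E G) Q h := by
    intro h hh
    refine killingForm_eq_of_mem_connectedComponentIn hB hp₀ hp hq
      ⟨hpT.1, fun k hk => hpT.2 k (hJ.1 hk)⟩ hJ.2.2.2 fun g hg => ?_
    have hmem : Ad E g (H₀ : LieAlg E G) ∈ lieAlgOf E T :=
      hBT.mem_of_forall_lie_eq_zero hH₀ (C := {H | (H : LieAlg E G) ∈ lieAlgOf E K}) hc
        fun H hH => lie_eq_zero_of_mem_fixedVectors hH hg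
    exact hBT.comm ⟨_, hmem⟩ ⟨h, hh⟩
  have h0 : (P : LieAlg E G) - Q = 0 := by
    apply hkill
    rw [map_sub (killingForm ℝ (LieAlg E G)), LinearMap.sub_apply,
      hkT _ (sub_mem P.2 Q.2), sub_self]
  refine hpq (ContinuousLinearMap.ext fun X => ?_)
  rw [hp, hq, sub_eq_zero.1 h0]

-- The component of `Q - P` in `ker α = Lie K` is Killing-orthogonal to itself, hence zero. So `Q =
-- P + c h` with `c ≠ 0`, and equal lengths leave only `c = -α(P)`.
omit hBT in
lemma reflection_of_joins
    (hkill : ∀ X : LieAlg E G, killingForm ℝ (LieAlg E G) X X = 0 → X = 0)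
    (hnorm : B P P = B Q Q) (hpq : p ≠ q) (hJ : Joins p₀ T p q K)
    {α : TorusDual E T} (hα : ∀ H : lieAlgOf E T, (H : LieAlg E G) ∈ lieAlgOf E K ↔ α H = 0)
    {h : lieAlgOf E T} {k k' : ℝ} (hk : 0 < k) (hαh : α h = 2)
    (hBh : ∀ H : lieAlgOf E T, B H h = k * α H)
    (hKh : ∀ H : lieAlgOf E T, killingForm ℝ (LieAlg E G) H h = k' * α H) :
    Q = P - α P • h := by
  set c : ℝ := α (Q - P) / 2 with hc
  set Z : lieAlgOf E T := Q - P - c • h with hZ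
  have hαZ : α Z = 0 := by simp [hZ, hc, hαh]
  have hZK := (hα Z).2 hαZ
  have hPQ : killingForm ℝ (LieAlg E G) P Z = killingForm ℝ (LieAlg E G) Q Z :=
    killingForm_eq_of_mem_connectedComponentIn hB hp₀ hp hq
      ⟨hpT.1, fun k hk => hpT.2 k (hJ.1 hk)⟩ hJ.2.2.2 fun g hg => by
        rw [← lie_skew, lie_eq_zero_of_mem_fixedVectors hZK hg, neg_zero]
  have hZ0 : (Z : LieAlg E G) = 0 := by
    apply hkill
    have h1 : killingForm ℝ (LieAlg E G) Z h = 0 := by rw [hKh, hαZ, mul_zero]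
    have h2 : killingForm ℝ (LieAlg E G) Z Z = killingForm ℝ (LieAlg E G) Q Z -
        killingForm ℝ (LieAlg E G) P Z - c * killingForm ℝ (LieAlg E G) h Z := by
      conv_lhs => enter [1]; rw [hZ]
      simp
    rw [h2, hPQ, LieModule.traceForm_comm ℝ _ _ (h : LieAlg E G), h1, mul_zero, sub_self, sub_zero]
  have hQ : Q = P + c • h := by
    have h3 : Z = 0 := Subtype.ext hZ0
    rw [hZ, sub_sub, sub_eq_zero] at h3
    exact h3
  have hc0 : c ≠ 0 := fun h0 => hpq (ContinuousLinearMap.ext fun X => by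
    rw [hp, hq, hQ, h0, zero_smul, add_zero])
  have hsum : 2 * c * (B P h) + c * c * B h h = 0 := by
    rw [hQ] at hnorm
    simp only [Submodule.coe_add, Submodule.coe_smul, map_add, map_smul, LinearMap.add_apply,
      LinearMap.smul_apply, smul_eq_mul, hB.symm (h : LieAlg E G) P] at hnorm
    linarith
  rw [hBh, hBh, hαh] at hsum
  have hcP : c = -α P := by
    have : (2 * c * k) * (α P + c) = 0 := by linarith
    have := (mul_eq_zero.1 this).resolve_left (by positivity)
    linarith
  rw [hQ, hcP, neg_smul, sub_eq_add_neg]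

omit hp₀ hp hpT in
/-- The weight of an edge is determined by a root that vanishes on `Lie K`. -/
lemma exists_mem_weightsOn_of_vanishing (hJ : Joins p₀ T p q K) {α : TorusDual E T}
    (hα : α ∈ rootSet (lieAlgOf E T)) (hαQ : 0 < α Q)
    (hαK : ∀ H : lieAlgOf E T, (H : LieAlg E G) ∈ lieAlgOf E K → α H = 0) :
    ∃ K', Joins p₀ T p q K' ∧ α ∈ weightsOn T q (fixedTangent q K') := by
  have := topologicalGroup_of_lieGroup 𝓘(ℝ, E) ∞ (G := G)
  obtain ⟨hKT, hKcl, hdim, hcomp⟩ := hJ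
  -- Other components of `K` could act nontrivially on the root space. The closed subgroup generated
  -- by the one-parameter subgroups in `K` has the same Lie algebra, fixes the root space, and still
  -- joins `p` and `q`, since its fixed set is larger.
  set S : Set G := {g | ∃ (X : LieAlg E G) (γ : ℝ → G), IsOneParam (E := E) X γ ∧
    (∀ t, γ t ∈ K) ∧ ∃ t, γ t = g} with hS
  set K' : Subgroup G := (Subgroup.closure S).topologicalClosure with hK'
  have hSK : S ⊆ K := by
    rintro _ ⟨X, γ, -, hγ, t, rfl⟩
    exact hγ t
  have hK'K : K' ≤ K := Subgroup.topologicalClosure_minimal _ ((Subgroup.closure_le _).2 hSK) hKcl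
  have hSK' : ∀ g ∈ S, g ∈ K' := fun g hg =>
    Subgroup.le_topologicalClosure _ (Subgroup.subset_closure hg)
  have hLie : lieAlgOf E K' = lieAlgOf E K := by
    apply le_antisymm
    · exact lieAlgOf_induction fun X γ h hγ => mem_lieAlgOf_of_isOneParam h fun t => hK'K (hγ t)
    · refine lieAlgOf_induction fun X γ h hγ => mem_lieAlgOf_of_isOneParam h fun t => hSK' (γ t) ?_
      exact ⟨X, γ, h, hγ, t, rfl⟩
  refine ⟨K', ⟨hK'K.trans hKT, Subgroup.isClosed_topologicalClosure _, by rw [hLie]; exact hdim, ?_⟩, ?_⟩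
  · have hle : fixedSet p₀ K ⊆ fixedSet p₀ K' := fun r hr => ⟨hr.1, fun k hk => hr.2 k (hK'K hk)⟩
    exact connectedComponentIn_mono p hle hcomp
  · refine mem_weightsOn hBT hq hα hαQ fun v V hV hv k hk => ?_
    let F : Subgroup G :=
      { carrier := {g | Ad E g V = V}
        one_mem' := Ad_one V
        mul_mem' := fun {a b} ha hb => by
          change Ad E (a * b) V = V
          rw [Ad_mul, show Ad E b V = V from hb, show Ad E a V = V from ha]
        inv_mem' := fun {a} ha => by
          change Ad E a⁻¹ V = V
          nth_rewrite 1 [← show Ad E a V = V from ha]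
          exact Ad_inv_Ad a V }
    have hF : K' ≤ F := by
      refine Subgroup.topologicalClosure_minimal _ ((Subgroup.closure_le _).2 ?_)
        (isClosed_eq (continuous_Ad_apply V) continuous_const)
      rintro _ ⟨X, γ, h, hγ, t, rfl⟩
      refine h.Ad_eq_self ?_ t
      obtain ⟨W, hW⟩ := hBT.exists_isRootPair hα.1 hV
      have hXK : X ∈ lieAlgOf E K := mem_lieAlgOf_of_isOneParam h hγ
      have hXT : X ∈ lieAlgOf E T := mem_lieAlgOf_of_isOneParam h fun t => hKT (hγ t)
      have := (hW ⟨X, hXT⟩).1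
      rwa [hαK ⟨X, hXT⟩ hXK, zero_smul] at this
    ext Z
    rw [hB.coAd_eq hv k, show Ad E k V = V from hF hk, hv]

end Edge

end

/-! ### Combinatorics of the reflected positive roots -/

section

section Combinatorics
variable {t : Type*} [AddCommGroup t] [Module ℝ t] {R : Set (Module.Dual ℝ t)}
  {n : Module.Dual ℝ t → ℕ} {s : t →ₗ[ℝ] t} {α : Module.Dual ℝ t} {h : t}
  {ξ P Q : t} {A C : Finset (Module.Dual ℝ t)}

open Classical in
/-- A root is reflected if this keeps it positive. -/
def reflectIfPos (s : t →ₗ[ℝ] t) (ξ : t) (β : Module.Dual ℝ t) : Module.Dual ℝ t :=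
  if 0 < β (s ξ) then β ∘ₗ s else β

variable (hs : ∀ H, s H = H - α H • h) (hh : α h = 2)
include hs hh

lemma reflection_reflection (H : t) : s (s H) = H := by
  rw [hs (s H), hs H]
  simp only [map_sub, map_smul, smul_eq_mul, hh]
  module

omit hh in
lemma comp_reflection (β : Module.Dual ℝ t) : β ∘ₗ s = β - β h • α := by
  ext H
  simp [hs, mul_comm]

variable (hR : ∀ β ∈ R, β ∘ₗ s ∈ R) (hn : ∀ β, n (β ∘ₗ s) = n β)
  (hαξ : 0 < α ξ) (hαP : α P < 0) (hQ : Q = s P)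
  (hA : ∀ β, β ∈ A ↔ (β ∈ R ∧ 0 < β ξ) ∧ 0 < β P) (hC : ∀ β, β ∈ C ↔ (β ∈ R ∧ 0 < β ξ) ∧ 0 < β Q)
include hR hαξ hαP hQ hA hC

-- If `β ∘ s` stays positive on `ξ`, then `(β ∘ s)(Q) = β(P) > 0`, and it is not `α` since `α ∘ s =
-- -α`. Otherwise `β(h) > 0`, so `β(Q) = β(P) - α(P) β(h) > 0`, and `β ≠ α` because `α(P) < 0`.
open Classical in
lemma reflectIfPos_mapsTo {β : Module.Dual ℝ t} (hβ : β ∈ A) :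
    reflectIfPos s ξ β ∈ C.erase α := by
  obtain ⟨⟨h1, h2⟩, h3⟩ := (hA β).1 hβ
  have hss := reflection_reflection hs hh
  rw [reflectIfPos, Finset.mem_erase, hC]
  split_ifs with hpos
  · refine ⟨fun h0 => ?_, ⟨hR β h1, hpos⟩, by simpa [hQ, hss] using h3⟩
    have := LinearMap.congr_fun h0 (s ξ)
    rw [LinearMap.comp_apply, hss, hs ξ, map_sub, map_smul, hh, smul_eq_mul] at this
    linarith
  · refine ⟨fun h0 => ?_, ⟨h1, h2⟩, ?_⟩
    · rw [h0] at h3; linarith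
    · rw [hs, map_sub, map_smul, smul_eq_mul, not_lt] at hpos
      rw [hQ, hs, map_sub, map_smul, smul_eq_mul]
      have : 0 < β h := by
        by_contra hc
        nlinarith
      nlinarith

-- Two roots treated differently cannot collide: if `β ∘ s = γ`, then `γ ∘ s = β` is positive on
-- `ξ`, so `γ` is reflected as well.
omit hR hαξ hαP hQ hC in
lemma reflectIfPos_injOn : Set.InjOn (reflectIfPos s ξ) A := by
  have hss := reflection_reflection hs hh
  have key : ∀ β ∈ A, ∀ γ ∈ A, 0 < β (s ξ) → ¬ 0 < γ (s ξ) → β ∘ₗ s ≠ γ := by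
    intro β hβ γ hγ h1 h2 h0
    rw [← h0, LinearMap.comp_apply, hss] at h2
    exact h2 ((hA β).1 hβ).1.2
  intro β hβ γ hγ hβγ
  rw [reflectIfPos, reflectIfPos] at hβγ
  split_ifs at hβγ with h1 h2 h2
  · ext H
    have := LinearMap.congr_fun hβγ (s H)
    simpa [hss] using this
  · exact absurd hβγ (key β hβ γ hγ h1 h2)
  · exact absurd hβγ.symm (key γ hγ β hβ h2 h1)
  · exact hβγ

include hn in
open Classical in
lemma sum_add_sum_sdiff_image (hα : α ∈ C) :
    ∑ β ∈ A, n β + (∑ β ∈ C.erase α \ A.image (reflectIfPos s ξ), n β + n α) = ∑ β ∈ C, n β := by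
  have h1 : ∑ β ∈ A, n β = ∑ β ∈ A.image (reflectIfPos s ξ), n β := by
    rw [Finset.sum_image (reflectIfPos_injOn hs hh hA)]
    refine Finset.sum_congr rfl fun β _ => ?_
    rw [reflectIfPos]
    split_ifs
    · rw [hn]
    · rfl
  have h2 : A.image (reflectIfPos s ξ) ⊆ C.erase α := by
    intro γ hγ
    obtain ⟨β, hβ, rfl⟩ := Finset.mem_image.1 hγ
    exact reflectIfPos_mapsTo hs hh hR hαξ hαP hQ hA hC hβ
  rw [h1, ← add_assoc, add_comm (∑ β ∈ A.image _, n β), Finset.sum_sdiff h2,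
    Finset.sum_erase_add _ _ hα]

-- A missed root and `α` would each add at least 2 to the sum, exceeding the allowed difference of
-- 3.
include hn in
open Classical in
lemma image_reflectIfPos (hα : α ∈ C) (hn2 : ∀ β ∈ R, 2 ≤ n β)
    (hsum : ∑ β ∈ C, n β ≤ ∑ β ∈ A, n β + 3) : A.image (reflectIfPos s ξ) = C.erase α := by
  have h1 := sum_add_sum_sdiff_image hs hh hR hn hαξ hαP hQ hA hC hα
  have h2 : A.image (reflectIfPos s ξ) ⊆ C.erase α := by
    intro γ hγ
    obtain ⟨β, hβ, rfl⟩ := Finset.mem_image.1 hγ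
    exact reflectIfPos_mapsTo hs hh hR hαξ hαP hQ hA hC hβ
  refine h2.antisymm fun γ hγ => ?_
  by_contra hc
  have h3 := Finset.single_le_sum (f := n) (fun _ _ => Nat.zero_le _) (Finset.mem_sdiff.2 ⟨hγ, hc⟩)
  have h4 := hn2 γ ((hC γ).1 (Finset.mem_of_mem_erase hγ)).1.1
  have h5 := hn2 α ((hC α).1 hα).1.1
  omega

end Combinatorics

end

/-! ### Realizing the reflection, the label of an edge, and the quotient `Θ` -/

section

lemma symmetricAlgebra_ι_ne_zero {V : Type*} [AddCommGroup V] [Module ℝ V] {v : V} (hv : v ≠ 0) :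
    SymmetricAlgebra.ι ℝ V v ≠ 0 := by
  intro h0
  refine hv ((Module.forall_dual_apply_eq_zero_iff ℝ v).1 fun f => ?_)
  rw [← SymmetricAlgebra.lift_ι_apply f v, h0, map_zero]

section Edge
variable {E : Type*} [NormedAddCommGroup E] [NormedSpace ℝ E] [FiniteDimensional ℝ E]
  [CompleteSpace E]
  {G : Type*} [TopologicalSpace G] [ChartedSpace E G] [Group G] [LieGroup 𝓘(ℝ, E) ∞ G]
  [T2Space G] {B : LinearMap.BilinForm ℝ (LieAlg E G)} {T K : Subgroup G}

/-- The reflection in a root is induced by an element of the group. -/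
lemma exists_lieEquiv_reflection {α : TorusDual E T} {h : lieAlgOf E T} {r : ℝ} {X Y : LieAlg E G}
    (hr : 0 < r) (hα : α h = 2) (hXY : IsRootPair (lieAlgOf E T) α X Y)
    (hlie : ⁅X, Y⁆ = r • (h : LieAlg E G)) :
    ∃ w : LieAlg E G ≃ₗ⁅ℝ⁆ LieAlg E G, ∀ H : lieAlgOf E T,
      w H = (H - α H • h : lieAlgOf E T) := by
  obtain ⟨γ, hγ⟩ := exists_isOneParam_lieAlg X
  have hc : 0 < Real.sqrt (2 * r) := Real.sqrt_pos.2 (by positivity)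
  have hlie' : ∀ H : lieAlgOf E T, ⁅X, (H : LieAlg E G)⁆ = -(α H) • Y := fun H => by
    rw [← lie_skew, (hXY H).1, neg_smul]
  -- In the span of `X`, `Y`, `h` the group `γ` rotates `Y` and `h` with frequency `√(2r)`. Half a
  -- turn sends `h` to `-h`, while `ker α` commutes with `X` and stays fixed.
  set g := γ (Real.pi / Real.sqrt (2 * r))
  have h1 : Ad E g (h : LieAlg E G) = -h := by
    have := hγ.Ad_rotate hc hlie (by
      rw [lie_smul, hlie', hα, smul_smul, Real.sq_sqrt (by positivity)]
      congr 1; ring)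
    rw [map_smul, ← smul_neg] at this
    exact smul_right_injective _ hr.ne' this
  refine ⟨AdEquiv g, fun H => ?_⟩
  have h2 : Ad E g ((H - (α H / 2) • h : lieAlgOf E T) : LieAlg E G) =
      (H - (α H / 2) • h : lieAlgOf E T) := by
    refine hγ.Ad_eq_self ?_ _
    rw [hlie', map_sub, map_smul, hα, smul_eq_mul, div_mul_cancel₀ _ two_ne_zero, sub_self,
      neg_zero, zero_smul]
  simp only [Submodule.coe_sub, Submodule.coe_smul, map_sub, map_smul, h1, AdEquiv_apply] at h2 ⊢
  rw [sub_eq_iff_eq_add.1 h2]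
  module

/-- The label of an edge vanishes precisely on the Lie algebra of the subgroup. -/
lemma mem_lieAlgOf_iff_of_mem_weightsOn (hB : IsInvariantInner E B)
    (hBT : IsTorusForm B (lieAlgOf E T)) {p₀ p q : CoLieAlg E G} {Q : lieAlgOf E T}
    (hq : Represents B Q q) (hJ : Joins p₀ T p q K) {η : TorusDual E T}
    (hη : η ∈ weightsOn T q (fixedTangent q K)) (H : lieAlgOf E T) :
    (H : LieAlg E G) ∈ lieAlgOf E K ↔ η H = 0 := by
  obtain ⟨hroot, -, v, hv, -, -, V, W, hV, -, hW0, hVW⟩ :=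
    exists_rootPair_of_mem_weightsOn hBT hq hη
  have hfix : V ∈ fixedVectors (K : Set G) := fun k hk => by
    have h1 := hB.coAd_eq hV k
    rw [hv k hk] at h1
    exact eq_of_represents hBT h1 hV
  have hle : (lieAlgOf E K).comap (lieAlgOf E T).subtype ≤ LinearMap.ker η := fun H hH => by
    have h1 := (hVW H).1
    have h2 : ⁅(H : LieAlg E G), V⁆ = 0 := lie_eq_zero_of_mem_fixedVectors hH hfix
    rw [h2] at h1
    exact (smul_eq_zero.1 h1.symm).resolve_right hW0
  have hKT : lieAlgOf E K ≤ lieAlgOf E T :=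
    lieAlgOf_induction fun X γ h hγ => mem_lieAlgOf_of_isOneParam h fun t => hJ.1 (hγ t)
  -- `Lie K` is contained in `ker η`, and both have codimension one in `𝔱`.
  have h1 := Module.Dual.finrank_ker_add_one_of_ne_zero hroot.1
  have h2 := hJ.2.2.1
  rw [← (Submodule.comapSubtypeEquivOfLe hKT).finrank_eq] at h2
  have heq := Submodule.eq_of_le_of_finrank_eq hle (by omega)
  change H ∈ (lieAlgOf E K).comap (lieAlgOf E T).subtype ↔ _
  rw [heq, LinearMap.mem_ker]

end Edge

section Theta
variable {E : Type*} [NormedAddCommGroup E] [NormedSpace ℝ E] [FiniteDimensional ℝ E]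
  [CompleteSpace E]
  {G : Type*} [TopologicalSpace G] [ChartedSpace E G] [Group G] [LieGroup 𝓘(ℝ, E) ∞ G]
  {T : Subgroup G}

omit [FiniteDimensional ℝ E] [CompleteSpace E] [LieGroup 𝓘(ℝ, E) ∞ G] in
lemma rho_ι (ξ : lieAlgOf E T) (η β : TorusDual E T) :
    rho ξ η (SymmetricAlgebra.ι ℝ _ β) = SymmetricAlgebra.ι ℝ _ (β - ((η ξ)⁻¹ * β ξ) • η) := by
  rw [rho, SymmetricAlgebra.lift_ι_apply]
  simp

omit [CompleteSpace E] [LieGroup 𝓘(ℝ, E) ∞ G] in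
lemma exactQuot_mul_left {a b : SymT E T} (ha : a ≠ 0) : exactQuot (a * b) a = b := by
  have h : a ∣ a * b := dvd_mul_right a b
  rw [exactQuot, dif_pos h]
  exact (mul_left_cancel₀ ha (Classical.choose_spec h)).symm

/-- `Θ` is `1` if the negative weights at `p` and `q` correspond to each other modulo the label. -/
lemma Theta_eq_one {p₀ p q : CoLieAlg E G} {ξ : lieAlgOf E T} {α : TorusDual E T}
    (hα : edgeWeight p₀ T p q = α) (hα0 : α ≠ 0) (hαξ : α ξ ≠ 0) {A C : Finset (TorusDual E T)}
    (hA : negWeights ξ p = A) (hC : negWeights ξ q = C) (hαC : α ∈ C)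
    {f : TorusDual E T → TorusDual E T} (hf : Set.InjOn f A)
    (himg : ∀ γ, γ ∈ C ∧ γ ≠ α ↔ ∃ β ∈ A, f β = γ)
    (hfα : ∀ β ∈ A, ∃ c : ℝ, f β = β + c • α) (hne : ∀ β ∈ A, ∀ c : ℝ, β ≠ c • α) :
    Theta p₀ ξ p q = 1 := by
  classical
  have hp : lamMinus ξ p = ∏ β ∈ A, SymmetricAlgebra.ι ℝ _ β := by
    rw [lamMinus, hA, finprod_mem_coe_finset]
  have hq : lamMinus ξ q = SymmetricAlgebra.ι ℝ _ α *
      ∏ β ∈ A, SymmetricAlgebra.ι ℝ _ (f β) := by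
    have him : A.image f = C.erase α := by
      ext γ
      rw [Finset.mem_image, Finset.mem_erase, ← himg γ, and_comm]
    rw [lamMinus, hC, finprod_mem_coe_finset, ← Finset.mul_prod_erase C _ hαC, ← him,
      Finset.prod_image hf]
  have hrho : ∀ β ∈ A, rho ξ α (SymmetricAlgebra.ι ℝ _ (f β)) =
      rho ξ α (SymmetricAlgebra.ι ℝ _ β) := fun β hβ => by
    obtain ⟨c, hc⟩ := hfα β hβ
    rw [rho_ι, rho_ι, hc]
    congr 1
    have : (α ξ)⁻¹ * (β + c • α) ξ = (α ξ)⁻¹ * β ξ + c := by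
      simp only [LinearMap.add_apply, LinearMap.smul_apply, smul_eq_mul]
      field_simp
    rw [this]
    module
  rw [Theta, hα, hq, exactQuot_mul_left (symmetricAlgebra_ι_ne_zero hα0), hp, map_prod (rho ξ α),
    map_prod (rho ξ α), Finset.prod_congr rfl hrho]
  refine div_self ?_
  rw [Ne, map_eq_zero_iff _ (IsFractionRing.injective _ _), Finset.prod_eq_zero_iff]
  rintro ⟨β, hβ, h0⟩
  rw [rho_ι] at h0
  -- The projection kills only multiples of `α`, so no factor of the denominator vanishes.
  exact symmetricAlgebra_ι_ne_zero (sub_ne_zero.2 (hne β hβ _)) h0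

end Theta

end

/-! ### Assembling the theorem -/

/-- The coefficient of an edge of index one is `1`. -/
theorem Theta_eq_one_of_isGKMEdge {E : Type*} [NormedAddCommGroup E] [NormedSpace ℝ E]
    [FiniteDimensional ℝ E] [CompleteSpace E]
    {G : Type*} [TopologicalSpace G] [ChartedSpace E G] [Group G] [LieGroup 𝓘(ℝ, E) ∞ G]
    [T2Space G] [CompactSpace G] [ConnectedSpace G]
    (hG : LieAlgebra.IsSimple ℝ (LieAlg E G))
    (T : Subgroup G) (hT : IsMaximalTorus T)
    (B : LinearMap.BilinForm ℝ (LieAlg E G)) (hB : IsInvariantInner E B)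
    (p₀ : CoLieAlg E G) (hp₀ : IsGenericPoint B T p₀)
    (ξ : lieAlgOf E T) (hξ : IsGenericComponent p₀ T ξ)
    (p q : CoLieAlg E G) (hpq : IsGKMEdge p₀ T p q)
    (hlam : lam ξ q = lam ξ p + 1) :
    Theta p₀ ξ p q = 1 := by
  classical
  have hBT := hB.isTorusForm hG hT
  have hkill := fun X : LieAlg E G => killingForm_self_nonpos hB.symm hB.pos hB.lie_left
    (LieAlgebra.center_eq_bot ℝ _) (X := X)
  obtain ⟨H₀, hrep₀, hreg₀⟩ := hp₀
  rw [roots_eq hBT] at hreg₀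
  obtain ⟨hpT, hqT, hne, K, hK⟩ := hpq
  -- fixed points of the torus
  have hfix : ∀ r ∈ fixedSet p₀ T, ∃ R : lieAlgOf E T, Represents B R r ∧ B R R = B H₀ H₀ ∧
      ∀ β ∈ rootSet (lieAlgOf E T), β R ≠ 0 := by
    intro r hr
    obtain ⟨g, hg, hfix⟩ := exists_represents_of_mem_fixedSet hB hrep₀ hr
    rw [← hT.lieAlgOf_eq] at hfix
    exact ⟨⟨_, hfix⟩, hg, hB.invariant g _ _, hBT.regular_of_conj hreg₀ (AdEquiv g) rfl⟩
  obtain ⟨P, hP, hPn, hPreg⟩ := hfix p hpT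
  obtain ⟨Q, hQ, hQn, hQreg⟩ := hfix q hqT
  have hξ' : ∀ β ∈ rootSet (lieAlgOf E T), β ξ ≠ 0 := by
    intro β hβ
    rcases (hPreg β hβ).lt_or_gt with h | h
    · have := hξ p hpT (-β) (by
        rw [weights_eq hBT hP]
        exact ⟨neg_mem_rootSet hβ, by simpa using h⟩)
      simpa using this
    · exact hξ p hpT β (by rw [weights_eq hBT hP]; exact ⟨hβ, h⟩)
  -- the label of the edge
  obtain ⟨α, hα, hαR, hαQ, K', hK', hαK'⟩ : ∃ α, edgeWeight p₀ T p q = α ∧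
      α ∈ rootSet (lieAlgOf E T) ∧ 0 < α Q ∧ ∃ K', Joins p₀ T p q K' ∧
        ∀ H : lieAlgOf E T, (H : LieAlg E G) ∈ lieAlgOf E K' ↔ α H = 0 := by
    have hex : ∃ η, ∃ K, Joins p₀ T p q K ∧ η ∈ weightsOn T q (fixedTangent q K) := by
      obtain ⟨β, hβ, hβK⟩ := exists_root_vanishing hB hBT hrep₀ hP hQ hpT hkill hreg₀ hne hK
      rcases (hQreg β hβ).lt_or_gt with h | h
      · obtain ⟨K', h1, h2⟩ := exists_mem_weightsOn_of_vanishing hB hBT hQ hK (neg_mem_rootSet hβ)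
          (by simpa using h) (fun H hH => by simp [hβK H hH])
        exact ⟨_, K', h1, h2⟩
      · obtain ⟨K', h1, h2⟩ := exists_mem_weightsOn_of_vanishing hB hBT hQ hK hβ h hβK
        exact ⟨_, K', h1, h2⟩
    -- The label is a choice among weights for all admissible subgroups. The rest of the argument
    -- works for whichever pair was chosen.
    obtain ⟨K', hK', hw⟩ := Classical.choose_spec hex
    obtain ⟨h1, h2, -⟩ := exists_rootPair_of_mem_weightsOn hBT hQ hw
    exact ⟨Classical.choose hex, dif_pos hex, h1, h2, K', hK',
      mem_lieAlgOf_iff_of_mem_weightsOn hB hBT hQ hK' hw⟩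
  -- the reflection
  obtain ⟨h, r, k, k', X, Y, hr, hk, hαh, hXY, hlie, hBh, hKh⟩ := hBT.exists_coroot hαR
  have hQP : Q = P - α P • h := reflection_of_joins hB hrep₀ hP hQ hpT hkill
    (hPn.trans hQn.symm) hne hK' hαK' hk hαh hBh hKh
  let s : lieAlgOf E T →ₗ[ℝ] lieAlgOf E T := LinearMap.id - α.smulRight h
  have hs : ∀ H, s H = H - α H • h := fun H => rfl
  have hss := reflection_reflection hs hαh
  obtain ⟨w, hw⟩ := exists_lieEquiv_reflection hr hαh hXY hlie
  have hRs : ∀ β ∈ rootSet (lieAlgOf E T), β ∘ₗ s ∈ rootSet (lieAlgOf E T) := fun β hβ =>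
    comp_mem_rootSet hss hw hβ
  let n : TorusDual E T → ℕ := fun β => Module.finrank ℝ (rootSp (lieAlgOf E T) β)
  have hns : ∀ β, n (β ∘ₗ s) = n β := finrank_rootSp_comp hss hw
  have hn2 : ∀ β ∈ rootSet (lieAlgOf E T), 2 ≤ n β := fun β hβ => hBT.two_le_finrank_rootSp hβ
  have hαP : α P < 0 := by
    rw [hQP, map_sub, map_smul, hαh, smul_eq_mul] at hαQ
    linarith
  have hsP : Q = s P := hQP
  have hsQ : P = s Q := by rw [hsP, hss]
  -- the negative weights
  have hfin := hBT.finite_posRoots ξ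
  let A : Finset (TorusDual E T) := {β ∈ hfin.toFinset | 0 < β P}
  let C : Finset (TorusDual E T) := {β ∈ hfin.toFinset | 0 < β Q}
  have hA : ∀ β, β ∈ A ↔ β ∈ posRoots (lieAlgOf E T) ξ ∧ 0 < β P := fun β => by simp [A]
  have hC : ∀ β, β ∈ C ↔ β ∈ posRoots (lieAlgOf E T) ξ ∧ 0 < β Q := fun β => by simp [C]
  have hidp : morseIndex ξ p = ∑ β ∈ A, n β := morseIndex_eq hBT hP hξ' hA
  have hidq : morseIndex ξ q = ∑ β ∈ C, n β := morseIndex_eq hBT hQ hξ' hC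
  rw [lam, lam] at hlam
  -- Since `lam` is the index halved and rounded down, 3 rather than 2 is what follows without
  -- knowing that the indices are even.
  have hsum : morseIndex ξ q ≤ morseIndex ξ p + 3 := by omega
  have hαξ : 0 < α ξ := by
    refine lt_of_le_of_ne (not_lt.1 fun hneg => ?_) (hξ' α hαR).symm
    have hs' : ∀ H, s H = H - (-α) H • (-h) := fun H => by rw [hs]; simp
    -- If `α(ξ) < 0`, use `-α` and `-h`, which define the same `s`, with `p` and `q` exchanged. The
    -- index at `q` would then be at most that at `p`.
    have := sum_add_sum_sdiff_image (n := n) hs' (by simpa using hαh) hRs hns (by simpa using hneg)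
      (by simpa using hαQ) hsQ hC hA
      ((hA _).2 ⟨⟨neg_mem_rootSet hαR, by simpa using hneg⟩, by simpa using hαP⟩)
    have hle : morseIndex ξ q ≤ morseIndex ξ p :=
      hidq.trans_le ((Nat.le_add_right _ _).trans_eq (this.trans hidp.symm))
    omega
  have hαC : α ∈ C := (hC α).2 ⟨⟨hαR, hαξ⟩, hαQ⟩
  have himg := image_reflectIfPos hs hαh hRs hns hαξ hαP hsP hA hC hαC hn2
    (hidq.symm.trans_le (hsum.trans_eq (congrArg (· + 3) hidp)))
  refine Theta_eq_one (A := A) (C := C) (f := reflectIfPos s ξ) hα hαR.1 hαξ.ne' ?_ ?_ hαC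
    (reflectIfPos_injOn hs hαh hA) (fun γ => ?_) (fun β hβ => ?_) fun β hβ c hc => ?_
  · ext β
    rw [negWeights, weights_eq hBT hP, Finset.mem_coe, hA]
    exact and_right_comm
  · ext β
    rw [negWeights, weights_eq hBT hQ, Finset.mem_coe, hC]
    exact and_right_comm
  · rw [← Finset.mem_image, himg, Finset.mem_erase, and_comm]
  · rw [reflectIfPos]
    split_ifs
    · exact ⟨-β h, by rw [comp_reflection hs]; module⟩
    · exact ⟨0, by simp⟩
  · obtain ⟨⟨-, h1⟩, h2⟩ := (hA β).1 hβ
    rw [hc, LinearMap.smul_apply, smul_eq_mul] at h1 h2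
    have := pos_of_mul_pos_left h1 hαξ.le
    nlinarith

end CoadjointGKM

end

/-- The value `1` includes divisibility and a nonzero denominator: `exactQuot` is `0` without
divisibility, and division by `0` gives `0`. -/
theorem mainTheorem7 {E : Type*} [NormedAddCommGroup E] [NormedSpace ℝ E]
    [FiniteDimensional ℝ E] [CompleteSpace E]
    {G : Type*} [TopologicalSpace G] [ChartedSpace E G] [Group G] [LieGroup 𝓘(ℝ, E) ∞ G]
    [T2Space G] [CompactSpace G] [ConnectedSpace G]
    (hG : LieAlgebra.IsSimple ℝ (CoadjointGKM.LieAlg E G))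
    (T : Subgroup G) (hT : CoadjointGKM.IsMaximalTorus T)
    (B : LinearMap.BilinForm ℝ (CoadjointGKM.LieAlg E G)) (hB : CoadjointGKM.IsInvariantInner E B)
    (p₀ : CoadjointGKM.CoLieAlg E G) (hp₀ : CoadjointGKM.IsGenericPoint B T p₀)
    (ξ : CoadjointGKM.lieAlgOf E T) (hξ : CoadjointGKM.IsGenericComponent p₀ T ξ)
    (p q : CoadjointGKM.CoLieAlg E G) (hpq : CoadjointGKM.IsGKMEdge p₀ T p q)
    (hlam : CoadjointGKM.lam ξ q = CoadjointGKM.lam ξ p + 1) :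
    CoadjointGKM.Theta p₀ ξ p q = 1 :=
  CoadjointGKM.Theta_eq_one_of_isGKMEdge hG T hT B hB p₀ hp₀ ξ hξ p q hpq hlam
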